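/- **Formulas and logic.** Consider modal first-order formulas (connectives $\bot,\wedge,\vee,\Rightarrow$, quantifiers $\exists,\forall$, and $\Box$) in the signature $\{\in\}$ with equality; $\neg\varphi$ is $\varphi\Rightarrow\bot$, and $\forall x\in y\,\varphi$, $\exists x\in y\,\varphi$ abbreviate $\forall x\,(x\in y\Rightarrow\varphi)$, $\exists x\,(x\in y\wedge\varphi)$. $Q_{eq}.\mathsf{S4}$ is the Hilbert system for classical predicate logic, with the instantiation axiom $(\forall x\,\varphi(x))\Rightarrow\varphi(y)$ for free variables $y$, together with the identity axioms $t=t$ and $s=t\Rightarrow(\varphi(t)\Rightarrow\varphi(s))$ (for all modal $\varphi$), the modal axioms $\mathsf K$, $\mathsf T$, $\mathsf 4$, and the rules of modus ponens, generalization and necessitation. A set of axioms is *consistent* if $\bot$ is not derivable from it in $Q_{eq}.\mathsf{S4}$ (all rules, including necessitation, may be applied to the axioms). **The theory $\mathsf{eZF}$** has the following axioms ($\varphi$ is any modal formula, possibly with parameters, in which the variable $y$ of (VI) and the variable $x$ of (X) are not free): - (I) $\forall x,y\,(\Box\,\forall z\,(z\in x\Leftrightarrow z\in y)\Rightarrow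 x=y)$; - (III) $[\Box\,\forall x\,(\Box(\forall y\in x\,\varphi(y))\Rightarrow\varphi(x))]\Rightarrow\Box\,\forall x\,\varphi(x)$; - (IV) $\forall x,y\,\exists z\,\Box\,\forall u\,(u\in z\Leftrightarrow(u=x\vee u=y))$; - (V) $\forall x\,\exists y\,\Box\,\forall z\,(z\in y\Leftrightarrow\exists v\,(v\in x\wedge z\in v))$; - (VI) $\forall x\,\exists y\,\Box\,\forall z\,(z\in y\Leftrightarrow(z\in x\wedge\Box\varphi(z)))$; - (VII) $\forall x\,\exists y\,\Box\,\forall z\,(z\in y\Leftrightarrow\Box\,\forall u\,(u\in z\Rightarrow u\in x))$; - (VIII) $\exists u\,\Box\,\mathrm{Ind}(u)$, where $\mathrm{Ind}(u)$ is $\exists y\in u\,\Box(\forall z\,z\notin y)\,\wedge\,\forall y\in u\,\exists z\in u\,\Box\,\forall v\,(v\in z\Leftrightarrow(v\in y\vee v=y))$; - (X) $[\forall y\in u\,\exists z\,\Box\varphi(y,z)]\Rightarrow\exists x\,\forall y\in u\,\exists z\in x\,\Box\varphi(y,z)$. **Epistemic Church's Thesis.** Let $T(e,n,q)$ be a primitive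 recursive predicate and $U$ a primitive recursive function such that, for the $e$-th partial recursive function $\{e\}$, one has $\{e\}(n)=m$ iff $T(e,n,q)$ and $U(q)=m$ for some $q$. They are rendered in the language of sets by the usual formulas obtained from their primitive recursive definitions (primitive recursion being expressed through the existence of a set of ordered pairs that contains the course of the recursion), either as these stand or in their Gödel translation (a $\Box$ in front of every conditional and every universal quantifier). For a modal formula $\varphi(n,m)$ with parameters let $\mathsf{ECT}_\varphi(w)$ be $$[\Box\,\forall n\in w\,\exists m\in w\,\Box\varphi(n,m)]\Rightarrow[\exists e\in w\,\Box\,\forall n\in w\,\exists m\in w\,\exists q\in w\,(T(e,n,q)\wedge U(q,m)\wedge\Box\varphi(n,m))].$$ Let $\Omega(w)$ be $\Box[\mathrm{Ind}(w)\wedge\forall v\,(\mathrm{Ind}(v)\Rightarrow\forall z\in w\,(z\in v))]$, expressing that $w$ is the set of natural numbers. $\mathsf{ECT}$ consists of the axioms $\forall w\,(\Omega(w)\Rightarrow\mathsf{ECT}_\varphi(w))$ for all $\varphi$ (and for both renderings). **Stability.** The stability of atomics consists of $\Box\,\forall x,y\,(x=y\Rightarrow\Box\,x=y)$ and $\Box\,\forall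 x,y\,(x\in y\Rightarrow\Box\,x\in y)$. The stability of the negated atomic $y\notin x$ is $\mathrm{NS}:=\Box\,\forall x,y\,(y\notin x\Rightarrow\Box\,y\notin x)$. **The model.** Let $\mathcal K_1$ be Kleene's first model (the partial combinatory algebra on $\omega$ with application $en=\{e\}(n)$ and some suitable $k,s$), let $i=skk$, $\breve k=ki$, let $pab=\lambda z.zab$ be the pairing, and let $\widetilde 0=i$, $\widetilde{n+1}=p\breve k\widetilde n$. For $X,Y\subseteq\omega$ put $X\wedge Y=\{pab:a\in X,b\in Y\}$, $X\vee Y=\{pka:a\in X\}\cup\{p\breve kb:b\in Y\}$, $X\Rightarrow Y=\{e:\forall a\in X\ ea{\downarrow}\in Y\}$ and $\ominus_DX=(X\Rightarrow D)\Rightarrow D$. Let $V_0=\emptyset$, $V_{\alpha+1}=P(\omega\times V_\alpha)$, $V_\lambda=\bigcup_{\beta<\lambda}V_\beta$ for limit $\lambda$, and for $a,b\in V_\kappa$ define recursively $\|a\in b\|=\{pe_0e_1:\exists c\,(\langle e_0,c\rangle\in b\wedge e_1\in\|a=c\|)\}$ and $\|a=b\|=\{e_0:\forall\langle n,c\rangle\in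 a\ e_0n\in\|c\in b\|\}\wedge\{e_1:\forall\langle n,c\rangle\in b\ e_1n\in\|c\in a\|\}$. The modal structure $\mu[V_\kappa^{\mathcal K_1}]$ assigns to each modal formula $\varphi$ with parameters in $V_\kappa$ and each $D\subseteq\omega$ a set $\|\varphi\|_\mu(D)\subseteq\omega$: it is $\ominus_D\|\varphi\|$ for atomic $\varphi$ (with $\|\bot\|=\emptyset$); $\wedge$ and $\Rightarrow$ are interpreted by the operations above; $\|\varphi\vee\psi\|_\mu(D)=\ominus_D(\|\varphi\|_\mu(D)\vee\|\psi\|_\mu(D))$; $\|\forall z\,\varphi\|_\mu(D)=\bigcap_{c\in V_\kappa}\|\varphi(c)\|_\mu(D)$; $\|\exists z\,\varphi\|_\mu(D)=\ominus_D\bigcup_{c\in V_\kappa}\|\varphi(c)\|_\mu(D)$; $\|\Box\varphi\|_\mu(D)=\ominus_D\bigcap_{Z\subseteq\omega}\|\varphi\|_\mu(Z)$. A formula is *valid* if some $e$ satisfies $ea{\downarrow}\in\|\varphi\|_\mu(D)$ for all $a\in\omega$, all $D\subseteq\omega$ and all values in $V_\kappa$ of the free variables. Put $\overline n=\{\langle\widetilde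 m,\overline m\rangle:m<n\}$ and $\overline\omega=\{\langle\widetilde m,\overline m\rangle:m<\omega\}$. **Theorem.** The theory $\mathsf{eZF}+\mathsf{ECT}+{}$(stability of atomics) is consistent with the failure of the stability of negated atomics; indeed the theory with the additional axiom $\neg\,\mathrm{NS}$ is consistent. Moreover, for every strongly inaccessible cardinal $\kappa>\aleph_0$, the modal structure $\mu[V_\kappa^{\mathcal K_1}]$ is a witness: all axioms of $\mathsf{eZF}$, of $\mathsf{ECT}$ and of the stability of atomics are valid on it, $\neg\,\mathrm{NS}$ is valid on it, and $\mathrm{NS}$ is not valid on it; further $\overline\omega\in V_\kappa$, and $\Omega(\overline\omega)$ and all $\mathsf{ECT}_\varphi(\overline\omega)$ are valid on it. -/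

import Mathlib

universe u

namespace EpistemicSet

/-! ## Modal formulas in the signature of membership

The only terms are variables.  Variables are de Bruijn indices: `all` and `ex` bind the index `0`
and raise the other indices by one; indices that point outside all binders are free variables. -/

/-- Modal formulas in the signature whose only nonlogical symbol is membership. -/
inductive Form : Type
  | bot : Form
  | eq : ℕ → ℕ → Form
  | mem : ℕ → ℕ → Form
  | and : Form → Form → Form
  | or : Form → Form → Form
  | imp : Form → Form → Form
  | all : Form → Form
  | ex : Form → Form
  | box : Form → Form

infixr:60 " ⟹ " => Form.imp
infixr:67 " ⩕ " => Form.and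
infixr:65 " ⩖ " => Form.or

/-- The sequence `ρ` with `c` put in front. -/
def scons {X : Type*} (c : X) (ρ : ℕ → X) : ℕ → X
  | 0 => c
  | i + 1 => ρ i

namespace Form

def neg (φ : Form) : Form := φ ⟹ bot

def iff (φ ψ : Form) : Form := (φ ⟹ ψ) ⩕ (ψ ⟹ φ)

/-- A renaming of free variables, moved under one binder. -/
def liftRen (f : ℕ → ℕ) : ℕ → ℕ
  | 0 => 0
  | i + 1 => f i + 1

/-- Renaming of the free variables (capture is impossible). -/
def ren : (ℕ → ℕ) → Form → Form
  | _, bot => bot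
  | f, eq x y => eq (f x) (f y)
  | f, mem x y => mem (f x) (f y)
  | f, and φ ψ => and (ren f φ) (ren f ψ)
  | f, or φ ψ => or (ren f φ) (ren f ψ)
  | f, imp φ ψ => imp (ren f φ) (ren f ψ)
  | f, all φ => all (ren (liftRen f) φ)
  | f, ex φ => ex (ren (liftRen f) φ)
  | f, box φ => box (ren f φ)

/-- `φ` with the variable `y` put for the index `0`; the index `i + 1` becomes `i`. -/
def inst (φ : Form) (y : ℕ) : Form := φ.ren (scons y id)

/-- `φ` moved under one binder whose variable does not occur in it. -/
def shift (φ : Form) : Form := φ.ren Nat.succ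

/-- Interchange of the indices `0` and `1`. -/
def swap (φ : Form) : Form := φ.ren (Equiv.swap 0 1)

/-- The Gödel translation (only ever applied to formulas without box). -/
def godel : Form → Form
  | and φ ψ => and (godel φ) (godel ψ)
  | or φ ψ => or (godel φ) (godel ψ)
  | imp φ ψ => box (imp (godel φ) (godel ψ))
  | all φ => box (all (godel φ))
  | ex φ => ex (godel φ)
  | box φ => box (godel φ)
  | bot => bot
  | eq x y => eq x y
  | mem x y => mem x y

/-- Existential quantification of the indices `0, …, m - 1`. -/
def exN : ℕ → Form → Form
  | 0, φ => φ
  | m + 1, φ => exN m (ex φ)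

/-- Finite conjunctions. -/
def conj : (m : ℕ) → (Fin m → Form) → Form
  | 0, _ => neg bot
  | m + 1, F => F 0 ⩕ conj m (fun i => F i.succ)

end Form

open Form

/-! ## The modal predicate logic with equality -/

/-- `Prov Ax φ`: the formula `φ` is derivable in `Q_eq.S4` from the axioms `Ax` (classical
predicate logic with free-variable instantiation, the axioms K, T, 4 and the two identity axioms,
the latter for all modal formulas; the rules modus ponens, generalization and necessitation). -/
inductive Prov (Ax : Set Form) : Form → Prop
  | ax {φ : Form} : φ ∈ Ax → Prov Ax φ
  | imp_k (φ ψ : Form) : Prov Ax (φ ⟹ ψ ⟹ φ)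
  | imp_s (φ ψ χ : Form) : Prov Ax ((φ ⟹ ψ ⟹ χ) ⟹ (φ ⟹ ψ) ⟹ φ ⟹ χ)
  | and_intro (φ ψ : Form) : Prov Ax (φ ⟹ ψ ⟹ φ ⩕ ψ)
  | and_left (φ ψ : Form) : Prov Ax (φ ⩕ ψ ⟹ φ)
  | and_right (φ ψ : Form) : Prov Ax (φ ⩕ ψ ⟹ ψ)
  | or_left (φ ψ : Form) : Prov Ax (φ ⟹ φ ⩖ ψ)
  | or_right (φ ψ : Form) : Prov Ax (ψ ⟹ φ ⩖ ψ)
  | or_elim (φ ψ χ : Form) : Prov Ax ((φ ⟹ χ) ⟹ (ψ ⟹ χ) ⟹ φ ⩖ ψ ⟹ χ)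
  | dne (φ : Form) : Prov Ax (neg (neg φ) ⟹ φ)
  | all_vacuous (φ : Form) : Prov Ax (iff (all φ.shift) φ)
  | all_distrib (φ ψ : Form) : Prov Ax (all (φ ⟹ ψ) ⟹ all φ ⟹ all ψ)
  | all_perm (φ : Form) : Prov Ax (all (all φ) ⟹ all (all φ.swap))
  | all_inst (φ : Form) (y : ℕ) : Prov Ax (all φ ⟹ φ.inst y)
  | ex_def (φ : Form) : Prov Ax (iff (ex φ) (neg (all (neg φ))))
  | eq_refl (x : ℕ) : Prov Ax (eq x x)
  | eq_subst (φ : Form) (x y : ℕ) : Prov Ax (eq x y ⟹ φ.inst y ⟹ φ.inst x)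
  | box_k (φ ψ : Form) : Prov Ax (box (φ ⟹ ψ) ⟹ box φ ⟹ box ψ)
  | box_t (φ : Form) : Prov Ax (box φ ⟹ φ)
  | box_four (φ : Form) : Prov Ax (box φ ⟹ box (box φ))
  | mp {φ ψ : Form} : Prov Ax (φ ⟹ ψ) → Prov Ax φ → Prov Ax ψ
  | gen {φ : Form} : Prov Ax φ → Prov Ax (all φ)
  | nec {φ : Form} : Prov Ax φ → Prov Ax (box φ)

def Consistent (Ax : Set Form) : Prop := ¬ Prov Ax bot

/-! ## The axioms of eZF -/

/-- `∀ z, z ∉ y`. -/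
def isEmpty (y : ℕ) : Form := all (neg (mem 0 (y + 1)))

/-- `∀ v, v ∈ z ↔ v ∈ y ∨ v = y`. -/
def isSucc (z y : ℕ) : Form := all (iff (mem 0 (z + 1)) (mem 0 (y + 1) ⩖ eq 0 (y + 1)))

/-- `∀ u, u ∈ z ↔ u = x ∨ u = y`. -/
def isUPair (z x y : ℕ) : Form := all (iff (mem 0 (z + 1)) (eq 0 (x + 1) ⩖ eq 0 (y + 1)))

/-- `p` is the ordered pair `{{x}, {x, y}}`. -/
def isPair (p x y : ℕ) : Form :=
  ex (ex (isUPair 1 (x + 2) (x + 2) ⩕ isUPair 0 (x + 2) (y + 2) ⩕ isUPair (p + 2) 1 0))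

/-- `∃ y ∈ u, □ (∀ z, z ∉ y)` and `∀ y ∈ u, ∃ z ∈ u, □ ∀ v, (v ∈ z ↔ v ∈ y ∨ v = y)`. -/
def isInductive (u : ℕ) : Form :=
  ex (mem 0 (u + 1) ⩕ box (isEmpty 0)) ⩕
    all (mem 0 (u + 1) ⟹ ex (mem 0 (u + 2) ⩕ box (isSucc 0 1)))

/-- `∀ x y, □ (∀ z, (z ∈ x ↔ z ∈ y)) → x = y`. -/
def modalExt : Form := all (all (box (all (iff (mem 0 2) (mem 0 1))) ⟹ eq 1 0))

/-- `∀ x y, ∃ z, □ ∀ u, (u ∈ z ↔ u = x ∨ u = y)`. -/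
def pairing : Form := all (all (ex (box (isUPair 0 2 1))))

/-- `∀ x, ∃ y, □ ∀ z, (z ∈ y ↔ ∃ v, v ∈ x ∧ z ∈ v)`. -/
def unions : Form := all (ex (box (all (iff (mem 0 1) (ex (mem 0 3 ⩕ mem 1 0))))))

/-- `∀ x, ∃ y, □ ∀ z, (z ∈ y ↔ □ ∀ u, (u ∈ z → u ∈ x))`. -/
def modalPower : Form :=
  all (ex (box (all (iff (mem 0 1) (box (all (mem 0 1 ⟹ mem 0 3)))))))

/-- `∃ u, □ [∃ y ∈ u, □ (∀ z, z ∉ y) ∧ ∀ y ∈ u, ∃ z ∈ u, □ ∀ v, (v ∈ z ↔ v ∈ y ∨ v = y)]`. -/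
def infinity : Form := ex (box (isInductive 0))

/-- `[□ ∀ x, (□ (∀ y ∈ x, φ y) → φ x)] → □ ∀ x, φ x`.
In `φ`, the index `0` is the displayed variable and the others are parameters. -/
def modalFoundation (φ : Form) : Form :=
  box (all (box (all (mem 0 1 ⟹ φ.ren (scons 0 (· + 2)))) ⟹ φ)) ⟹
    box (all φ)

/-- `∀ x, ∃ y, □ ∀ z, (z ∈ y ↔ z ∈ x ∧ □ φ z)`.
In `φ`, the index `0` is `z`, the index `1` is `x`, the others are parameters; `y` is not free. -/
def boxComprehension (φ : Form) : Form :=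
  all (ex (box (all (iff (mem 0 1)
    (mem 0 2 ⩕ box (φ.ren (scons 0 (· + 2))))))))

/-- `[∀ y ∈ u, ∃ z, □ φ y z] → ∃ x, ∀ y ∈ u, ∃ z ∈ x, □ φ y z`.
In `φ`, the index `0` is `z`, the index `1` is `y`, the index `2` is `u`, the others are
parameters; `x` is not free. -/
def boxCollection (φ : Form) : Form :=
  all (mem 0 1 ⟹ ex (box φ)) ⟹
    ex (all (mem 0 2 ⟹ ex (mem 0 2 ⩕
      box (φ.ren (scons 0 (scons 1 (· + 3)))))))

/-- The nonlogical axioms of eZF (free variables are read universally). -/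
def eZF : Set Form :=
  {modalExt, pairing, unions, modalPower, infinity} ∪ Set.range modalFoundation ∪
    Set.range boxComprehension ∪ Set.range boxCollection

/-! ## Stability of atomics and of negated atomics -/

/-- Stability of the atomic formulas: `□ ∀ x y, (x = y → □ x = y)` and
`□ ∀ x y, (x ∈ y → □ x ∈ y)`. -/
def atomicStability : Set Form :=
  {box (all (all (eq 1 0 ⟹ box (eq 1 0)))), box (all (all (mem 1 0 ⟹ box (mem 1 0))))}

/-- Stability of the negated atomic formula `y ∉ x`: `□ ∀ x y, (y ∉ x → □ y ∉ x)`. -/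
def notMemStability : Form := box (all (all (neg (mem 0 1) ⟹ box (neg (mem 0 1)))))

/-! ## Primitive recursive functions and their set-theoretic graphs -/

/-- Definitions (derivations) of primitive recursive functions, by arity. -/
inductive PR : ℕ → Type
  | zero : PR 0
  | succ : PR 1
  | proj {n : ℕ} (i : Fin n) : PR n
  | comp {m n : ℕ} (f : PR m) (g : Fin m → PR n) : PR n
  | prec {n : ℕ} (f : PR n) (g : PR (n + 2)) : PR (n + 1)

/-- The function that is defined by a primitive recursive definition. -/
def PR.eval : {n : ℕ} → PR n → (Fin n → ℕ) → ℕ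
  | _, .zero, _ => 0
  | _, .succ, v => v 0 + 1
  | _, .proj i, v => v i
  | _, .comp f g, v => f.eval fun i => (g i).eval v
  | _, .prec f g, v =>
      Nat.rec (f.eval fun i => v i.succ)
        (fun j r => g.eval (Fin.cons j (Fin.cons r fun i => v i.succ))) (v 0)

/-- The usual set-theoretic formula (without boxes) for the graph of a primitive recursive function
on the finite ordinals: `y` is the value at the arguments `x 0, …, x (n - 1)` (all these are
variables).  In the case of primitive recursion, it says that there is a set `s` such that every
`p ∈ s` is an ordered pair `(i, v)` for which either `i = ∅` and `v` is the initial value, or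
`i = j ∪ {j}`, `(j, u) ∈ s` and `v` is the result of the recursion step on `j` and `u`; and
`(x 0, y) ∈ s`. -/
def PR.graph : {n : ℕ} → PR n → (Fin n → ℕ) → ℕ → Form
  | _, .zero, _, y => isEmpty y
  | _, .succ, x, y => isSucc y (x 0)
  | _, .proj i, x, y => eq y (x i)
  | _, .comp (m := m) f g, x, y =>
      exN m (conj m (fun i => (g i).graph (fun j => x j + m) i) ⩕ f.graph (fun i => i) (y + m))
  | _, .prec f g, x, y =>
      ex (all (mem 0 1 ⟹
          ex (ex (isPair 2 1 0 ⩕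
            ((isEmpty 1 ⩕ f.graph (fun k => x k.succ + 4) 0) ⩖
              ex (ex (ex (isSucc 4 2 ⩕ isPair 0 2 1 ⩕ mem 0 6 ⩕
                g.graph (Fin.cons 2 (Fin.cons 1 fun k => x k.succ + 7)) 3))))))) ⩕
        ex (mem 0 1 ⩕ isPair 0 (x 0 + 2) (y + 2)))

/-- Every primitive recursive function has a definition. -/
theorem PR.exists_eval {n : ℕ} {f : List.Vector ℕ n → ℕ} (hf : Nat.Primrec' f) :
    ∃ c : PR n, ∀ v, c.eval v = f (List.Vector.ofFn v) := by
  induction hf with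
  | zero => exact ⟨.zero, fun _ => rfl⟩
  | succ => exact ⟨.succ, fun v => by simp [PR.eval, List.Vector.ofFn]⟩
  | get i => exact ⟨.proj i, fun v => by simp [PR.eval]⟩
  | comp g _ _ ihf ihg =>
    obtain ⟨c, hc⟩ := ihf
    choose d hd using ihg
    exact ⟨.comp c d, fun v => by simp [PR.eval, hc, hd]⟩
  | prec _ _ ihf ihg =>
    obtain ⟨c, hc⟩ := ihf
    obtain ⟨d, hd⟩ := ihg
    refine ⟨.prec c d, fun v => ?_⟩
    simp only [PR.eval, hc, hd, List.Vector.ofFn, List.Vector.head_cons, List.Vector.tail_cons,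
      Fin.cons_zero, Fin.cons_succ]

/-! ## Kleene's predicates and Epistemic Church's Thesis

The `e`-th partial recursive function is the one computed by Mathlib's program with number `e`. -/

/-- The partial recursive function with index `e`, at the argument `n`. -/
def kleene (e n : ℕ) : Part ℕ := (Nat.Partrec.Code.ofNatCode e).eval n

/-- A primitive recursive Kleene predicate `T(e, n, q)` (expressed as `t(e, n, q) = 0`) together
with a primitive recursive output function `u`, so that `{e}(n) = m` if and only if there is a
code `q` of a halting computation of the program `e` on the input `n` with output `m = u(q)`. -/
structure KleenePredicates where
  t : PR 3
  u : PR 1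
  normalForm : ∀ e n m : ℕ, m ∈ kleene e n ↔ ∃ q, t.eval ![e, n, q] = 0 ∧ u.eval ![q] = m

instance : Nonempty KleenePredicates := by
  let g : List.Vector ℕ 3 → ℕ := fun v =>
    if Nat.Partrec.Code.evaln (v.get 2).unpair.1 (Denumerable.ofNat Nat.Partrec.Code (v.get 0))
      (v.get 1) = some (v.get 2).unpair.2 then 0 else 1
  have hg : Primrec g := by
    have h0 : Primrec fun v : List.Vector ℕ 3 => v.get 0 :=
      Primrec.vector_get.comp .id (.const 0)
    have h1 : Primrec fun v : List.Vector ℕ 3 => v.get 1 :=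
      Primrec.vector_get.comp .id (.const 1)
    have h2 : Primrec fun v : List.Vector ℕ 3 => (v.get 2).unpair :=
      Primrec.unpair.comp (Primrec.vector_get.comp .id (.const 2))
    refine Primrec.ite (Primrec.eq.comp ?_ ?_) (.const 0) (.const 1)
    · exact Nat.Partrec.Code.primrec_evaln.comp
        (((Primrec.fst.comp h2).pair ((Primrec.ofNat _).comp h0)).pair h1)
    · exact Primrec.option_some.comp (Primrec.snd.comp h2)
  have hu : Primrec fun v : List.Vector ℕ 1 => (v.get 0).unpair.2 :=
    Primrec.snd.comp (Primrec.unpair.comp (Primrec.vector_get.comp .id (.const 0)))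
  obtain ⟨t, ht⟩ := PR.exists_eval (Nat.Primrec'.of_prim hg)
  obtain ⟨u, hu⟩ := PR.exists_eval (Nat.Primrec'.of_prim hu)
  refine ⟨⟨t, u, fun e n m => ?_⟩⟩
  rw [kleene, ← Nat.Partrec.Code.ofNatCode_eq, Nat.Partrec.Code.evaln_complete]
  constructor
  · rintro ⟨k, hk⟩
    refine ⟨Nat.pair k m, ?_, ?_⟩
    · rw [ht]
      simpa [g] using hk
    · rw [hu]
      simp
  · rintro ⟨q, hq, hm⟩
    refine ⟨q.unpair.1, ?_⟩
    rw [ht] at hq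
    rw [hu] at hm
    simp only [List.Vector.get_ofFn, Matrix.cons_val_zero] at hm
    simpa [g, hm] using hq

/-- The set-theoretic formula for `T(e, n, q)`. -/
def KleenePredicates.formT (K : KleenePredicates) (e n q : ℕ) : Form :=
  ex (isEmpty 0 ⩕ K.t.graph ![e + 1, n + 1, q + 1] 0)

/-- The set-theoretic formula for `U(q, m)`. -/
def KleenePredicates.formU (K : KleenePredicates) (q m : ℕ) : Form := K.u.graph ![q] m

/-- `w` is the set of natural numbers, i.e. the least set as in the axiom of infinity:
`□ [w is inductive ∧ ∀ v, (v is inductive → w ⊆ v)]`. -/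
def isOmega (w : ℕ) : Form :=
  box (isInductive w ⩕ all (isInductive 0 ⟹ all (mem 0 (w + 2) ⟹ mem 0 1)))

/-- The instance for `φ(n, m)` of Epistemic Church's Thesis over the set `ω`:
`[□ ∀ n ∈ ω, ∃ m ∈ ω, □ φ n m] →
  ∃ e ∈ ω, □ ∀ n ∈ ω, ∃ m ∈ ω, ∃ q ∈ ω, T e n q ∧ U q m ∧ □ φ n m`.
The free variable `0` of the instance stands for `ω`.  In `φ`, the index `0` is `m`, the index `1`
is `n`, the index `2` is `ω`, the others are parameters. -/
def ectAt (T : ℕ → ℕ → ℕ → Form) (U : ℕ → ℕ → Form) (φ : Form) : Form :=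
  box (all (mem 0 1 ⟹ ex (mem 0 2 ⩕ box φ))) ⟹
    ex (mem 0 1 ⩕ box (all (mem 0 2 ⟹ ex (mem 0 3 ⩕ ex (mem 0 4 ⩕ T 3 2 0 ⩕ U 0 1 ⩕
      box (φ.ren (scons 1 (scons 2 (· + 4)))))))))

/-- All instances of Epistemic Church's Thesis over `ω`, where `T` and `U` are rendered by their
set-theoretic formulas or else by the Gödel translations of these. -/
def ectInstances (K : KleenePredicates) : Set Form :=
  {ψ | ∃ φ, ψ = ectAt K.formT K.formU φ ∨
    ψ = ectAt (fun e n q => (K.formT e n q).godel) (fun q m => (K.formU q m).godel) φ}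

/-- Epistemic Church's Thesis with its quantifiers bound to the set of natural numbers. -/
def ECT (K : KleenePredicates) : Set Form :=
  {ψ | ∃ χ ∈ ectInstances K, ψ = all (isOmega 0 ⟹ χ)}

/-! ## Partial combinatory algebras -/

/-- The structure of a partial combinatory algebra on `A`. -/
structure PCA (A : Type*) where
  app : A → A → Part A
  k : A
  s : A
  s_dom : ∀ a b, ((app s a).bind fun x => app x b).Dom
  k_app : ∀ a b, ((app k a).bind fun x => app x b) = Part.some a
  s_app : ∀ a b c, (((app s a).bind fun x => app x b).bind fun x => app x c) =
    (app a c).bind fun x => (app b c).bind fun y => app x y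

namespace PCA

variable {A : Type*} (𝒜 : PCA A)

theorem k_dom (a : A) : (𝒜.app 𝒜.k a).Dom := by
  have h : ((𝒜.app 𝒜.k a).bind fun x => 𝒜.app x a).Dom := by
    rw [𝒜.k_app]; trivial
  exact h.1

/-- `k a`. -/
def ka (a : A) : A := (𝒜.app 𝒜.k a).get (𝒜.k_dom a)

/-- `s a b`. -/
def sab (a b : A) : A := ((𝒜.app 𝒜.s a).bind fun x => 𝒜.app x b).get (𝒜.s_dom a b)

/-- The identity `s k k`. -/
def i : A := 𝒜.sab 𝒜.k 𝒜.k

/-- The second projection combinator: `kbar a b = b`. -/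
def kbar : A := 𝒜.ka 𝒜.i

/-- The pair `p a b`, for the pairing combinator `p = λ x y z. z x y`, that is, the element
`λ z. z a b = s (s i (k a)) (k b)`. -/
def pr (a b : A) : A := 𝒜.sab (𝒜.sab 𝒜.i (𝒜.ka a)) (𝒜.ka b)

/-- The Curry numerals. -/
def numeral : ℕ → A
  | 0 => 𝒜.i
  | n + 1 => 𝒜.pr 𝒜.kbar (numeral n)

/-- `e : X ⇝ Y`, i.e. `e a` is defined and in `Y` for all `a ∈ X`. -/
def Realizes (e : A) (X Y : Set A) : Prop := ∀ a ∈ X, ∃ b ∈ 𝒜.app e a, b ∈ Y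

/-! The operations of the Heyting prealgebra on the power set. -/

def hAnd (X Y : Set A) : Set A := {r | ∃ a ∈ X, ∃ b ∈ Y, r = 𝒜.pr a b}

def hOr (X Y : Set A) : Set A :=
  {r | ∃ a ∈ X, r = 𝒜.pr 𝒜.k a} ∪ {r | ∃ b ∈ Y, r = 𝒜.pr 𝒜.kbar b}

def hImp (X Y : Set A) : Set A := {e | 𝒜.Realizes e X Y}

/-- The generalized double negation `(X ⇒ D) ⇒ D`. -/
def ominus (D X : Set A) : Set A := 𝒜.hImp (𝒜.hImp X D) D

/-! ## The modal semantics -/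

variable {N : Type*} (E M : N → N → Set A)

/-- The valuation `‖φ(ρ)‖_μ(D)` of modal formulas on the modalization of the `P(A)`-valued
structure with domain `N`, identity `E`, membership `M` and classical quantifier; `ρ` assigns
elements of the domain to the free variables. -/
def val : Form → (ℕ → N) → Set A → Set A
  | .bot, _, D => 𝒜.ominus D ∅
  | .eq x y, ρ, D => 𝒜.ominus D (E (ρ x) (ρ y))
  | .mem x y, ρ, D => 𝒜.ominus D (M (ρ x) (ρ y))
  | .and φ ψ, ρ, D => 𝒜.hAnd (val φ ρ D) (val ψ ρ D)
  | .or φ ψ, ρ, D => 𝒜.ominus D (𝒜.hOr (val φ ρ D) (val ψ ρ D))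
  | .imp φ ψ, ρ, D => 𝒜.hImp (val φ ρ D) (val ψ ρ D)
  | .all φ, ρ, D => ⋂ c : N, val φ (scons c ρ) D
  | .ex φ, ρ, D => 𝒜.ominus D (⋃ c : N, val φ (scons c ρ) D)
  | .box φ, ρ, D => 𝒜.ominus D (⋂ Z : Set A, val φ ρ Z)

/-- `φ` has top value uniformly on the set `R` of assignments. -/
def ValidOn (R : Set (ℕ → N)) (φ : Form) : Prop :=
  ∃ e : A, ∀ ρ ∈ R, ∀ D : Set A, 𝒜.Realizes e Set.univ (𝒜.val E M φ ρ D)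

/-- Validity on the modal structure (uniformly in all parameters). -/
def Valid (φ : Form) : Prop := 𝒜.ValidOn E M Set.univ φ

end PCA

/-- `𝒦` is Kleene's first model: the underlying set is `ℕ` and application is application of
partial recursive functions (`k` and `s` are any suitable indices). -/
def IsKleeneFirst (𝒦 : PCA ℕ) : Prop := ∀ e n, 𝒦.app e n = kleene e n

theorem exists_isKleeneFirst : ∃ 𝒦 : PCA ℕ, IsKleeneFirst 𝒦 := by
  have hev : Partrec₂ kleene :=
    (Nat.Partrec.Code.eval_part.comp ((Computable.ofNat Nat.Partrec.Code).comp .fst) .snd).of_eq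
      fun p => by rw [kleene, ← Nat.Partrec.Code.ofNatCode_eq]
  have hk : ∀ (c : Nat.Partrec.Code) (n : ℕ), kleene (Encodable.encode c) n = c.eval n := by
    intro c n
    rw [kleene, ← Nat.Partrec.Code.ofNatCode_eq, Denumerable.ofNat_encode]
  have code : ∀ {f : ℕ →. ℕ}, Partrec f → ∃ e : Nat.Partrec.Code, e.eval = f := by
    intro f hf
    exact Nat.Partrec.Code.exists_code.1 (Partrec.nat_iff.1 hf)
  obtain ⟨ck, hck⟩ := code
    (Computable.encode.comp Nat.Partrec.Code.primrec_const.to_comp : Computable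
      fun a : ℕ => Encodable.encode (Nat.Partrec.Code.const a))
  have h1 : Computable fun v : ℕ => v.unpair.1 := (Primrec.fst.comp Primrec.unpair).to_comp
  have h2 : Computable fun v : ℕ => v.unpair.2.unpair.1 :=
    (Primrec.fst.comp (Primrec.unpair.comp (Primrec.snd.comp Primrec.unpair))).to_comp
  have h3 : Computable fun v : ℕ => v.unpair.2.unpair.2 :=
    (Primrec.snd.comp (Primrec.unpair.comp (Primrec.snd.comp Primrec.unpair))).to_comp
  obtain ⟨cf, hcf⟩ := code (f := fun v => (kleene v.unpair.1 v.unpair.2.unpair.2).bind fun x =>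
      (kleene v.unpair.2.unpair.1 v.unpair.2.unpair.2).bind fun y => kleene x y)
    (Partrec.bind (hev.comp h1 h3) (Partrec.bind (hev.comp (h2.comp .fst) (h3.comp .fst))
      (hev.comp (Computable.snd.comp .fst) .snd)))
  obtain ⟨cg, hcg⟩ := code
    (Primrec.to_comp (Primrec.encode.comp (Nat.Partrec.Code.primrec₂_curry.comp
      (Nat.Partrec.Code.primrec₂_curry.comp (.const cf) (Primrec.fst.comp Primrec.unpair))
        (Primrec.snd.comp Primrec.unpair))) : Computable
      fun v : ℕ => Encodable.encode ((cf.curry v.unpair.1).curry v.unpair.2))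
  obtain ⟨cs, hcs⟩ := code
    (Primrec.to_comp (Primrec.encode.comp
      (Nat.Partrec.Code.primrec₂_curry.comp (.const cg) .id)) : Computable
      fun a : ℕ => Encodable.encode (cg.curry a))
  refine ⟨⟨kleene, Encodable.encode ck, Encodable.encode cs, ?_, ?_, ?_⟩, fun _ _ => rfl⟩
  · intro a b
    simp [hk, hcs, hcg]
  · intro a b
    simp [hk, hck]
  · intro a b c
    simp [hk, hcs, hcg, hcf]

/-! ## McCarty's realizability model of set theory over the natural numbers -/

/-- The natural number `n` as a set. -/
def natSet : ℕ → ZFSet.{u}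
  | 0 => ∅
  | n + 1 => insert (natSet n) (natSet n)

/-- `V 0 = ∅`, `V (α + 1) = P(ℕ × V α)`, and unions are taken at limits. -/
noncomputable def V (α : Ordinal.{u}) : Set ZFSet.{u} :=
  Ordinal.limitRecOn (motive := fun _ => Set ZFSet.{u}) α ∅
    (fun _ W => {x | ∀ z ∈ x, ∃ (n : ℕ), ∃ y ∈ W, z = ZFSet.pair (natSet n) y})
    (fun l _ W => ⋃ β : Ordinal.{u}, ⋃ h : β < l, W β h)

mutual
/-- `MemR 𝒦 r a b` says that `r ∈ ‖a ∈ b‖`, where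
`‖a ∈ b‖ = {p e₀ e₁ : ∃ c, ⟨e₀, c⟩ ∈ b ∧ e₁ ∈ ‖a = c‖}`. -/
inductive MemR (𝒦 : PCA ℕ) : ℕ → ZFSet.{u} → ZFSet.{u} → Prop
  | intro {a b c : ZFSet.{u}} {e₀ e₁ : ℕ} : ZFSet.pair (natSet e₀) c ∈ b → EqR 𝒦 e₁ a c →
      MemR 𝒦 (𝒦.pr e₀ e₁) a b
/-- `EqR 𝒦 r a b` says that `r ∈ ‖a = b‖`, where `‖a = b‖` is the conjunction of
`{e₀ : ∀ ⟨n, c⟩ ∈ a, e₀ n ∈ ‖c ∈ b‖}` and `{e₁ : ∀ ⟨n, c⟩ ∈ b, e₁ n ∈ ‖c ∈ a‖}`.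
(The two recursion equations have exactly one solution since membership is well-founded.) -/
inductive EqR (𝒦 : PCA ℕ) : ℕ → ZFSet.{u} → ZFSet.{u} → Prop
  | intro {a b : ZFSet.{u}} {e₀ e₁ : ℕ} :
      (∀ n c, ZFSet.pair (natSet n) c ∈ a → (𝒦.app e₀ n).Dom) →
      (∀ n c r, ZFSet.pair (natSet n) c ∈ a → r ∈ 𝒦.app e₀ n → MemR 𝒦 r c b) →
      (∀ n c, ZFSet.pair (natSet n) c ∈ b → (𝒦.app e₁ n).Dom) →
      (∀ n c r, ZFSet.pair (natSet n) c ∈ b → r ∈ 𝒦.app e₁ n → MemR 𝒦 r c a) →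
      EqR 𝒦 (𝒦.pr e₀ e₁) a b
end

/-- The domain `V κ` of McCarty's model. -/
abbrev Dom (κ : Cardinal.{u}) : Type (u + 1) := {x : ZFSet.{u} // x ∈ V κ.ord}

/-- `‖a = b‖` in McCarty's model. -/
def eqVal (𝒦 : PCA ℕ) {κ : Cardinal.{u}} (a b : Dom κ) : Set ℕ := {r | EqR 𝒦 r a.1 b.1}

/-- `‖a ∈ b‖` in McCarty's model. -/
def memVal (𝒦 : PCA ℕ) {κ : Cardinal.{u}} (a b : Dom κ) : Set ℕ := {r | MemR 𝒦 r a.1 b.1}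

/-- Validity of a modal formula on the modalization of McCarty's model. -/
def McCartyValid (𝒦 : PCA ℕ) (κ : Cardinal.{u}) (φ : Form) : Prop :=
  𝒦.Valid (N := Dom κ) (eqVal 𝒦) (memVal 𝒦) φ

/-- Validity of a modal formula whose free variable `0` is interpreted by `w`. -/
def McCartyValidAt (𝒦 : PCA ℕ) (κ : Cardinal.{u}) (w : Dom κ) (φ : Form) : Prop :=
  𝒦.ValidOn (N := Dom κ) (eqVal 𝒦) (memVal 𝒦) {ρ | ρ 0 = w} φ

/-- The element `{⟨m̃, m̄⟩ : m < n}` that represents the number `n`, where `m̃` are the Curry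
numerals. -/
noncomputable def numBar (𝒦 : PCA ℕ) : ℕ → ZFSet.{u}
  | 0 => ∅
  | n + 1 => insert (ZFSet.pair (natSet (𝒦.numeral n)) (numBar 𝒦 n)) (numBar 𝒦 n)

/-- The element `{⟨m̃, m̄⟩ : m ∈ ℕ}` that represents the set of natural numbers. -/
noncomputable def omegaBar (𝒦 : PCA ℕ) : ZFSet.{u} :=
  ZFSet.range fun m : ℕ => ZFSet.pair (natSet (𝒦.numeral m)) (numBar.{u} 𝒦 m)

end EpistemicSet

-- Combinatory completeness and a typing calculus for realizers.

namespace EpistemicSet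

namespace PCA

-- The operation ⊖_D X = (X ⇒ D) ⇒ D is a double negation with answer set `D`, and □ asks for a
-- realizer that does not depend on `D`. Every formula value at `D` is stable under ⊖_D, by a number
-- independent of `D` and of the assignment (`exists_stable`). Hence ∨, ∃ and □ can be eliminated
-- into arbitrary formulas and classical S4 with equality is sound (`EqualityLaws.sound`). Since ⊖_∅
-- ∅ is empty, ⊥ is not valid, and so validity of the axioms gives consistency.
--
-- Validity needs one number for all assignments and all `D`. Realizers are therefore values of
-- combinatory terms, and `Den` acts as a typing judgement for terms. In the recurring pattern
-- `⟨𝒜.value _, fun ρ D => value_mem …⟩` the term is a hole that unification fills from the typing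
-- derivation; as the hole stands outside the binders, the number cannot depend on `ρ` or `D`.
--
-- Conversely, a realizer uniform in `D` may be evaluated at the very set one wants to reach. A
-- uniform map ⊖_Z X ⇒ ⊖_Z Y becomes X ⇒ Y at Z = Y (`Den.descend`). This reduces boxed statements
-- about membership to facts about McCarty's model. The sets required by eZF are then formed by
-- comprehension in the metatheory (`Dom.exists_comprehension`), with realizers recorded as first
-- components of the pairs; inaccessibility of κ keeps them inside V_κ.
--
-- For Church's Thesis (`exists_ectAt`) the hypothesis is evaluated at the set of pairs of a numeral
-- m̃ and a uniform realizer of φ(n, m). The result is a program that computes such an m from n; in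
-- Kleene's first model a program is a recursive index. What remains is to search for a computation
-- `q` and to realize the set-theoretic renderings of T and U (`exists_graph`).
--
-- Stability of negated atomics fails (`notMem_stability_eq_empty`) because a realizer uniform in
-- `D` cannot tell 0 ∉ 1 at D = {0}, which is realizable although 0 ∈ 1 is realized, from 0 ∉ 0 at D
-- = {1}. On a common input its output would have to send one and the same number to 0 and to 1.

/-- Combinatory terms with parameters from `A` and with variables from `ℕ`. -/
inductive Tm (A : Type*) : Type _
  | var : ℕ → Tm A
  | const : A → Tm A
  | app : Tm A → Tm A → Tm A

/-- The environment `γ` with the value of the variable `x` changed to `a`. -/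
def upd {A : Type*} (γ : ℕ → A) (x : ℕ) (a : A) : ℕ → A :=
  fun y => bif Nat.beq y x then a else γ y

variable {A : Type*} (𝒜 : PCA A)

/-- The value of a term in an environment. -/
def eval (γ : ℕ → A) : Tm A → Part A
  | .var x => Part.some (γ x)
  | .const a => Part.some a
  | .app t u => (eval γ t).bind fun a => (eval γ u).bind fun b => 𝒜.app a b

/-- Bracket abstraction. -/
def lam (x : ℕ) : Tm A → Tm A
  | .var y => bif Nat.beq y x then .const 𝒜.i else .app (.const 𝒜.k) (.var y)
  | .const a => .const (𝒜.ka a)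
  | .app t u => .app (.app (.const 𝒜.s) (lam x t)) (lam x u)

theorem app_k (a : A) : 𝒜.app 𝒜.k a = Part.some (𝒜.ka a) := (Part.some_get _).symm

theorem app_ka (a b : A) : 𝒜.app (𝒜.ka a) b = Part.some a := by
  have := 𝒜.k_app a b
  rwa [app_k, Part.bind_some] at this

theorem app_s (a b : A) : ((𝒜.app 𝒜.s a).bind fun x => 𝒜.app x b) = Part.some (𝒜.sab a b) :=
  (Part.some_get _).symm

theorem app_sab (a b c : A) :
    𝒜.app (𝒜.sab a b) c = (𝒜.app a c).bind fun x => (𝒜.app b c).bind fun y => 𝒜.app x y := by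
  have := 𝒜.s_app a b c
  rwa [app_s, Part.bind_some] at this

theorem app_i (a : A) : 𝒜.app 𝒜.i a = Part.some a := by
  simp [i, app_sab, app_k, app_ka]

theorem app_kbar (a : A) : 𝒜.app 𝒜.kbar a = Part.some 𝒜.i := 𝒜.app_ka _ _

theorem app_pr (a b c : A) :
    𝒜.app (𝒜.pr a b) c = (𝒜.app c a).bind fun x => 𝒜.app x b := by
  simp [pr, app_sab, app_ka, app_i]

theorem app_pr_k (a b : A) : 𝒜.app (𝒜.pr a b) 𝒜.k = Part.some a := by
  simp [app_pr, app_k, app_ka]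

theorem app_pr_kbar (a b : A) : 𝒜.app (𝒜.pr a b) 𝒜.kbar = Part.some b := by
  simp [app_pr, app_kbar, app_i]

/-- An abstraction always has a value, even if its body has none, because `s a b` is always defined.
The β-rule is therefore an equality of partial values. -/
theorem lam_spec (x : ℕ) (t : Tm A) (γ : ℕ → A) :
    ∃ e, 𝒜.eval γ (𝒜.lam x t) = Part.some e ∧ ∀ a, 𝒜.app e a = 𝒜.eval (upd γ x a) t := by
  induction t with
  | var y =>
    rcases hxy : Nat.beq y x with _ | _
    · exact ⟨𝒜.ka (γ y), by simp [lam, eval, hxy, app_k], by simp [app_ka, eval, upd, hxy]⟩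
    · exact ⟨𝒜.i, by simp [lam, eval, hxy], by simp [app_i, eval, upd, hxy]⟩
  | const b => exact ⟨𝒜.ka b, by simp [lam, eval], by simp [app_ka, eval]⟩
  | app t u iht ihu =>
    obtain ⟨e, he, he'⟩ := iht
    obtain ⟨f, hf, hf'⟩ := ihu
    exact ⟨𝒜.sab e f, by simp [lam, eval, he, hf, app_s], by simp [app_sab, eval, he', hf']⟩

/-! ### Terms that denote elements of a given set -/

/-- The term `t` has a value in the environment `γ`, and this value belongs to `X`. -/
def Den (γ : ℕ → A) (t : Tm A) (X : Set A) : Prop := ∃ a ∈ 𝒜.eval γ t, a ∈ X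

section Rules

variable {𝒜} {γ : ℕ → A} {t t' u v : Tm A} {X Y Z D : Set A} {a b : A}

variable (𝒜) in
open Classical in
/-- The value of a closed term, if there is one. -/
noncomputable def value (t : Tm A) : A :=
  if h : (𝒜.eval (fun _ => 𝒜.k) t).Dom then (𝒜.eval (fun _ => 𝒜.k) t).get h else 𝒜.k

/-- Turns a typing derivation for a term into an actual realizer. The constant environment is only a
default for the unbound variables. -/
theorem value_mem (h : 𝒜.Den (fun _ => 𝒜.k) t X) : 𝒜.value t ∈ X := by
  obtain ⟨a, ha, haX⟩ := h
  have hd := Part.dom_iff_mem.2 ⟨a, ha⟩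
  rwa [value, dif_pos hd, Part.get_eq_of_mem ha]

namespace Den

theorem mono (h : 𝒜.Den γ t X) (hXY : X ⊆ Y) : 𝒜.Den γ t Y :=
  let ⟨a, ha, haX⟩ := h; ⟨a, ha, hXY haX⟩

/-- For numeral variables `upd` computes by a Boolean test, so the hypothesis on an abstracted
argument has the required type by reduction alone. -/
theorem var (x : ℕ) (h : γ x ∈ X) : 𝒜.Den γ (.var x) X := ⟨γ x, Part.mem_some _, h⟩

theorem const (h : a ∈ X) : 𝒜.Den γ (.const a) X := ⟨a, Part.mem_some _, h⟩

theorem app (h : 𝒜.Den γ t (𝒜.hImp X Y)) (h' : 𝒜.Den γ u X) : 𝒜.Den γ (.app t u) Y := by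
  obtain ⟨e, he, heX⟩ := h
  obtain ⟨a, ha, haX⟩ := h'
  obtain ⟨b, hb, hbY⟩ := heX a haX
  exact ⟨b, Part.mem_bind he (Part.mem_bind ha hb), hbY⟩

/-- The value of the abstraction is fixed before the index `i`, so a single number serves the whole
family. Uniformity inside terms rests on this. -/
theorem lamAll {ι : Sort*} {X Y : ι → Set A} (x : ℕ)
    (h : ∀ i, ∀ a ∈ X i, 𝒜.Den (upd γ x a) t (Y i)) :
    𝒜.Den γ (𝒜.lam x t) {e | ∀ i, e ∈ 𝒜.hImp (X i) (Y i)} := by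
  obtain ⟨e, he, he'⟩ := 𝒜.lam_spec x t γ
  refine ⟨e, he ▸ Part.mem_some _, fun i a ha => ?_⟩
  rw [he']
  exact h i a ha

theorem lam (x : ℕ) (h : ∀ a ∈ X, 𝒜.Den (upd γ x a) t Y) :
    𝒜.Den γ (𝒜.lam x t) (𝒜.hImp X Y) :=
  (lamAll (ι := Unit) (X := fun _ => X) (Y := fun _ => Y) x fun _ => h).mono fun _ he => he ()

/-- Local definition, and elimination of unions. -/
theorem bind (x : ℕ) (h : 𝒜.Den γ t X) (h' : ∀ a ∈ X, 𝒜.Den (upd γ x a) u Y) :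
    𝒜.Den γ (.app (𝒜.lam x u) t) Y := app (lam x h') h

/-- The term is single-valued, so its memberships for the various `i` concern the same number. Some
index is needed to know that there is a value at all. -/
theorem iInter {ι : Sort*} [Nonempty ι] {X : ι → Set A} (h : ∀ i, 𝒜.Den γ t (X i)) :
    𝒜.Den γ t (⋂ i, X i) := by
  obtain ⟨e, he, -⟩ := h (Classical.arbitrary ι)
  refine ⟨e, he, Set.mem_iInter.2 fun j => ?_⟩
  obtain ⟨f, hf, hfX⟩ := h j
  rwa [Part.mem_unique he hf]

theorem inst {ι : Sort*} {X : ι → Set A} (h : 𝒜.Den γ t (⋂ i, X i)) (i : ι) :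
    𝒜.Den γ t (X i) := h.mono (Set.iInter_subset X i)

theorem iUnion {ι : Sort*} {X : ι → Set A} (i : ι) (h : 𝒜.Den γ t (X i)) :
    𝒜.Den γ t (⋃ i, X i) := h.mono (Set.subset_iUnion X i)

/-- The pairing combinator. -/
theorem exists_pair (𝒜 : PCA A) : ∃ e, ∀ X Y : Set A, e ∈ 𝒜.hImp X (𝒜.hImp Y (𝒜.hAnd X Y)) := by
  refine ⟨𝒜.value (𝒜.lam 0 (𝒜.lam 1
    (.app (.app (.const 𝒜.s) (.app (.app (.const 𝒜.s) (.const 𝒜.i)) (.app (.const 𝒜.k) (.var 0))))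
      (.app (.const 𝒜.k) (.var 1))))), fun X Y => value_mem ?_⟩
  refine lam 0 fun a ha => lam 1 fun b hb => ⟨𝒜.pr a b, ?_, a, ha, b, hb, rfl⟩
  simp [eval, app_k, app_s, upd, pr]
  rfl

end Den

variable (𝒜) in
/-- The pairing combinator. -/
noncomputable def pairing : A := (Den.exists_pair 𝒜).choose

variable (𝒜) in
/-- The term for a pair. -/
noncomputable def tPair (t u : Tm A) : Tm A := .app (.app (.const 𝒜.pairing) t) u

namespace Den

theorem pair (h : 𝒜.Den γ t X) (h' : 𝒜.Den γ u Y) : 𝒜.Den γ (𝒜.tPair t u) (𝒜.hAnd X Y) :=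
  app (app (const ((exists_pair 𝒜).choose_spec X Y)) h) h'

theorem fst (h : 𝒜.Den γ t (𝒜.hAnd X Y)) : 𝒜.Den γ (.app t (.const 𝒜.k)) X := by
  obtain ⟨_, he, a, ha, b, hb, rfl⟩ := h
  exact ⟨a, Part.mem_bind he (by simp [eval, app_pr_k]), ha⟩

theorem snd (h : 𝒜.Den γ t (𝒜.hAnd X Y)) : 𝒜.Den γ (.app t (.const 𝒜.kbar)) Y := by
  obtain ⟨_, he, a, ha, b, hb, rfl⟩ := h
  exact ⟨b, Part.mem_bind he (by simp [eval, app_pr_kbar]), hb⟩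

theorem inl (h : 𝒜.Den γ t X) : 𝒜.Den γ (𝒜.tPair (.const 𝒜.k) t) (𝒜.hOr X Y) :=
  (pair (const (Set.mem_singleton _)) h).mono fun _ ⟨_, hk, a, ha, he⟩ =>
    .inl ⟨a, ha, by rw [he, Set.mem_singleton_iff.1 hk]⟩

theorem inr (h : 𝒜.Den γ t Y) : 𝒜.Den γ (𝒜.tPair (.const 𝒜.kbar) t) (𝒜.hOr X Y) :=
  (pair (const (Set.mem_singleton _)) h).mono fun _ ⟨_, hk, a, ha, he⟩ =>
    .inr ⟨a, ha, by rw [he, Set.mem_singleton_iff.1 hk]⟩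

end Den

variable (𝒜) in
/-- The term for definition by cases. -/
def tCases (t u v : Tm A) : Tm A :=
  .app (.app (.app (.app t (.const 𝒜.k)) u) v) (.app t (.const 𝒜.kbar))

namespace Den

/-- Application is strict, so the branch not taken must have a value, but nothing is required of
that value. -/
theorem cases_left (ht : 𝒜.Den γ t (𝒜.hAnd {𝒜.k} X)) (hu : 𝒜.Den γ u (𝒜.hImp X Z))
    (hv : 𝒜.Den γ v Y) : 𝒜.Den γ (𝒜.tCases t u v) Z := by
  refine app ?_ (snd ht)
  obtain ⟨e, he, he'⟩ := fst ht
  obtain ⟨f, hf, hfX⟩ := hu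
  obtain ⟨g, hg, -⟩ := hv
  obtain rfl := Set.mem_singleton_iff.1 he'
  exact ⟨f, Part.mem_bind (Part.mem_bind he (Part.mem_bind hf (by
    rw [app_k]; exact Part.mem_some _))) (Part.mem_bind hg (by
      rw [app_ka]; exact Part.mem_some _)), hfX⟩

theorem cases_right (ht : 𝒜.Den γ t (𝒜.hAnd {𝒜.kbar} X)) (hu : 𝒜.Den γ u Y)
    (hv : 𝒜.Den γ v (𝒜.hImp X Z)) : 𝒜.Den γ (𝒜.tCases t u v) Z := by
  refine app ?_ (snd ht)
  obtain ⟨e, he, he'⟩ := fst ht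
  obtain ⟨f, hf, -⟩ := hu
  obtain ⟨g, hg, hgX⟩ := hv
  obtain rfl := Set.mem_singleton_iff.1 he'
  exact ⟨g, Part.mem_bind (Part.mem_bind he (Part.mem_bind hf (by
    rw [app_kbar]; exact Part.mem_some _))) (Part.mem_bind hg (by
      rw [app_i]; exact Part.mem_some _)), hgX⟩

theorem singleton_pair (ht : 𝒜.Den γ t (𝒜.hAnd {a} {b})) : 𝒜.Den γ t {𝒜.pr a b} :=
  ht.mono fun _ ⟨_, ha, _, hb, he⟩ => by
    rw [Set.mem_singleton_iff.1 ha, Set.mem_singleton_iff.1 hb] at he; exact he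

theorem cases (ht : 𝒜.Den γ t (𝒜.hOr X Y)) (hu : 𝒜.Den γ u (𝒜.hImp X Z))
    (hv : 𝒜.Den γ v (𝒜.hImp Y Z)) : 𝒜.Den γ (𝒜.tCases t u v) Z := by
  obtain ⟨_, he, ⟨a, ha, rfl⟩ | ⟨a, ha, rfl⟩⟩ := ht
  · exact cases_left ⟨_, he, _, rfl, _, ha, rfl⟩ hu hv
  · exact cases_right ⟨_, he, _, rfl, _, ha, rfl⟩ hu hv

end Den

/-! ### The generalized double negation -/

variable (𝒜) in
/-- The term for the unit `X ⇒ ⊖_D X`. -/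
def tUnit (t : Tm A) : Tm A := .app (𝒜.lam 0 (𝒜.lam 1 (.app (.var 1) (.var 0)))) t

variable (𝒜) in
/-- The term for the multiplication `⊖_D X ⇒ (X ⇒ ⊖_D Y) ⇒ ⊖_D Y`. -/
def tKleisli (t u : Tm A) : Tm A :=
  .app (.app (𝒜.lam 0 (𝒜.lam 1 (𝒜.lam 2 (.app (.var 0) (𝒜.lam 3
    (.app (.app (.var 1) (.var 3)) (.var 2))))))) t) u

namespace Den

theorem unit (h : 𝒜.Den γ t X) : 𝒜.Den γ (𝒜.tUnit t) (𝒜.ominus D X) :=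
  app (lam 0 fun _ ha => lam 1 fun _ hb => app (var 1 hb) (var 0 ha)) h

theorem kleisli' (h : 𝒜.Den γ t (𝒜.ominus D X)) (h' : 𝒜.Den γ u (𝒜.hImp X (𝒜.ominus D Y))) :
    𝒜.Den γ (𝒜.tKleisli t u) (𝒜.ominus D Y) :=
  app (app (lam 0 fun _ ha => lam 1 fun _ hb => lam 2 fun _ hc =>
    app (var 0 ha) (lam 3 fun _ hd => app (app (var 1 hb) (var 3 hd)) (var 2 hc))) h) h'

theorem kleisli (x : ℕ) (h : 𝒜.Den γ t (𝒜.ominus D X))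
    (h' : ∀ a ∈ X, 𝒜.Den (upd γ x a) u (𝒜.ominus D Y)) :
    𝒜.Den γ (𝒜.tKleisli t (𝒜.lam x u)) (𝒜.ominus D Y) := kleisli' h (lam x h')

/-- The way out of ⊖_D: if `D` has been chosen as the set to be reached, the continuation may end in
`D` itself. -/
theorem extract (h : 𝒜.Den γ t (𝒜.ominus D X)) (x : ℕ)
    (h' : ∀ a ∈ X, 𝒜.Den (upd γ x a) u D) : 𝒜.Den γ (.app t (𝒜.lam x u)) D := app h (lam x h')

end Den

/-! ### Recursion -/

/-- Self-application: with `e = λ0 λ1. t (0 0) 1`, where `t` is abstracted over its two variables,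
take `h = e e`. The inner abstraction delays the recursion and keeps `e e` defined. -/
theorem exists_fixedPoint (t : Tm A) : ∃ h, ∀ a,
    𝒜.app h a = 𝒜.eval (upd (upd (fun _ => 𝒜.k) 0 h) 1 a) t := by
  let w : Tm A := 𝒜.lam 0 (𝒜.lam 1 (.app (.app (𝒜.lam 0 (𝒜.lam 1 t)) (.app (.var 0) (.var 0)))
    (.var 1)))
  obtain ⟨e, he, he'⟩ := 𝒜.lam_spec 0 (𝒜.lam 1 (.app (.app (𝒜.lam 0 (𝒜.lam 1 t))
    (.app (.var 0) (.var 0))) (.var 1))) (fun _ => 𝒜.k)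
  obtain ⟨h, hh, hh'⟩ := 𝒜.lam_spec 1 (.app (.app (𝒜.lam 0 (𝒜.lam 1 t)) (.app (.var 0) (.var 0)))
    (.var 1)) (upd (fun _ => 𝒜.k) 0 e)
  have hee : 𝒜.app e e = Part.some h := by rw [he', hh]
  refine ⟨h, fun a => ?_⟩
  rw [hh']
  set δ := upd (upd (fun _ => 𝒜.k) 0 e) 1 a with hδ
  obtain ⟨f, hf, hf'⟩ := 𝒜.lam_spec 0 (𝒜.lam 1 t) δ
  obtain ⟨g, hg, hg'⟩ := 𝒜.lam_spec 1 t (upd δ 0 h)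
  have h0 : δ 0 = e := rfl
  have h1 : δ 1 = a := rfl
  simp only [eval, hf, h0, h1, hee, Part.bind_some, hf', hg, hg']
  congr 1
  funext y
  match y with
  | 0 => rfl
  | 1 => rfl
  | y + 2 => rfl

/-- Variable 0 of `t` is the recursive function, variable 1 its argument. The number `h` is fixed by
the recursion theorem alone; well-founded induction only verifies that it works for every index. -/
theorem exists_recursive {ι : Type*} {r : ι → ι → Prop} (hr : WellFounded r) {X Y : ι → Set A}
    (H : ∀ i h, ∀ a ∈ X i, (∀ j, r j i → h ∈ 𝒜.hImp (X j) (Y j)) →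
      𝒜.Den (upd (upd (fun _ => 𝒜.k) 0 h) 1 a) t (Y i)) :
    ∃ h, ∀ i, h ∈ 𝒜.hImp (X i) (Y i) := by
  obtain ⟨h, hh⟩ := exists_fixedPoint (𝒜 := 𝒜) t
  refine ⟨h, fun i => ?_⟩
  induction i using hr.induction with
  | _ i ih =>
    intro a ha
    rw [hh]
    exact H i h a ha ih

end Rules

end PCA
end EpistemicSet

-- Soundness of the modal predicate logic.

namespace EpistemicSet

open Form

namespace PCA

variable {A : Type*} {𝒜 : PCA A} {N : Type*} {E M : N → N → Set A}
variable {γ : ℕ → A} {t t' u v : Tm A} {X Y Z D : Set A} {a b : A}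
variable {φ ψ χ : Form} {ρ ρ' : ℕ → N}

/-! ### Every formula is stable under the generalized double negation -/

/-- Values of ⊥, atoms, ∨, ∃ and □ have the form ⊖_D X, where the multiplication of the monad does
it; ∧ and ⇒ pass to subformulas. For ∀ the realizer is the one of the matrix, since its output on a
given input is the same for all instances. -/
theorem exists_stable (𝒜 : PCA A) (E M : N → N → Set A) (φ : Form) :
    ∃ e, ∀ (ρ : ℕ → N) D, e ∈ 𝒜.hImp (𝒜.ominus D (𝒜.val E M φ ρ D)) (𝒜.val E M φ ρ D) := by
  have main : ∃ e, ∀ D X, e ∈ 𝒜.hImp (𝒜.ominus D (𝒜.ominus D X)) (𝒜.ominus D X) :=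
    ⟨𝒜.value _, fun D X => value_mem <| .lam 0 fun _ ha => .kleisli 1 (.var 0 ha) fun _ hb =>
      .var 1 hb⟩
  obtain ⟨m, hm⟩ := main
  induction φ with
  | bot => exact ⟨m, fun ρ D => hm _ _⟩
  | eq x y => exact ⟨m, fun ρ D => hm _ _⟩
  | mem x y => exact ⟨m, fun ρ D => hm _ _⟩
  | or φ ψ => exact ⟨m, fun ρ D => hm _ _⟩
  | ex φ => exact ⟨m, fun ρ D => hm _ _⟩
  | box φ => exact ⟨m, fun ρ D => hm _ _⟩
  | and φ ψ ihφ ihψ =>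
    obtain ⟨e, he⟩ := ihφ
    obtain ⟨f, hf⟩ := ihψ
    exact ⟨𝒜.value _, fun ρ D => value_mem <| .lam 0 fun _ ha => .pair
      (.app (.const (he ρ D)) (.kleisli 1 (.var 0 ha) fun _ hb => .unit (.fst (.var 1 hb))))
      (.app (.const (hf ρ D)) (.kleisli 1 (.var 0 ha) fun _ hb => .unit (.snd (.var 1 hb))))⟩
  | imp φ ψ _ ihψ =>
    obtain ⟨f, hf⟩ := ihψ
    exact ⟨𝒜.value _, fun ρ D => value_mem <| .lam 0 fun _ ha => .lam 1 fun _ hb =>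
      .app (.const (hf ρ D)) (.kleisli 2 (.var 0 ha) fun _ hc =>
        .unit (.app (.var 2 hc) (.var 1 hb)))⟩
  | all φ ihφ =>
    obtain ⟨e, he⟩ := ihφ
    refine ⟨e, fun ρ D a ha => ?_⟩
    obtain ⟨b, hb, -⟩ := he (scons (ρ 0) ρ) D a (by
      intro f hf
      exact ha f fun c hc => hf c (Set.mem_iInter.1 hc _))
    refine ⟨b, hb, Set.mem_iInter.2 fun c => ?_⟩
    obtain ⟨b', hb', h'⟩ := he (scons c ρ) D a (by
      intro f hf
      exact ha f fun c hc => hf c (Set.mem_iInter.1 hc _))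
    rwa [Part.mem_unique hb hb']

variable (𝒜 E M) in
/-- A realizer of the stability of a formula. -/
noncomputable def stable (φ : Form) : A := (exists_stable 𝒜 E M φ).choose

variable (𝒜 E M) in
theorem stable_mem (φ : Form) (ρ : ℕ → N) (D : Set A) :
    stable 𝒜 E M φ ∈ 𝒜.hImp (𝒜.ominus D (𝒜.val E M φ ρ D)) (𝒜.val E M φ ρ D) :=
  (exists_stable 𝒜 E M φ).choose_spec ρ D

namespace Den

theorem stable (h : 𝒜.Den γ t (𝒜.ominus D (𝒜.val E M φ ρ D))) :
    𝒜.Den γ (.app (.const (𝒜.stable E M φ)) t) (𝒜.val E M φ ρ D) :=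
  app (const (stable_mem 𝒜 E M φ ρ D)) h

/-- Elimination of the generalized double negation in front of the value of a formula. -/
theorem elim (x : ℕ) (h : 𝒜.Den γ t (𝒜.ominus D X))
    (h' : ∀ a ∈ X, 𝒜.Den (upd γ x a) u (𝒜.val E M φ ρ D)) :
    𝒜.Den γ (.app (.const (𝒜.stable E M φ)) (𝒜.tKleisli t (𝒜.lam x (𝒜.tUnit u))))
      (𝒜.val E M φ ρ D) := stable (kleisli x h fun a ha => unit (h' a ha))

theorem all (h : ∀ c, 𝒜.Den γ t (𝒜.val E M φ (scons c ρ) D)) :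
    𝒜.Den γ t (𝒜.val E M (.all φ) ρ D) :=
  haveI : Nonempty N := ⟨ρ 0⟩
  iInter h

theorem allElim (h : 𝒜.Den γ t (𝒜.val E M (.all φ) ρ D)) (c : N) :
    𝒜.Den γ t (𝒜.val E M φ (scons c ρ) D) := inst h c

theorem ex (c : N) (h : 𝒜.Den γ t (𝒜.val E M φ (scons c ρ) D)) :
    𝒜.Den γ (𝒜.tUnit t) (𝒜.val E M (.ex φ) ρ D) :=
  unit (iUnion (X := fun c => 𝒜.val E M φ (scons c ρ) D) c h)

theorem exElim (x : ℕ) (h : 𝒜.Den γ t (𝒜.val E M (.ex φ) ρ D))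
    (h' : ∀ c, ∀ a ∈ 𝒜.val E M φ (scons c ρ) D, 𝒜.Den (upd γ x a) u (𝒜.val E M ψ ρ' D)) :
    𝒜.Den γ (.app (.const (𝒜.stable E M ψ)) (𝒜.tKleisli t (𝒜.lam x (𝒜.tUnit u))))
      (𝒜.val E M ψ ρ' D) :=
  elim x h fun a ha => let ⟨c, hc⟩ := Set.mem_iUnion.1 ha; h' c a hc

theorem box (h : ∀ Z, 𝒜.Den γ t (𝒜.val E M φ ρ Z)) :
    𝒜.Den γ (𝒜.tUnit t) (𝒜.val E M (.box φ) ρ D) := unit (iInter h)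

theorem boxElim (x : ℕ) (h : 𝒜.Den γ t (𝒜.val E M (.box φ) ρ D))
    (h' : ∀ a, (∀ Z, a ∈ 𝒜.val E M φ ρ Z) → 𝒜.Den (upd γ x a) u (𝒜.val E M ψ ρ' D)) :
    𝒜.Den γ (.app (.const (𝒜.stable E M ψ)) (𝒜.tKleisli t (𝒜.lam x (𝒜.tUnit u))))
      (𝒜.val E M ψ ρ' D) :=
  elim x h fun a ha => h' a fun Z => Set.mem_iInter.1 ha Z

theorem cast (h : X = Y) (ht : 𝒜.Den γ t X) : 𝒜.Den γ t Y := h ▸ ht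

theorem mp (h : 𝒜.Den γ t (𝒜.val E M (φ ⟹ ψ) ρ D)) (h' : 𝒜.Den γ u (𝒜.val E M φ ρ D)) :
    𝒜.Den γ (.app t u) (𝒜.val E M ψ ρ D) := app h h'

end Den

theorem valid_iff : 𝒜.Valid E M φ ↔ ∃ e, ∀ (ρ : ℕ → N) D, e ∈ 𝒜.val E M φ ρ D := by
  constructor
  · rintro ⟨e, he⟩
    exact ⟨𝒜.value _, fun ρ D => value_mem <| .app (.const (he ρ trivial D)) (.const (a := 𝒜.k) trivial)⟩
  · rintro ⟨e, he⟩
    exact ⟨𝒜.value _, fun ρ _ D => value_mem <| .lam 0 fun _ _ => .const (he ρ D)⟩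

theorem scons_comp_liftRen (c : N) (ρ : ℕ → N) (f : ℕ → ℕ) :
    (fun j => scons c ρ (liftRen f j)) = scons c fun j => ρ (f j) := by
  funext j; cases j <;> rfl

theorem val_ren (φ : Form) (f : ℕ → ℕ) (ρ : ℕ → N) (D : Set A) :
    𝒜.val E M (φ.ren f) ρ D = 𝒜.val E M φ (fun j => ρ (f j)) D := by
  induction φ generalizing f ρ D with
  | bot => rfl
  | eq x y => rfl
  | mem x y => rfl
  | and φ ψ ihφ ihψ => simp only [ren, val, ihφ, ihψ]
  | or φ ψ ihφ ihψ => simp only [ren, val, ihφ, ihψ]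
  | imp φ ψ ihφ ihψ => simp only [ren, val, ihφ, ihψ]
  | all φ ih => simp only [ren, val, ih, scons_comp_liftRen]
  | ex φ ih => simp only [ren, val, ih, scons_comp_liftRen]
  | box φ ih => simp only [ren, val, ih]

theorem val_inst (φ : Form) (y : ℕ) (ρ : ℕ → N) (D : Set A) :
    𝒜.val E M (φ.inst y) ρ D = 𝒜.val E M φ (scons (ρ y) ρ) D := by
  rw [inst, val_ren]
  congr 1; funext j; cases j <;> rfl

theorem val_shift (φ : Form) (c : N) (ρ : ℕ → N) (D : Set A) :
    𝒜.val E M φ.shift (scons c ρ) D = 𝒜.val E M φ ρ D := val_ren _ _ _ _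

theorem val_swap (φ : Form) (c d : N) (ρ : ℕ → N) (D : Set A) :
    𝒜.val E M φ.swap (scons c (scons d ρ)) D = 𝒜.val E M φ (scons d (scons c ρ)) D := by
  rw [swap, val_ren]
  congr 1; funext j
  match j with
  | 0 => rfl
  | 1 => rfl
  | j + 2 => rw [Equiv.swap_apply_of_ne_of_ne (by omega) (by omega)]; rfl

/-! ### Substitution of realizably equal elements -/

/-- Realizers of the laws of equality. -/
structure EqualityLaws (𝒜 : PCA A) (E M : N → N → Set A) where
  refl : A
  refl_mem (a : N) : refl ∈ E a a
  symm : A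
  symm_mem (a b : N) : symm ∈ 𝒜.hImp (E a b) (E b a)
  trans : A
  trans_mem (a b c : N) : trans ∈ 𝒜.hImp (E a b) (𝒜.hImp (E b c) (E a c))
  left : A
  left_mem (a b c : N) : left ∈ 𝒜.hImp (E a b) (𝒜.hImp (M a c) (M b c))
  right : A
  right_mem (a b c : N) : right ∈ 𝒜.hImp (E a b) (𝒜.hImp (M c a) (M c b))

/-- Allowing assignments to differ at an arbitrary index `i` lets the induction pass binders, where
`i` becomes `i + 1`. The hypothesis is `E` itself rather than ⊖_D of it, so it remains available
under a box. -/
theorem EqualityLaws.exists_subst (L : EqualityLaws 𝒜 E M) (φ : Form) (i : ℕ) :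
    ∃ e, ∀ (ρ ρ' : ℕ → N), (∀ j ≠ i, ρ j = ρ' j) → ∀ D,
      e ∈ 𝒜.hImp (E (ρ i) (ρ' i)) (𝒜.hImp (𝒜.val E M φ ρ D) (𝒜.val E M φ ρ' D)) := by
  have hvar (x i : ℕ) : ∃ e, ∀ (ρ ρ' : ℕ → N), (∀ j ≠ i, ρ j = ρ' j) →
      e ∈ 𝒜.hImp (E (ρ i) (ρ' i)) (E (ρ x) (ρ' x)) := by
    by_cases hx : x = i
    · subst hx
      exact ⟨𝒜.value _, fun ρ ρ' _ => value_mem <| .lam 0 fun _ ha => .var 0 ha⟩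
    · refine ⟨𝒜.value _, fun ρ ρ' h => value_mem <| .lam 0 fun _ _ => .const (a := L.refl) ?_⟩
      rw [h x hx]
      exact L.refl_mem _
  have hs : ∀ {ρ ρ' : ℕ → N} {i}, (∀ j ≠ i, ρ j = ρ' j) → ∀ j ≠ i, ρ' j = ρ j :=
    fun h j hj => (h j hj).symm
  have hc : ∀ {ρ ρ' : ℕ → N} {i} (c : N), (∀ j ≠ i, ρ j = ρ' j) →
      ∀ j ≠ i + 1, scons c ρ j = scons c ρ' j := by
    intro ρ ρ' i c h j hj
    cases j with
    | zero => rfl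
    | succ j => exact h j (by omega)
  induction φ generalizing i with
  | bot => exact ⟨𝒜.value _, fun ρ ρ' _ D => value_mem <| .lam 0 fun _ _ => .lam 1 fun _ hb =>
      .var 1 hb⟩
  | eq x y =>
    obtain ⟨e, he⟩ := hvar x i
    obtain ⟨f, hf⟩ := hvar y i
    exact ⟨𝒜.value _, fun ρ ρ' h D => value_mem <| .lam 0 fun _ ha => .lam 1 fun _ hb =>
      .kleisli 2 (.var 1 hb) fun _ hc => .unit <|
        .app (.app (.const (L.trans_mem _ _ _))
          (.app (.const (L.symm_mem _ _)) (.app (.const (he ρ ρ' h)) (.var 0 ha))))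
          (.app (.app (.const (L.trans_mem _ _ _)) (.var 2 hc))
            (.app (.const (hf ρ ρ' h)) (.var 0 ha)))⟩
  | mem x y =>
    obtain ⟨e, he⟩ := hvar x i
    obtain ⟨f, hf⟩ := hvar y i
    exact ⟨𝒜.value _, fun ρ ρ' h D => value_mem <| .lam 0 fun _ ha => .lam 1 fun _ hb =>
      .kleisli 2 (.var 1 hb) fun _ hc => .unit <|
        .app (.app (.const (L.left_mem _ _ _)) (.app (.const (he ρ ρ' h)) (.var 0 ha)))
          (.app (.app (.const (L.right_mem _ _ _)) (.app (.const (hf ρ ρ' h)) (.var 0 ha)))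
            (.var 2 hc))⟩
  | and φ ψ ihφ ihψ =>
    obtain ⟨e, he⟩ := ihφ i
    obtain ⟨f, hf⟩ := ihψ i
    exact ⟨𝒜.value _, fun ρ ρ' h D => value_mem <| .lam 0 fun _ ha => .lam 1 fun _ hb =>
      .pair (.app (.app (.const (he ρ ρ' h D)) (.var 0 ha)) (.fst (.var 1 hb)))
        (.app (.app (.const (hf ρ ρ' h D)) (.var 0 ha)) (.snd (.var 1 hb)))⟩
  | or φ ψ ihφ ihψ =>
    obtain ⟨e, he⟩ := ihφ i
    obtain ⟨f, hf⟩ := ihψ i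
    exact ⟨𝒜.value _, fun ρ ρ' h D => value_mem <| .lam 0 fun _ ha => .lam 1 fun _ hb =>
      .kleisli 2 (.var 1 hb) fun _ hc => .unit <| .cases (.var 2 hc)
        (.lam 3 fun _ hd => .inl (.app (.app (.const (he ρ ρ' h D)) (.var 0 ha)) (.var 3 hd)))
        (.lam 3 fun _ hd => .inr (.app (.app (.const (hf ρ ρ' h D)) (.var 0 ha)) (.var 3 hd)))⟩
  | imp φ ψ ihφ ihψ =>
    obtain ⟨e, he⟩ := ihφ i
    obtain ⟨f, hf⟩ := ihψ i
    exact ⟨𝒜.value _, fun ρ ρ' h D => value_mem <| .lam 0 fun _ ha => .lam 1 fun _ hb =>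
      .lam 2 fun _ hc => .app (.app (.const (hf ρ ρ' h D)) (.var 0 ha)) (.app (.var 1 hb)
        (.app (.app (.const (he ρ' ρ (hs h) D)) (.app (.const (L.symm_mem _ _)) (.var 0 ha)))
          (.var 2 hc)))⟩
  | all φ ih =>
    obtain ⟨e, he⟩ := ih (i + 1)
    exact ⟨𝒜.value _, fun ρ ρ' h D => value_mem <| .lam 0 fun _ ha => .lam 1 fun _ hb =>
      .all fun c => .app (.app (.const (he _ _ (hc c h) D)) (.var 0 ha)) (.allElim (.var 1 hb) c)⟩
  | ex φ ih =>
    obtain ⟨e, he⟩ := ih (i + 1)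
    exact ⟨𝒜.value _, fun ρ ρ' h D => value_mem <| .lam 0 fun _ ha => .lam 1 fun _ hb =>
      .exElim 2 (.var 1 hb) fun c _ hc' =>
        .ex c (.app (.app (.const (he _ _ (hc c h) D)) (.var 0 ha)) (.var 2 hc'))⟩
  | box φ ih =>
    obtain ⟨e, he⟩ := ih i
    exact ⟨𝒜.value _, fun ρ ρ' h D => value_mem <| .lam 0 fun _ ha => .lam 1 fun _ hb =>
      .boxElim 2 (.var 1 hb) fun _ hc' =>
        .box fun Z => (.app (.app (.const (he _ _ h Z)) (.var 0 ha)) (.var 2 (hc' Z)))⟩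

/-! ### Soundness -/

theorem not_valid_bot [Nonempty N] : ¬ 𝒜.Valid E M .bot := by
  intro h
  obtain ⟨e, he⟩ := valid_iff.1 h
  -- At D = ∅ every number realizes ∅ ⇒ ∅, so a realizer of ⊖_∅ ∅ would produce an element of ∅.
  obtain ⟨_, _, h⟩ := he (fun _ => Classical.arbitrary N) ∅ 𝒜.k fun _ h => h.elim
  exact h

theorem EqualityLaws.sound (L : EqualityLaws 𝒜 E M) {Ax : Set Form}
    (hAx : ∀ φ ∈ Ax, 𝒜.Valid E M φ) (h : Prov Ax φ) : 𝒜.Valid E M φ := by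
  induction h with
  | ax h => exact hAx _ h
  | imp_k φ ψ =>
    exact valid_iff.2 ⟨𝒜.value _, fun ρ D => value_mem <| .lam 0 fun _ ha => .lam 1 fun _ _ =>
      .var 0 ha⟩
  | imp_s φ ψ χ =>
    exact valid_iff.2 ⟨𝒜.value _, fun ρ D => value_mem <| .lam 0 fun _ ha => .lam 1 fun _ hb =>
      .lam 2 fun _ hc => .app (.app (.var 0 ha) (.var 2 hc)) (.app (.var 1 hb) (.var 2 hc))⟩
  | and_intro φ ψ =>
    exact valid_iff.2 ⟨𝒜.value _, fun ρ D => value_mem <| .lam 0 fun _ ha => .lam 1 fun _ hb =>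
      .pair (.var 0 ha) (.var 1 hb)⟩
  | and_left φ ψ =>
    exact valid_iff.2 ⟨𝒜.value _, fun ρ D => value_mem <| .lam 0 fun _ ha => .fst (.var 0 ha)⟩
  | and_right φ ψ =>
    exact valid_iff.2 ⟨𝒜.value _, fun ρ D => value_mem <| .lam 0 fun _ ha => .snd (.var 0 ha)⟩
  | or_left φ ψ =>
    exact valid_iff.2 ⟨𝒜.value _, fun ρ D => value_mem <| .lam 0 fun _ ha =>
      .unit (.inl (.var 0 ha))⟩
  | or_right φ ψ =>
    exact valid_iff.2 ⟨𝒜.value _, fun ρ D => value_mem <| .lam 0 fun _ ha =>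
      .unit (.inr (.var 0 ha))⟩
  | or_elim φ ψ χ =>
    exact valid_iff.2 ⟨𝒜.value _, fun ρ D => value_mem <| .lam 0 fun _ ha => .lam 1 fun _ hb =>
      .lam 2 fun _ hc => .elim 3 (.var 2 hc) fun _ hd =>
        .cases (.var 3 hd) (.var 0 ha) (.var 1 hb)⟩
  | dne φ =>
    -- A continuation φ ⇒ D gives φ ⇒ ⊖_D ∅, which is ¬φ at `D`. Then ¬¬φ gives ⊖_D ∅, and the
    -- vacuous map ∅ ⇒ D turns this into an element of `D`. So ¬¬φ yields ⊖_D φ, and stability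
    -- finishes.
    exact valid_iff.2 ⟨𝒜.value _, fun ρ D => value_mem <| .lam 0 fun _ ha => .stable <|
      .lam 1 fun _ hb => .app (.app (.var 0 ha)
        (.lam 2 fun _ hc => .lam 3 fun _ _ => .app (.var 1 hb) (.var 2 hc)))
        (.lam 4 fun _ hd => .var 4 hd.elim)⟩
  | all_vacuous φ =>
    exact valid_iff.2 ⟨𝒜.value _, fun ρ D => value_mem <| .pair
      (.lam 0 fun _ ha => (.cast (val_shift φ (ρ 0) ρ D) <| .allElim (.var 0 ha) (ρ 0)))
      (.lam 0 fun _ ha => .all fun c => .cast (val_shift φ c ρ D).symm <| .var 0 ha)⟩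
  | all_distrib φ ψ =>
    exact valid_iff.2 ⟨𝒜.value _, fun ρ D => value_mem <| .lam 0 fun _ ha => .lam 1 fun _ hb =>
      .all fun c => .mp (.allElim (.var 0 ha) c) (.allElim (.var 1 hb) c)⟩
  | all_perm φ =>
    exact valid_iff.2 ⟨𝒜.value _, fun ρ D => value_mem <| .lam 0 fun _ ha => .all fun c =>
      .all fun d => .cast (val_swap φ d c ρ D).symm <| .allElim (.allElim (.var 0 ha) d) c⟩
  | all_inst φ y =>
    exact valid_iff.2 ⟨𝒜.value _, fun ρ D => value_mem <| .lam 0 fun _ ha =>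
      .cast (val_inst φ y ρ D).symm <| .allElim (.var 0 ha) (ρ y)⟩
  | ex_def φ =>
    exact valid_iff.2 ⟨𝒜.value _, fun ρ D => value_mem <| .pair
      (.lam 0 fun _ ha => .lam 1 fun _ hb => .exElim 2 (.var 0 ha) fun c _ hc =>
        Den.mp (ρ := scons c ρ) (ψ := .bot) (.allElim (.var 1 hb) c) (.var 2 hc))
      (.lam 0 fun _ ha => .lam 1 fun _ hb => .app (.app (.var 0 ha) (.all fun c => .lam 2 fun _ hc =>
        .lam 3 fun _ _ => .app (.var 1 hb) (.var 2 (Set.mem_iUnion.2 ⟨c, hc⟩))))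
          (.lam 4 fun _ hd => .var 4 hd.elim))⟩
  | eq_refl x =>
    exact valid_iff.2 ⟨𝒜.value _, fun ρ D => value_mem <| .unit (.const (L.refl_mem _))⟩
  | eq_subst φ x y =>
    obtain ⟨e, he⟩ := L.exists_subst φ 0
    refine valid_iff.2 ⟨𝒜.value _, fun ρ D => value_mem <| .lam 0 fun _ ha => .lam 1 fun _ hb =>
      .elim 2 (.var 0 ha) fun _ hc => .cast (val_inst φ x ρ D).symm <|
        .app (.app (.const (he (scons (ρ y) ρ) (scons (ρ x) ρ) ?_ D))
          (.app (.const (L.symm_mem _ _)) (.var 2 hc))) (.cast (val_inst φ y ρ D) <| .var 1 hb)⟩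
    intro j hj
    cases j with
    | zero => exact absurd rfl hj
    | succ j => rfl
  | box_k φ ψ =>
    exact valid_iff.2 ⟨𝒜.value _, fun ρ D => value_mem <| .lam 0 fun _ ha => .lam 1 fun _ hb =>
      .boxElim 2 (.var 0 ha) fun _ hc => .boxElim 3 (.var 1 hb) fun _ hd => .box fun Z =>
        .app (.var 2 (hc Z)) (.var 3 (hd Z))⟩
  | box_t φ =>
    exact valid_iff.2 ⟨𝒜.value _, fun ρ D => value_mem <| .lam 0 fun _ ha =>
      .boxElim 1 (.var 0 ha) fun _ hb => .var 1 (hb D)⟩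
  | box_four φ =>
    exact valid_iff.2 ⟨𝒜.value _, fun ρ D => value_mem <| .lam 0 fun _ ha =>
      .boxElim 1 (.var 0 ha) fun _ hb => .box fun Z => .box fun W => .var 1 (hb W)⟩
  | mp _ _ ih₁ ih₂ =>
    obtain ⟨e, he⟩ := valid_iff.1 ih₁
    obtain ⟨f, hf⟩ := valid_iff.1 ih₂
    exact valid_iff.2 ⟨𝒜.value _, fun ρ D => value_mem <| .app (.const (he ρ D)) (.const (hf ρ D))⟩
  | gen _ ih =>
    obtain ⟨e, he⟩ := valid_iff.1 ih
    exact valid_iff.2 ⟨e, fun ρ D => Set.mem_iInter.2 fun c => he _ D⟩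
  | nec _ ih =>
    obtain ⟨e, he⟩ := valid_iff.1 ih
    exact valid_iff.2 ⟨𝒜.value _, fun ρ D => value_mem <| .box fun Z => .const (he ρ Z)⟩

end PCA
end EpistemicSet

namespace EpistemicSet

open Form

namespace PCA

/-! ### Recursive functions in Kleene's first model -/

/-- The singleton that consists of the code of `a`. -/
def cd {α : Type*} [Encodable α] (a : α) : Set ℕ := {Encodable.encode a}

section Kleene

variable {𝒦 : PCA ℕ} {γ : ℕ → ℕ} {t t' u v : Tm ℕ} {X Y Z D : Set ℕ}

theorem partrec_app (hK : IsKleeneFirst 𝒦) : Partrec₂ 𝒦.app :=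
  (Nat.Partrec.Code.eval_part.comp ((Computable.ofNat Nat.Partrec.Code).comp .fst) .snd).of_eq
    fun p => by rw [hK, kleene, ← Nat.Partrec.Code.ofNatCode_eq]

theorem exists_index (hK : IsKleeneFirst 𝒦) {f : ℕ →. ℕ} (hf : Partrec f) :
    ∃ e, ∀ n, 𝒦.app e n = f n := by
  obtain ⟨c, hc⟩ := Nat.Partrec.Code.exists_code.1 (Partrec.nat_iff.1 hf)
  refine ⟨Encodable.encode c, fun n => ?_⟩
  rw [hK, kleene, ← Nat.Partrec.Code.ofNatCode_eq, Denumerable.ofNat_encode, hc]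

/-- Imports recursion theory into the typing calculus: any partial recursive map between coded types
becomes a constant that may be applied to codes. -/
theorem exists_realizer_partrec (hK : IsKleeneFirst 𝒦) {α β : Type*} [Primcodable α]
    [Primcodable β] {f : α →. β} (hf : Partrec f) :
    ∃ e, ∀ a, ∀ b ∈ f a, e ∈ 𝒦.hImp (cd a) (cd b) := by
  obtain ⟨e, he⟩ := exists_index hK (Partrec.nat_iff.2 hf)
  refine ⟨e, fun a b hb n hn => ⟨Encodable.encode b, ?_, rfl⟩⟩
  obtain rfl := Set.mem_singleton_iff.1 hn
  rw [he]
  simpa [Part.mem_map_iff] using hb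

theorem exists_realizer (hK : IsKleeneFirst 𝒦) {α β : Type*} [Primcodable α]
    [Primcodable β] {f : α → β} (hf : Computable f) :
    ∃ e, ∀ a, e ∈ 𝒦.hImp (cd a) (cd (f a)) := by
  obtain ⟨e, he⟩ := exists_realizer_partrec hK hf.partrec
  exact ⟨e, fun a => he a _ (Part.mem_some _)⟩

theorem exists_pairCode (hK : IsKleeneFirst 𝒦) {α β : Type*} [Primcodable α]
    [Primcodable β] : ∃ e, ∀ (a : α) (b : β), e ∈ 𝒦.hImp (𝒦.hAnd (cd a) (cd b)) (cd (a, b)) := by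
  have hf : Partrec fun z : ℕ => (𝒦.app z 𝒦.k).bind fun a => (𝒦.app z 𝒦.kbar).map fun b =>
      Nat.pair a b :=
    ((partrec_app hK).comp .id (.const _)).bind
      (((partrec_app hK).comp .fst (.const _)).map
        (Primrec₂.natPair.to_comp.comp (Computable.snd.comp .fst) .snd))
  obtain ⟨e, he⟩ := exists_index hK hf
  refine ⟨e, ?_⟩
  rintro a b _ ⟨x, rfl, y, rfl, rfl⟩
  refine ⟨_, ?_, rfl⟩
  rw [he]
  simp [app_pr_k, app_pr_kbar]

theorem computable_numeral (hK : IsKleeneFirst 𝒦) : Computable 𝒦.numeral := by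
  have hp : Computable fun n => 𝒦.pr 𝒦.kbar n := by
    have hk : Computable 𝒦.ka := Partrec.of_eq ((partrec_app hK).comp (.const 𝒦.k) .id)
      fun n => 𝒦.app_k n
    obtain ⟨x, hx⟩ : ∃ x, x = 𝒦.sab 𝒦.i (𝒦.ka 𝒦.kbar) := ⟨_, rfl⟩
    have hs : Computable fun n => 𝒦.sab x n := by
      refine Partrec.of_eq (((partrec_app hK).comp (.const 𝒦.s) (.const x)).bind
        ((partrec_app hK).comp .snd .fst).to₂) fun n => 𝒦.app_s x n
    exact (hs.comp hk).of_eq fun n => by rw [pr, hx]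
  refine (Computable.nat_rec (f := fun n : ℕ => n) (g := fun _ => 𝒦.i)
    (h := fun _ p => 𝒦.pr 𝒦.kbar p.2) .id (.const _)
      (hp.comp (Computable.snd.comp .snd))).of_eq fun n => ?_
  induction n with
  | zero => rfl
  | succ n ih => simp only at ih ⊢; rw [numeral, ← ih]

theorem exists_numeral_of_code (hK : IsKleeneFirst 𝒦) :
    ∃ e, ∀ n : ℕ, e ∈ 𝒦.hImp (cd n) {𝒦.numeral n} :=
  exists_realizer hK (computable_numeral hK)

/-- A successor is a pair with tag `kbar`. Zero is `i`, not a pair, but `i k = k` and `i kbar =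
kbar`, so under `tCases` it behaves like a pair with tag `k` and content `kbar`; this is why the
zero branch must accept a dummy argument. -/
theorem Den.natCases {n : ℕ} (ht : 𝒦.Den γ t {𝒦.numeral n})
    (hu : 𝒦.Den γ u {e | n = 0 → e ∈ 𝒦.hImp Set.univ Z})
    (hv : 𝒦.Den γ v {e | ∀ m : {m // n = m + 1}, e ∈ 𝒦.hImp {𝒦.numeral m} Z}) :
    𝒦.Den γ (𝒦.tCases t u v) Z := by
  cases n with
  | zero =>
    obtain ⟨a, ha, rfl⟩ := ht
    obtain ⟨f, hf, hf'⟩ := hu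
    obtain ⟨g, hg, -⟩ := hv
    refine .app (X := Set.univ) ⟨f, ?_, hf' rfl⟩ ⟨𝒦.kbar, Part.mem_bind ha ?_, trivial⟩
    · refine Part.mem_bind (Part.mem_bind (Part.mem_bind ha (b := 𝒦.k) ?_)
        (Part.mem_bind hf (b := 𝒦.ka f) ?_)) (Part.mem_bind hg ?_)
      · simp [eval, numeral, app_i]
      · simp [app_k]
      · simp [app_ka]
    · simp [eval, numeral, app_i]
  | succ m =>
    refine .cases_right (ht.mono ?_) hu (hv.mono fun _ h => h ⟨m, rfl⟩)
    rintro _ rfl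
    exact ⟨_, rfl, _, rfl, rfl⟩

theorem exists_code_of_numeral (hK : IsKleeneFirst 𝒦) :
    ∃ e, ∀ n : ℕ, e ∈ 𝒦.hImp {𝒦.numeral n} (cd n) := by
  obtain ⟨e, he⟩ := exists_realizer hK Computable.succ
  refine exists_recursive (t := 𝒦.tCases (.var 1) (𝒦.lam 2 (.const 0))
    (𝒦.lam 2 (.app (.const e) (.app (.var 0) (.var 2))))) (r := (· < ·)) Nat.lt_wfRel.wf
    fun n h a ha ih => ?_
  refine .natCases (.var 1 ha) (.lamAll 2 fun hn _ _ => .const ?_) (.lamAll 2 fun m x hx => ?_)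
  · simp [cd, hn]
  · obtain ⟨m, rfl⟩ := m
    exact .app (.const (he m)) (.app (.var 0 (ih m (by simp))) (.var 2 hx))

/-- Recursion along the numerals. -/
theorem exists_natRec (𝒦 : PCA ℕ) : ∃ e, ∀ X : ℕ → Set ℕ, ∀ n,
    e ∈ 𝒦.hImp (X 0) (𝒦.hImp {f | ∀ n, f ∈ 𝒦.hImp {𝒦.numeral n} (𝒦.hImp (X n) (X (n + 1)))}
      (𝒦.hImp {𝒦.numeral n} (X n))) := by
  -- The family is part of the index of the recursion, so one recursor serves all families at once.
  have := exists_recursive (𝒜 := 𝒦) (ι := ℕ × (ℕ → Set ℕ)) (r := InvImage (· < ·) Prod.fst)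
    (InvImage.wf _ Nat.lt_wfRel.wf)
    (X := fun i => 𝒦.hAnd (𝒦.hAnd (i.2 0)
      {f | ∀ n, f ∈ 𝒦.hImp {𝒦.numeral n} (𝒦.hImp (i.2 n) (i.2 (n + 1)))}) {𝒦.numeral i.1})
    (Y := fun i => i.2 i.1) fun i h a ha ih => .natCases (.snd (.var 1 ha))
      (.lamAll 2 fun hn _ _ => .cast (congrArg i.2 hn.symm) (.fst (.fst (.var 1 ha))))
      (.lamAll 2 fun m x hx => .cast (congrArg i.2 m.2.symm)
        (.app (.app ((Den.snd (.fst (.var 1 ha))).mono fun _ h => h m) (.var 2 hx))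
          (.app (.var 0 (ih (m, i.2) (by have := m.2; simp only [InvImage]; omega)))
            (.pair (.fst (.var 1 ha)) (.var 2 hx)))))
  obtain ⟨h, hh⟩ := this
  exact ⟨𝒦.value _, fun X n => value_mem <| .lam 0 fun _ ha => .lam 1 fun _ hb => .lam 2 fun _ hc =>
    .app (.const (hh (n, X))) (.pair (.pair (.var 0 ha) (.var 1 hb)) (.var 2 hc))⟩

end Kleene
end PCA
end EpistemicSet

namespace EpistemicSet

open Form PCA Cardinal Ordinal

/-! ### The universe of names -/

theorem rank_natSet (n : ℕ) : (natSet.{u} n).rank = n := by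
  induction n with
  | zero => simp [natSet]
  | succ n ih => simp [natSet, ZFSet.rank_insert, ih]

theorem natSet_injective : Function.Injective natSet.{u} := fun m n h => by
  have := congrArg ZFSet.rank h
  simpa [rank_natSet] using this

theorem V_zero : V.{u} 0 = ∅ := Ordinal.limitRecOn_zero ..

theorem V_add_one (α : Ordinal.{u}) :
    V (α + 1) = {x | ∀ z ∈ x, ∃ n : ℕ, ∃ y ∈ V α, z = ZFSet.pair (natSet n) y} :=
  Ordinal.limitRecOn_add_one ..

theorem V_limit {α : Ordinal.{u}} (h : Order.IsSuccLimit α) :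
    V α = ⋃ β : Ordinal.{u}, ⋃ _ : β < α, V β :=
  Ordinal.limitRecOn_limit _ _ _ _ h

/-- Hereditary sets of pairs with a natural number as first component. -/
inductive IsName : ZFSet.{u} → Prop
  | mk {x : ZFSet.{u}} : (∀ z ∈ x, ∃ (n : ℕ) (y : ZFSet.{u}), z = ZFSet.pair (natSet n) y) →
      (∀ (n : ℕ) (y : ZFSet.{u}), ZFSet.pair (natSet n) y ∈ x → IsName y) → IsName x

theorem rank_lt_of_pair_mem {x y z : ZFSet.{u}} (h : ZFSet.pair x y ∈ z) : y.rank < z.rank := by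
  refine lt_trans ?_ (ZFSet.rank_lt_of_mem h)
  have h1 : y ∈ ({x, y} : ZFSet.{u}) := by simp
  have h2 : ({x, y} : ZFSet.{u}) ∈ ZFSet.pair x y := by simp [ZFSet.pair]
  exact (ZFSet.rank_lt_of_mem h1).trans (ZFSet.rank_lt_of_mem h2)

theorem IsName.mem_V {x : ZFSet.{u}} (hx : IsName x) (α : Ordinal.{u}) (h : x.rank < α) :
    x ∈ V α := by
  induction α using Ordinal.limitRecOn generalizing x with
  | zero => simp at h
  | add_one α ih =>
    rw [V_add_one]
    intro z hz
    obtain ⟨hx, hx'⟩ := hx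
    obtain ⟨n, y, rfl⟩ := hx z hz
    exact ⟨n, y, ih (hx' n y hz) ((rank_lt_of_pair_mem hz).trans_le (Order.lt_add_one_iff.1 h)), rfl⟩
  | limit α hα ih =>
    rw [V_limit hα]
    exact Set.mem_iUnion₂.2 ⟨_, hα.add_one_lt h, ih _ (hα.add_one_lt h) hx (by simp)⟩

theorem rank_pair_le {x y : ZFSet.{u}} {α : Ordinal.{u}} (hx : x.rank ≤ α) (hy : y.rank ≤ α) :
    (ZFSet.pair x y).rank ≤ α + 2 := by
  have : α + 2 = α + 1 + 1 := by rw [add_assoc, one_add_one_eq_two]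
  rw [this, ZFSet.rank_le_iff]
  intro z hz
  rw [Order.lt_add_one_iff, ZFSet.rank_le_iff]
  intro w hw
  rw [Order.lt_add_one_iff]
  simp only [ZFSet.pair, ZFSet.mem_pair] at hz
  rcases hz with rfl | rfl
  · rw [ZFSet.mem_singleton] at hw
    rwa [hw]
  · rcases ZFSet.mem_pair.1 hw with rfl | rfl <;> assumption

/-- Each stage raises the rank by at most three, two for the pair and one for the set, so a factor ω
is ample. -/
theorem isName_rank_of_mem_V {α : Ordinal.{u}} {x : ZFSet.{u}} (h : x ∈ V α) :
    IsName x ∧ x.rank < ω * (α + 1) := by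
  induction α using Ordinal.limitRecOn generalizing x with
  | zero => simp [V_zero] at h
  | add_one α ih =>
    rw [V_add_one] at h
    refine ⟨⟨fun z hz => ?_, fun n y hz => ?_⟩, ?_⟩
    · obtain ⟨n, y, hy, rfl⟩ := h z hz
      exact ⟨n, y, rfl⟩
    · obtain ⟨m, c, hc, he⟩ := h _ hz
      rw [(ZFSet.pair_inj.1 he).2]
      exact (ih hc).1
    · have hle : x.rank ≤ ω * (α + 1) + 3 := by
        refine ZFSet.rank_le_iff.2 fun z hz => ?_
        obtain ⟨n, y, hy, rfl⟩ := h z hz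
        have hn : (natSet.{u} n).rank ≤ ω * (α + 1) := by
          rw [rank_natSet]
          exact (Ordinal.natCast_lt_omega0 n).le.trans (Ordinal.le_mul_left _ (by simp))
        refine (rank_pair_le hn (ih hy).2.le).trans_lt ((add_lt_add_iff_left _).2 ?_)
        exact_mod_cast Nat.lt_succ_self 2
      refine hle.trans_lt ?_
      rw [mul_add ω (α + 1), mul_one]
      exact (add_lt_add_iff_left _).2 (Ordinal.natCast_lt_omega0 3)
  | limit α hα ih =>
    rw [V_limit hα] at h
    obtain ⟨β, hβ, hx⟩ := Set.mem_iUnion₂.1 h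
    obtain ⟨h1, h2⟩ := ih β hβ hx
    refine ⟨h1, h2.trans_le ?_⟩
    gcongr

-- Closure properties of V_κ for inaccessible κ.

section Domain

variable {κ : Cardinal.{u}}

/-- The hierarchy is not indexed by rank, but at κ the upper and lower rank bounds meet: for β < κ
the ordinal ω · (β + 1) has cardinality below κ, as κ is an uncountable cardinal. -/
theorem mem_V_ord (hκ : κ.IsInaccessible) {x : ZFSet.{u}} :
    x ∈ V κ.ord ↔ IsName x ∧ x.rank < κ.ord := by
  refine ⟨fun h => ?_, fun h => h.1.mem_V _ h.2⟩
  have hl : Order.IsSuccLimit κ.ord := Cardinal.isSuccLimit_ord hκ.1.le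
  rw [V_limit hl] at h
  obtain ⟨β, hβ, hx⟩ := Set.mem_iUnion₂.1 h
  obtain ⟨h1, h2⟩ := isName_rank_of_mem_V hx
  refine ⟨h1, h2.trans ?_⟩
  rw [Cardinal.lt_ord] at hβ ⊢
  rw [Ordinal.card_mul, Ordinal.card_omega0]
  refine Cardinal.mul_lt_of_lt hκ.1.le hκ.1 ?_
  rw [Ordinal.card_add]
  exact Cardinal.add_lt_of_lt hκ.1.le hβ (by simpa using hκ.nat_lt 1)

/-- `⟨n, c⟩ ∈ a`. -/
def Dom.El (n : ℕ) (c a : Dom κ) : Prop := ZFSet.pair (natSet n) c.1 ∈ a.1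

theorem Dom.El.rank_lt {n : ℕ} {c a : Dom κ} (h : Dom.El n c a) : c.1.rank < a.1.rank :=
  rank_lt_of_pair_mem h

theorem Dom.rank_lt (hκ : κ.IsInaccessible) (a : Dom κ) : a.1.rank < κ.ord :=
  ((mem_V_ord hκ).1 a.2).2

theorem Dom.exists_of_mem (hκ : κ.IsInaccessible) {a : Dom κ} {z : ZFSet.{u}} (h : z ∈ a.1) :
    ∃ (n : ℕ) (c : Dom κ), Dom.El n c a ∧ z = ZFSet.pair (natSet n) c.1 := by
  obtain ⟨⟨ha, ha'⟩, hr⟩ := (mem_V_ord hκ).1 a.2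
  obtain ⟨n, y, rfl⟩ := ha z h
  exact ⟨n, ⟨y, (mem_V_ord hκ).2 ⟨ha' n y h, (rank_lt_of_pair_mem h).trans hr⟩⟩, h, rfl⟩

theorem Dom.mem_of_pair_mem (hκ : κ.IsInaccessible) {a : Dom κ} {n : ℕ} {y : ZFSet.{u}}
    (h : ZFSet.pair (natSet n) y ∈ a.1) : y ∈ V κ.ord := by
  obtain ⟨m, c, -, hc⟩ := Dom.exists_of_mem hκ h
  obtain ⟨-, rfl⟩ := ZFSet.pair_inj.1 hc
  exact c.2

theorem Dom.wf : WellFounded fun c a : Dom κ => ∃ n, Dom.El n c a :=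
  Subrelation.wf (fun ⟨_, h⟩ => h.rank_lt) (InvImage.wf (fun a : Dom κ => a.1.rank) Ordinal.lt_wf)

/-- Comprehension: a bounded set of pairs is an element of the domain. -/
theorem Dom.exists_comprehension (hκ : κ.IsInaccessible) (S : ℕ → Dom κ → Prop) {δ : Ordinal.{u}}
    (hδ : δ < κ.ord) (hS : ∀ n c, S n c → c.1.rank ≤ δ) :
    ∃ a : Dom κ, ∀ n c, Dom.El n c a ↔ S n c := by
  -- The term ω bounds the natural-number components, and a pair raises the rank by at most two.
  let ε := max δ ω + 2
  let a : ZFSet.{u} := ZFSet.sep (fun z => ∃ n c, S n c ∧ z = ZFSet.pair (natSet n) c.1)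
    (ZFSet.vonNeumann (ε + 1))
  have hl : Order.IsSuccLimit κ.ord := Cardinal.isSuccLimit_ord hκ.1.le
  have hω : ω < κ.ord := by rw [Cardinal.lt_ord, Ordinal.card_omega0]; exact hκ.1
  have hε : ε + 1 < κ.ord := by
    have : ε + 1 = max δ ω + 1 + 1 + 1 := by
      simp only [ε, add_assoc, one_add_one_eq_two]
    rw [this]
    exact hl.add_one_lt (hl.add_one_lt (hl.add_one_lt (max_lt hδ hω)))
  have ha : a ∈ V κ.ord := by
    refine (mem_V_ord hκ).2 ⟨⟨fun z hz => ?_, fun n y hz => ?_⟩, ?_⟩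
    · obtain ⟨-, n, c, -, rfl⟩ := ZFSet.mem_sep.1 hz
      exact ⟨n, c.1, rfl⟩
    · obtain ⟨-, m, c, -, he⟩ := ZFSet.mem_sep.1 hz
      rw [(ZFSet.pair_inj.1 he).2]
      exact ((mem_V_ord hκ).1 c.2).1
    · refine lt_of_le_of_lt (ZFSet.rank_mono (y := ZFSet.vonNeumann (ε + 1)) fun z hz => ?_) ?_
      · exact (ZFSet.mem_sep.1 hz).1
      · rwa [ZFSet.rank_vonNeumann]
  refine ⟨⟨a, ha⟩, fun n c => ⟨fun h => ?_, fun h => ?_⟩⟩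
  · obtain ⟨-, m, d, hd, he⟩ := ZFSet.mem_sep.1 (show _ ∈ a from h)
    obtain ⟨hm, hc⟩ := ZFSet.pair_inj.1 he
    rwa [natSet_injective hm, Subtype.ext hc]
  · have hc : (ZFSet.pair (natSet n) c.1).rank ≤ ε := by
      refine rank_pair_le ?_ ((hS n c h).trans (le_max_left _ _))
      rw [rank_natSet]
      exact (Ordinal.natCast_lt_omega0 n).le.trans (le_max_right _ _)
    have : ZFSet.pair (natSet n) c.1 ∈ a :=
      ZFSet.mem_sep.2 ⟨ZFSet.mem_vonNeumann.2 (Order.lt_add_one_iff.2 hc), n, c, h, rfl⟩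
    exact this

/-- Families that are indexed by the elements of an element of the domain are bounded. -/
theorem Dom.exists_bound (hκ : κ.IsInaccessible) (a : Dom κ) (f : ℕ → Dom κ → ℕ → Dom κ) :
    ∃ δ < κ.ord, ∀ n c r, Dom.El n c a → (f n c r).1.rank ≤ δ := by
  have key : ∀ z : a.1, ∃ p : ℕ × Dom κ, z.1 = ZFSet.pair (natSet p.1) p.2.1 := fun z =>
    let ⟨n, c, _, h⟩ := Dom.exists_of_mem hκ z.2; ⟨(n, c), h⟩
  choose g hg using key
  let F : Shrink.{u} a.1 × ULift.{u} ℕ → Ordinal.{u} := fun i =>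
    (f (g ((equivShrink a.1).symm i.1)).1 (g ((equivShrink a.1).symm i.1)).2 i.2.down).1.rank
  have hcard : #(Shrink.{u} a.1) < κ := by
    -- A set lies in the cumulative stage of its rank, whose size is a value of `preBeth`; as κ is
    -- inaccessible, that value stays below κ.
    have h1 : a.1.card ≤ preBeth a.1.rank := by
      rw [← ZFSet.card_vonNeumann]
      exact ZFSet.card_mono (ZFSet.subset_vonNeumann_self _)
    refine lt_of_le_of_lt h1 ?_
    exact (Cardinal.preBeth_lt_preBeth.2 (Dom.rank_lt hκ a)).trans_eq hκ.preBeth_ord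
  have hF : iSup F < κ.ord := by
    -- Regularity of κ: there are fewer than κ many indices, even after multiplying by ℕ for the
    -- argument `r`.
    refine Ordinal.iSup_lt_of_lt_cof ?_ fun i => Dom.rank_lt hκ _
    rw [hκ.isRegular.cof_ord, Cardinal.mk_prod]
    simpa using Cardinal.mul_lt_of_lt hκ.1.le hcard hκ.1
  refine ⟨_, hF, fun n c r h => ?_⟩
  have := Ordinal.le_iSup F (equivShrink a.1 ⟨_, h⟩, ⟨r⟩)
  simp only [F, Equiv.symm_apply_apply] at this
  obtain ⟨h1, h2⟩ := ZFSet.pair_inj.1 (hg ⟨_, h⟩)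
  rwa [← natSet_injective h1, ← Subtype.ext h2] at this

end Domain

end EpistemicSet

-- Equality and membership in McCarty's model.

namespace EpistemicSet

open Form PCA

section Equality

variable {𝒦 : PCA ℕ} {κ : Cardinal.{u}} {γ : ℕ → ℕ} {t v w : Tm ℕ} {a b c d : Dom κ} {n : ℕ}
  {X Y Z D : Set ℕ}

/-- `{e : ∀ ⟨n, c⟩ ∈ a, e n ∈ ‖c ∈ b‖}`. -/
def subVal (𝒦 : PCA ℕ) (a b : Dom κ) : Set ℕ :=
  {e | ∀ i : {p : ℕ × Dom κ // Dom.El p.1 p.2 a}, e ∈ 𝒦.hImp {i.1.1} (memVal 𝒦 i.1.2 b)}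

/-- Converts the inductive predicate into the operations of the typing calculus. Elements of members
of V_κ are again in V_κ, so quantification over all sets and over the domain agree. -/
theorem eqVal_eq (hκ : κ.IsInaccessible) (a b : Dom κ) :
    eqVal 𝒦 a b = 𝒦.hAnd (subVal 𝒦 a b) (subVal 𝒦 b a) := by
  have hsub : ∀ (e : ℕ) (a b : Dom κ), e ∈ subVal 𝒦 a b ↔
      (∀ n c, ZFSet.pair (natSet n) c ∈ a.1 → (𝒦.app e n).Dom) ∧
      ∀ n c r, ZFSet.pair (natSet n) c ∈ a.1 → r ∈ 𝒦.app e n → MemR 𝒦 r c b.1 := by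
    intro e a b
    constructor
    · intro h
      have h' (n c) (hc : ZFSet.pair (natSet n) c ∈ a.1) :
          ∃ r ∈ 𝒦.app e n, MemR 𝒦 r c b.1 :=
        h ⟨(n, ⟨c, Dom.mem_of_pair_mem hκ hc⟩), hc⟩ n rfl
      refine ⟨fun n c hc => ?_, fun n c r hc hr => ?_⟩
      · obtain ⟨r, hr, -⟩ := h' n c hc
        exact Part.dom_iff_mem.2 ⟨r, hr⟩
      · obtain ⟨r', hr', h⟩ := h' n c hc
        rwa [Part.mem_unique hr hr']
    · rintro ⟨h1, h2⟩ ⟨⟨n, c⟩, hc⟩ _ rfl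
      exact ⟨_, Part.get_mem (h1 _ _ hc), h2 _ _ _ hc (Part.get_mem _)⟩
  ext r
  constructor
  · rintro ⟨h1, h2, h3, h4⟩
    exact ⟨_, (hsub _ _ _).2 ⟨h1, h2⟩, _, (hsub _ _ _).2 ⟨h3, h4⟩, rfl⟩
  · rintro ⟨e, he, f, hf, rfl⟩
    exact .intro ((hsub _ _ _).1 he).1 ((hsub _ _ _).1 he).2 ((hsub _ _ _).1 hf).1
      ((hsub _ _ _).1 hf).2

theorem exists_of_mem_memVal (hκ : κ.IsInaccessible) {r : ℕ} (h : r ∈ memVal 𝒦 a b) :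
    ∃ n c, Dom.El n c b ∧ r ∈ 𝒦.hAnd {n} (eqVal 𝒦 a c) := by
  obtain ⟨h1, h2⟩ := h
  exact ⟨_, ⟨_, Dom.mem_of_pair_mem hκ h1⟩, h1, _, rfl, _, h2, rfl⟩

theorem PCA.Den.memVal (h : Dom.El n c b) (ht : 𝒦.Den γ t {n}) (hv : 𝒦.Den γ v (eqVal 𝒦 a c)) :
    𝒦.Den γ (𝒦.tPair t v) (memVal 𝒦 a b) := by
  refine (Den.pair ht hv).mono ?_
  rintro _ ⟨_, rfl, f, hf, rfl⟩
  exact .intro h hf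

theorem PCA.Den.eqVal (hκ : κ.IsInaccessible) (ht : 𝒦.Den γ t (subVal 𝒦 a b))
    (hv : 𝒦.Den γ v (subVal 𝒦 b a)) : 𝒦.Den γ (𝒦.tPair t v) (eqVal 𝒦 a b) :=
  .cast (eqVal_eq hκ a b).symm (Den.pair ht hv)

theorem PCA.Den.subVal_left (hκ : κ.IsInaccessible) (ht : 𝒦.Den γ t (EpistemicSet.eqVal 𝒦 a b)) :
    𝒦.Den γ (.app t (.const 𝒦.k)) (subVal 𝒦 a b) := .fst (.cast (eqVal_eq hκ a b) ht)

theorem PCA.Den.subVal_right (hκ : κ.IsInaccessible) (ht : 𝒦.Den γ t (EpistemicSet.eqVal 𝒦 a b)) :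
    𝒦.Den γ (.app t (.const 𝒦.kbar)) (subVal 𝒦 b a) := .snd (.cast (eqVal_eq hκ a b) ht)

theorem PCA.Den.subVal_app (ht : 𝒦.Den γ t (subVal 𝒦 a b)) (h : Dom.El n c a)
    (hv : 𝒦.Den γ v {n}) : 𝒦.Den γ (.app t v) (EpistemicSet.memVal 𝒦 c b) :=
  .app (ht.mono fun _ h' => h' ⟨(n, c), h⟩) hv

theorem PCA.Den.memVal_app (ht : 𝒦.Den γ t (⋂ c, 𝒦.hImp (EpistemicSet.memVal 𝒦 c a)
      (EpistemicSet.memVal 𝒦 c b))) (hv : 𝒦.Den γ v (EpistemicSet.memVal 𝒦 c a)) :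
    𝒦.Den γ (.app t v) (EpistemicSet.memVal 𝒦 c b) :=
  .app (.inst ht c) hv

theorem exists_eqVal_refl (𝒦 : PCA ℕ) (hκ : κ.IsInaccessible) :
    ∃ e, ∀ a : Dom κ, e ∈ eqVal 𝒦 a a := by
  obtain ⟨e, he⟩ := exists_recursive (𝒜 := 𝒦) (ι := Dom κ) Dom.wf (X := fun _ => Set.univ)
    (Y := fun a => eqVal 𝒦 a a) fun a h x hx ih =>
      .eqVal hκ
        (.lamAll 2 fun i _ hm => .memVal i.2 (.var 2 hm)
          (.app (.var 0 (ih _ ⟨_, i.2⟩)) (.var 1 trivial)))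
        (.lamAll 2 fun i _ hm => .memVal i.2 (.var 2 hm)
          (.app (.var 0 (ih _ ⟨_, i.2⟩)) (.var 1 trivial)))
  exact ⟨𝒦.value _, fun a => value_mem <| .app (.const (he a)) (.const (a := 0) trivial)⟩

theorem exists_eqVal_symm (𝒦 : PCA ℕ) (hκ : κ.IsInaccessible) :
    ∃ e, ∀ a b : Dom κ, e ∈ 𝒦.hImp (eqVal 𝒦 a b) (eqVal 𝒦 b a) :=
  ⟨𝒦.value _, fun _ _ => value_mem <| .lam 0 fun _ h =>
    .eqVal hκ (.subVal_right hκ (.var 0 h)) (.subVal_left hκ (.var 0 h))⟩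

/-- Recursion on the middle element: in both directions an element is carried through some `d` in
`b`, and the recursive call is made at `d`. -/
theorem exists_eqVal_trans (𝒦 : PCA ℕ) (hκ : κ.IsInaccessible) : ∃ e, ∀ a b c : Dom κ,
    e ∈ 𝒦.hImp (eqVal 𝒦 a b) (𝒦.hImp (eqVal 𝒦 b c) (eqVal 𝒦 a c)) := by
  have := exists_recursive (𝒜 := 𝒦) (ι := Dom κ × Dom κ × Dom κ)
    (InvImage.wf (fun i => i.2.1) Dom.wf)
    (X := fun i => 𝒦.hAnd (eqVal 𝒦 i.1 i.2.1) (eqVal 𝒦 i.2.1 i.2.2))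
    (Y := fun i => eqVal 𝒦 i.1 i.2.2) fun ⟨a, b, c⟩ h x hx ih =>
      .eqVal hκ
        (.lamAll 2 fun i m hm => .bind 3 (.subVal_app (.subVal_left hκ (.fst (.var 1 hx))) i.2
          (.var 2 hm)) fun _ h => by
            obtain ⟨n, d, hd, hr⟩ := exists_of_mem_memVal hκ h
            exact .bind 4 (.subVal_app (.subVal_left hκ (.snd (.var 1 hx))) hd (.fst (.var 3 hr)))
              fun _ h => by
                obtain ⟨n', d', hd', hr'⟩ := exists_of_mem_memVal hκ h
                exact .memVal hd' (.fst (.var 4 hr')) (.app (.var 0 (ih (i.1.2, d, d') ⟨_, hd⟩))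
                  (.pair (.snd (.var 3 hr)) (.snd (.var 4 hr')))))
        (.lamAll 2 fun i m hm => .bind 3 (.subVal_app (.subVal_right hκ (.snd (.var 1 hx))) i.2
          (.var 2 hm)) fun _ h => by
            obtain ⟨n, d, hd, hr⟩ := exists_of_mem_memVal hκ h
            exact .bind 4 (.subVal_app (.subVal_right hκ (.fst (.var 1 hx))) hd (.fst (.var 3 hr)))
              fun _ h => by
                obtain ⟨n', d', hd', hr'⟩ := exists_of_mem_memVal hκ h
                exact .memVal hd' (.fst (.var 4 hr')) (.app (.var 0 (ih (i.1.2, d, d') ⟨_, hd⟩))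
                  (.pair (.snd (.var 3 hr)) (.snd (.var 4 hr')))))
  obtain ⟨e, he⟩ := this
  exact ⟨𝒦.value _, fun a b c => value_mem <| .lam 0 fun _ ha => .lam 1 fun _ hb =>
    .app (.const (he (a, b, c))) (.pair (.var 0 ha) (.var 1 hb))⟩

/-- The laws of equality in McCarty's model. -/
noncomputable def equalityLaws (𝒦 : PCA ℕ) (hκ : κ.IsInaccessible) :
    EqualityLaws 𝒦 (N := Dom κ) (eqVal 𝒦) (memVal 𝒦) :=
  have left : ∃ e, ∀ a b c : Dom κ,
      e ∈ 𝒦.hImp (eqVal 𝒦 a b) (𝒦.hImp (memVal 𝒦 a c) (memVal 𝒦 b c)) := by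
    obtain ⟨s, hs⟩ := exists_eqVal_symm 𝒦 hκ
    obtain ⟨t, ht⟩ := exists_eqVal_trans 𝒦 hκ
    exact ⟨𝒦.value _, fun a b c => value_mem <| .lam 0 fun _ ha => .lam 1 fun _ hb => by
      obtain ⟨n, d, hd, hr⟩ := exists_of_mem_memVal hκ hb
      exact .memVal hd (.fst (.var 1 hr))
        (.app (.app (.const (ht _ _ _)) (.app (.const (hs _ _)) (.var 0 ha))) (.snd (.var 1 hr)))⟩
  have right : ∃ e, ∀ a b c : Dom κ,
      e ∈ 𝒦.hImp (eqVal 𝒦 a b) (𝒦.hImp (memVal 𝒦 c a) (memVal 𝒦 c b)) := by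
    obtain ⟨t, ht⟩ := exists_eqVal_trans 𝒦 hκ
    exact ⟨𝒦.value _, fun a b c => value_mem <| .lam 0 fun _ ha => .lam 1 fun _ hb => by
      obtain ⟨n, d, hd, hr⟩ := exists_of_mem_memVal hκ hb
      exact .bind 2 (.subVal_app (.subVal_left hκ (.var 0 ha)) hd (.fst (.var 1 hr))) fun _ h => by
        obtain ⟨n', d', hd', hr'⟩ := exists_of_mem_memVal hκ h
        exact .memVal hd' (.fst (.var 2 hr'))
          (.app (.app (.const (ht _ _ _)) (.snd (.var 1 hr))) (.snd (.var 2 hr')))⟩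
  { refl := _
    refl_mem := (exists_eqVal_refl 𝒦 hκ).choose_spec
    symm := _
    symm_mem := (exists_eqVal_symm 𝒦 hκ).choose_spec
    trans := _
    trans_mem := (exists_eqVal_trans 𝒦 hκ).choose_spec
    left := _
    left_mem := left.choose_spec
    right := _
    right_mem := right.choose_spec }

/-- Extensionality. -/
theorem exists_ext (𝒦 : PCA ℕ) (hκ : κ.IsInaccessible) : ∃ e, ∀ a b : Dom κ,
    e ∈ 𝒦.hImp (⋂ c, 𝒦.hImp (memVal 𝒦 c a) (memVal 𝒦 c b))
      (𝒦.hImp (⋂ c, 𝒦.hImp (memVal 𝒦 c b) (memVal 𝒦 c a)) (eqVal 𝒦 a b)) :=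
  have hr := (equalityLaws 𝒦 hκ).refl_mem
  ⟨𝒦.value _, fun _ _ => value_mem <| .lam 0 fun _ ha => .lam 1 fun _ hb => .eqVal hκ
    (.lamAll 2 fun i _ hm => .memVal_app (.var 0 ha) (.memVal i.2 (.var 2 hm)
      (.const (hr _))))
    (.lamAll 2 fun i _ hm => .memVal_app (.var 1 hb) (.memVal i.2 (.var 2 hm)
      (.const (hr _))))⟩

end Equality

end EpistemicSet

-- The axioms of eZF other than power set and infinity.

namespace EpistemicSet

open Form PCA

theorem PCA.val_ren_eq {A N : Type*} {𝒜 : PCA A} {E M : N → N → Set A} (φ : Form) {f : ℕ → ℕ}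
    {ρ ρ' : ℕ → N} (h : ∀ j, ρ (f j) = ρ' j) (D : Set A) :
    𝒜.val E M (φ.ren f) ρ D = 𝒜.val E M φ ρ' D := by
  rw [val_ren]
  congr 1
  exact funext h

section Axioms

variable {𝒦 : PCA ℕ} {κ : Cardinal.{u}} {γ : ℕ → ℕ} {t v w : Tm ℕ} {a b c d : Dom κ} {n : ℕ}
  {X Y Z D : Set ℕ} {φ ψ : Form} {ρ ρ' : ℕ → Dom κ}

/-- The value of a formula in the modalization of McCarty's model. -/
abbrev mval (𝒦 : PCA ℕ) (φ : Form) (ρ : ℕ → Dom κ) (D : Set ℕ) : Set ℕ :=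
  𝒦.val (eqVal 𝒦) (memVal 𝒦) φ ρ D

theorem PCA.hAnd_singleton (m n : ℕ) : 𝒦.hAnd {m} {n} = {𝒦.pr m n} := by
  ext r; constructor
  · rintro ⟨_, rfl, _, rfl, rfl⟩; rfl
  · rintro rfl; exact ⟨_, rfl, _, rfl, rfl⟩

/-- For sets whose first components are realizers: the index is the value of a term, known only to
lie in `X`, and every element of `X` is an admissible index for `c`. -/
theorem PCA.Den.memVal_of_forall (ht : 𝒦.Den γ t X) (h : ∀ n ∈ X, Dom.El n c b)
    (hv : 𝒦.Den γ v (EpistemicSet.eqVal 𝒦 a c)) :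
    𝒦.Den γ (𝒦.tPair t v) (EpistemicSet.memVal 𝒦 a b) := by
  obtain ⟨n, hn, hX⟩ := ht
  exact .memVal (h n hX) ⟨n, hn, rfl⟩ hv

theorem PCA.Den.iffMp {A N : Type*} {𝒜 : PCA A} {E M : N → N → Set A} {γ : ℕ → A} {t : Tm A}
    {ρ : ℕ → N} {D : Set A} (h : 𝒜.Den γ t (𝒜.val E M (iff φ ψ) ρ D)) :
    𝒜.Den γ (.app t (.const 𝒜.k)) (𝒜.val E M (φ ⟹ ψ) ρ D) := .fst h

theorem PCA.Den.iffMpr {A N : Type*} {𝒜 : PCA A} {E M : N → N → Set A} {γ : ℕ → A} {t : Tm A}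
    {ρ : ℕ → N} {D : Set A} (h : 𝒜.Den γ t (𝒜.val E M (iff φ ψ) ρ D)) :
    𝒜.Den γ (.app t (.const 𝒜.kbar)) (𝒜.val E M (ψ ⟹ φ) ρ D) := .snd h

/-- The uniform validity of an implication between generalized double negations yields the
implication itself. -/
theorem PCA.Den.descend {A : Type*} {𝒜 : PCA A} {γ : ℕ → A} {t : Tm A} {X Y : Set A}
    (h : ∀ Z, 𝒜.Den γ t (𝒜.hImp (𝒜.ominus Z X) (𝒜.ominus Z Y))) :
    𝒜.Den γ (.app (𝒜.lam 0 (𝒜.lam 1 (.app (.app (.var 0) (𝒜.tUnit (.var 1)))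
      (𝒜.lam 2 (.var 2))))) t) (𝒜.hImp X Y) :=
  -- The parameter is taken to be `Y`; then the identity is a continuation that turns ⊖_Y Y into
  -- `Y`.
  .app (X := 𝒜.hImp (𝒜.ominus Y X) (𝒜.ominus Y Y)) (.lam 0 fun _ ha => .lam 1 fun _ hb =>
    .extract (.app (X := 𝒜.ominus Y X) (.var 0 ha) (.unit (.var 1 hb))) 2
    fun _ hc => .var 2 hc) (h Y)

theorem Dom.nonempty (hκ : κ.IsInaccessible) : Nonempty (Dom κ) :=
  let ⟨a, _⟩ := Dom.exists_comprehension hκ (fun _ _ => False) (Cardinal.isSuccLimit_ord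
    hκ.1.le).bot_lt (by simp)
  ⟨a⟩

theorem exists_subst (𝒦 : PCA ℕ) (hκ : κ.IsInaccessible) (φ : Form) (i : ℕ) :
    ∃ e, ∀ (ρ ρ' : ℕ → Dom κ), (∀ j ≠ i, ρ j = ρ' j) → ∀ D,
      e ∈ 𝒦.hImp (eqVal 𝒦 (ρ i) (ρ' i)) (𝒦.hImp (mval 𝒦 φ ρ D) (mval 𝒦 φ ρ' D)) :=
  (equalityLaws 𝒦 hκ).exists_subst φ i

/-- Replacement of the displayed variable by a realizably equal one. -/
theorem exists_subst_zero (𝒦 : PCA ℕ) (hκ : κ.IsInaccessible) (φ : Form) :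
    ∃ e, ∀ (ρ : ℕ → Dom κ) a b D, e ∈ 𝒦.hImp (eqVal 𝒦 a b)
      (𝒦.hImp (mval 𝒦 φ (scons a ρ) D) (mval 𝒦 φ (scons b ρ) D)) := by
  obtain ⟨e, he⟩ := exists_subst 𝒦 hκ φ 0
  refine ⟨e, fun ρ a b D => he (scons a ρ) (scons b ρ) (fun j hj => ?_) D⟩
  cases j with
  | zero => exact absurd rfl hj
  | succ j => rfl

theorem valid_modalExt (𝒦 : PCA ℕ) (hκ : κ.IsInaccessible) : McCartyValid 𝒦 κ modalExt := by
  obtain ⟨e, he⟩ := exists_ext 𝒦 hκ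
  have := Dom.nonempty hκ
  exact valid_iff.2 ⟨𝒦.value _, fun ρ D => value_mem <| .all fun x => .all fun y =>
    .lam 0 fun _ ha => .boxElim 1 (.var 0 ha) fun _ hb => .unit <|
      .app (.app (.const (he x y))
        (.iInter fun c => .descend fun Z => .iffMp (𝒜 := 𝒦) (E := eqVal 𝒦) (M := memVal 𝒦)
          (φ := mem 0 2) (ψ := mem 0 1) (ρ := scons c (scons y (scons x ρ))) (.allElim (.var 1 (hb Z)) c)))
        (.iInter fun c => .descend fun Z => .iffMpr (𝒜 := 𝒦) (E := eqVal 𝒦) (M := memVal 𝒦)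
          (ψ := mem 0 1) (φ := mem 0 2) (ρ := scons c (scons y (scons x ρ)))
          (.allElim (.var 1 (hb Z)) c))⟩

/-- The internal unordered pair. -/
theorem exists_upair (𝒦 : PCA ℕ) (hκ : κ.IsInaccessible) (x y : Dom κ) :
    ∃ z : Dom κ, ∀ u, memVal 𝒦 u z = 𝒦.hOr (eqVal 𝒦 u x) (eqVal 𝒦 u y) := by
  obtain ⟨z, hz⟩ := Dom.exists_comprehension hκ
    -- The indices `k` and `kbar` are the tags of a disjunction, so membership becomes an equality
    -- with `hOr`.
    (fun n c => n = 𝒦.k ∧ c = x ∨ n = 𝒦.kbar ∧ c = y) (δ := max x.1.rank y.1.rank)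
    (max_lt (Dom.rank_lt hκ x) (Dom.rank_lt hκ y)) (by
      rintro n c (⟨-, rfl⟩ | ⟨-, rfl⟩)
      · exact le_max_left _ _
      · exact le_max_right _ _)
  refine ⟨z, fun u => Set.ext fun r => ⟨fun h => ?_, ?_⟩⟩
  · obtain ⟨n, c, hc, _, rfl, f, hf, rfl⟩ := exists_of_mem_memVal hκ h
    rcases (hz _ _).1 hc with ⟨rfl, rfl⟩ | ⟨rfl, rfl⟩
    · exact .inl ⟨_, hf, rfl⟩
    · exact .inr ⟨_, hf, rfl⟩
  · rintro (⟨f, hf, rfl⟩ | ⟨f, hf, rfl⟩)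
    · exact .intro ((hz _ _).2 (.inl ⟨rfl, rfl⟩)) hf
    · exact .intro ((hz _ _).2 (.inr ⟨rfl, rfl⟩)) hf

theorem valid_pairing (𝒦 : PCA ℕ) (hκ : κ.IsInaccessible) : McCartyValid 𝒦 κ pairing := by
  choose z hz using exists_upair 𝒦 hκ
  exact valid_iff.2 ⟨𝒦.value _, fun ρ D => value_mem <| .all fun x => .all fun y =>
    .ex (z x y) <| .box fun Z => .all fun u => .pair
      (.lam 0 fun _ ha => .kleisli 1 (.var 0 ha) fun _ hb => .unit (.cases (.var 1 (hz x y u ▸ hb))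
        (.lam 2 fun _ hc => .inl (.unit (.var 2 hc)))
        (.lam 2 fun _ hc => .inr (.unit (.var 2 hc)))))
      (.lam 0 fun _ ha => .kleisli 1 (.var 0 ha) fun _ hb => .cases (.var 1 hb)
        (.lam 2 fun _ hc => .kleisli 3 (.var 2 hc) fun _ hd => .unit (.cast (hz x y u).symm
          (.inl (.var 3 hd))))
        (.lam 2 fun _ hc => .kleisli 3 (.var 2 hc) fun _ hd => .unit (.cast (hz x y u).symm
          (.inr (.var 3 hd)))))⟩

theorem valid_unions (𝒦 : PCA ℕ) (hκ : κ.IsInaccessible) : McCartyValid 𝒦 κ unions := by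
  let L := equalityLaws 𝒦 hκ
  have (x : Dom κ) := Dom.exists_comprehension hκ
    -- The index stores both membership indices, from which the intermediate `v` can be exhibited
    -- again.
    (fun n c => ∃ m v k, n = 𝒦.pr m k ∧ Dom.El m v x ∧ Dom.El k c v) (δ := x.1.rank)
    (Dom.rank_lt hκ x) (by
      rintro n c ⟨m, v, k, -, h1, h2⟩
      exact (h2.rank_lt.trans h1.rank_lt).le)
  choose y hy using this
  exact valid_iff.2 ⟨𝒦.value _, fun ρ D => value_mem <| .all fun x => .ex (y x) <| .box fun Z =>
    .all fun z => .pair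
      (.lam 0 fun _ ha => .elim 1 (.var 0 ha) fun _ hb => by
        obtain ⟨n, c, hc, hr⟩ := exists_of_mem_memVal hκ hb
        obtain ⟨m, v, k, rfl, hm, hk⟩ := (hy _ _ _).1 hc
        rw [← hAnd_singleton] at hr
        exact .ex v (.pair (.unit (.memVal hm (.fst (.fst (.var 1 hr))) (.const (L.refl_mem _))))
          (.unit (.memVal hk (.snd (.fst (.var 1 hr))) (.snd (.var 1 hr))))))
      (.lam 0 fun _ ha => .exElim 1 (.var 0 ha) fun v _ hb =>
        .kleisli 2 (.fst (.var 1 hb)) fun _ hc => .kleisli 3 (.snd (.var 1 hb)) fun _ hd => .unit <| by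
          obtain ⟨m, v', hm, hr⟩ := exists_of_mem_memVal hκ hc
          exact .bind 4 (.app (.app (.const (L.right_mem _ _ _)) (.snd (.var 2 hr))) (.var 3 hd))
            fun _ he => by
              obtain ⟨k, c, hk, hs⟩ := exists_of_mem_memVal hκ he
              exact .memVal ((hy _ _ _).2 ⟨m, v', k, rfl, hm, hk⟩)
                (.singleton_pair (.pair (.fst (.var 2 hr)) (.fst (.var 4 hs)))) (.snd (.var 4 hs)))⟩

/-- Because of the box, what has to be recorded about φ(c) is a realizer good for all `Z`, which
makes no reference to `D`. Hence a single set, whose indices pair a membership index with such a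
realizer, works for every `D`. -/
theorem valid_boxComprehension (𝒦 : PCA ℕ) (hκ : κ.IsInaccessible) (φ : Form) :
    McCartyValid 𝒦 κ (boxComprehension φ) := by
  let L := equalityLaws 𝒦 hκ
  obtain ⟨s, hs⟩ := exists_subst_zero 𝒦 hκ φ
  have (ρ : ℕ → Dom κ) (x : Dom κ) := Dom.exists_comprehension hκ
    (fun n c => ∃ m k, n = 𝒦.pr m k ∧ Dom.El m c x ∧ k ∈ ⋂ Z, mval 𝒦 φ (scons c (scons x ρ)) Z)
    (δ := x.1.rank) (Dom.rank_lt hκ x) (by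
      rintro n c ⟨m, k, -, h1, -⟩
      exact h1.rank_lt.le)
  choose y hy using this
  have hren (z y x : Dom κ) (ρ : ℕ → Dom κ) (Z : Set ℕ) :
      mval 𝒦 (φ.ren (scons 0 (· + 2))) (scons z (scons y (scons x ρ))) Z =
        mval 𝒦 φ (scons z (scons x ρ)) Z :=
    val_ren_eq φ (fun j => by cases j <;> rfl) Z
  exact valid_iff.2 ⟨𝒦.value _, fun ρ D => value_mem <| .all fun x => .ex (y ρ x) <| .box fun Z =>
    .all fun z => .pair
      (.lam 0 fun _ ha => .elim 1 (.var 0 ha) fun _ hb => by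
        obtain ⟨n, c, hc, hr⟩ := exists_of_mem_memVal hκ hb
        obtain ⟨m, k, rfl, hm, hk⟩ := (hy _ _ _ _).1 hc
        rw [← hAnd_singleton] at hr
        exact .pair (.unit (.memVal hm (.fst (.fst (.var 1 hr))) (.snd (.var 1 hr))))
          (.box fun W => .cast (hren _ _ _ _ _).symm (.app (.app (.const (hs _ _ _ _))
            (.app (.const (L.symm_mem _ _)) (.snd (.var 1 hr))))
              (.inst ((Den.snd (.fst (.var 1 hr))).mono (by simpa using hk)) W))))
      (.lam 0 fun _ ha => .kleisli 1 (.fst (.var 0 ha)) fun _ hb =>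
        .kleisli 2 (.snd (.var 0 ha)) fun r hr' => .unit <| by
          obtain ⟨m, c, hm, hr⟩ := exists_of_mem_memVal hκ hb
          exact .memVal_of_forall (X := 𝒦.hAnd {m} (⋂ Z, mval 𝒦 φ (scons c (scons x ρ)) Z))
            (.pair (.fst (.var 1 hr)) (.iInter fun W => .app (.app (.const (hs _ _ _ _))
              (.snd (.var 1 hr))) (.cast (hren _ _ _ _ _) (.var 2 (Set.mem_iInter.1 hr' W)))))
            (by
              rintro _ ⟨m', hm', k, hk, rfl⟩
              rw [Set.mem_singleton_iff.1 hm']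
              exact (hy _ _ _ _).2 ⟨m, k, rfl, hm, hk⟩)
            (.snd (.var 1 hr)))⟩

/-- Recursion along the elements of names. The recursive realizer must be good for all `Z`, as its
result is used under the inner box; the outer box makes the progressiveness hypothesis equally
uniform. -/
theorem valid_modalFoundation (𝒦 : PCA ℕ) (hκ : κ.IsInaccessible) (φ : Form) :
    McCartyValid 𝒦 κ (modalFoundation φ) := by
  let L := equalityLaws 𝒦 hκ
  obtain ⟨s, hs⟩ := exists_subst_zero 𝒦 hκ φ
  have hren (y x : Dom κ) (ρ : ℕ → Dom κ) (Z : Set ℕ) :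
      mval 𝒦 (φ.ren (scons 0 (· + 2))) (scons y (scons x ρ)) Z = mval 𝒦 φ (scons y ρ) Z :=
    val_ren_eq φ (fun j => by cases j <;> rfl) Z
  have := exists_recursive (𝒜 := 𝒦) (ι := (ℕ → Dom κ) × Dom κ) (InvImage.wf (fun i => i.2) Dom.wf)
    (X := fun i => {r | ∀ Z, r ∈ mval 𝒦
      (all (box (all (mem 0 1 ⟹ φ.ren (scons 0 (· + 2)))) ⟹ φ)) i.1 Z})
    (Y := fun i => ⋂ Z, mval 𝒦 φ (scons i.2 i.1) Z) fun ⟨ρ, x⟩ h r hr ih =>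
      .iInter fun Z => .mp (.allElim (.var 1 (hr Z)) x) <| .box fun W => .all fun y =>
        .lam 2 fun _ ha => .elim 3 (.var 2 ha) fun _ hb => by
          obtain ⟨n, c, hc, hr'⟩ := exists_of_mem_memVal hκ hb
          exact .cast (hren _ _ _ _).symm (.app (.app (.const (hs _ _ _ _))
            (.app (.const (L.symm_mem _ _)) (.snd (.var 3 hr'))))
              (.inst (.app (.var 0 (ih (ρ, c) ⟨_, hc⟩)) (.var 1 hr)) W))
  obtain ⟨h, hh⟩ := this
  have hh' (ρ : ℕ → Dom κ) (x : Dom κ) (Z : Set ℕ) : h ∈ 𝒦.hImp {r | ∀ Z, r ∈ mval 𝒦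
      (all (box (all (mem 0 1 ⟹ φ.ren (scons 0 (· + 2)))) ⟹ φ)) ρ Z} (mval 𝒦 φ (scons x ρ) Z) :=
    fun r hr => (hh (ρ, x) r hr).imp fun _ h => ⟨h.1, Set.mem_iInter.1 h.2 Z⟩
  exact valid_iff.2 ⟨𝒦.value _, fun ρ D => value_mem <| .lam 0 fun _ ha =>
    .boxElim 1 (.var 0 ha) fun _ hb => .box fun Z => .all fun x =>
      .app (.const (hh' ρ x Z)) (.var 1 hb)⟩

/-- A witness is chosen for each element `c` and each number `r` that realizes φ uniformly for some
witness. The choice depends on `c` and `r` only, so the witnesses are bounded by regularity and the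
collecting set does not depend on `D`. The default value `c` of `f` merely adds harmless elements;
all elements get index 0. -/
theorem valid_boxCollection (𝒦 : PCA ℕ) (hκ : κ.IsInaccessible) (φ : Form) :
    McCartyValid 𝒦 κ (boxCollection φ) := by
  classical
  let L := equalityLaws 𝒦 hκ
  obtain ⟨s, hs⟩ := exists_subst 𝒦 hκ φ 1
  let f (ρ : ℕ → Dom κ) (c : Dom κ) (r : ℕ) : Dom κ :=
    if h : ∃ z, ∀ Z, r ∈ mval 𝒦 φ (scons z (scons c ρ)) Z then h.choose else c
  have hf {ρ : ℕ → Dom κ} {z c r} (h : ∀ Z, r ∈ mval 𝒦 φ (scons z (scons c ρ)) Z) :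
      ∀ Z, r ∈ mval 𝒦 φ (scons (f ρ c r) (scons c ρ)) Z := by
    have h' : ∃ z, ∀ Z, r ∈ mval 𝒦 φ (scons z (scons c ρ)) Z := ⟨z, h⟩
    simp only [f, dif_pos h']
    exact h'.choose_spec
  have (ρ : ℕ → Dom κ) : ∃ x : Dom κ, ∀ n z, Dom.El n z x ↔
      n = 0 ∧ ∃ m c r, Dom.El m c (ρ 0) ∧ z = f ρ c r := by
    obtain ⟨δ, hδ, hb⟩ := Dom.exists_bound hκ (ρ 0) fun _ c r => f ρ c r
    exact Dom.exists_comprehension hκ _ hδ (by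
      rintro n z ⟨-, m, c, r, h, rfl⟩
      exact hb m c r h)
  choose x hx using this
  have hren (z y x : Dom κ) (ρ : ℕ → Dom κ) (Z : Set ℕ) :
      mval 𝒦 (φ.ren (scons 0 (scons 1 (· + 3)))) (scons z (scons y (scons x ρ))) Z =
        mval 𝒦 φ (scons z (scons y ρ)) Z :=
    val_ren_eq φ (fun j => match j with | 0 => rfl | 1 => rfl | j + 2 => rfl) Z
  have hs' (z y c : Dom κ) (ρ : ℕ → Dom κ) (Z : Set ℕ) := hs (scons z (scons c ρ))
    (scons z (scons y ρ)) (fun j hj => match j, hj with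
      | 0, _ => rfl | 1, h => absurd rfl h | j + 2, _ => rfl) Z
  exact valid_iff.2 ⟨𝒦.value _, fun ρ D => value_mem <| .lam 0 fun _ ha => .ex (x ρ) <|
    .all fun y => .lam 1 fun _ hb => .elim 2 (.var 1 hb) fun _ hb' => by
      obtain ⟨n, c, hc, hr⟩ := exists_of_mem_memVal hκ hb'
      exact .exElim 3 (.mp (.allElim (.var 0 ha) c) (.unit (.memVal hc (.fst (.var 2 hr))
        (.const (L.refl_mem _))))) fun z _ hz => .boxElim 4 (.var 3 hz) fun r hr4 =>
          .ex (f ρ c r) <| .pair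
            (.unit (.memVal ((hx _ _ _).2 ⟨rfl, n, c, r, hc, rfl⟩) (.const rfl)
              (.const (L.refl_mem _))))
            (.box fun Z => .cast (hren _ _ _ _ _).symm (.app (.app (.const (hs' _ _ _ _ _))
              (.app (.const (L.symm_mem _ _)) (.snd (.var 2 hr)))) (.var 4 (hf hr4 Z))))⟩

end Axioms

end EpistemicSet

-- Modal power set.

namespace EpistemicSet

open Form PCA

section Power

variable {κ : Cardinal.{u}}

theorem Dom.rank_le_of_forall (hκ : κ.IsInaccessible) {z : Dom κ} {δ : Ordinal.{u}}
    (h : ∀ n c, Dom.El n c z → c.1.rank ≤ δ) : z.1.rank ≤ max δ Ordinal.omega0 + 3 := by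
  refine ZFSet.rank_le_iff.2 fun y hy => ?_
  obtain ⟨n, c, hc, rfl⟩ := Dom.exists_of_mem hκ hy
  refine (rank_pair_le (α := max δ Ordinal.omega0) ?_
    ((h n c hc).trans (le_max_left _ _))).trans_lt ((add_lt_add_iff_left _).2 ?_)
  · rw [rank_natSet]
    exact (Ordinal.natCast_lt_omega0 n).le.trans (le_max_right _ _)
  · exact_mod_cast Nat.lt_succ_self 2

theorem Dom.bound_lt (hκ : κ.IsInaccessible) {δ : Ordinal.{u}} (hδ : δ < κ.ord) :
    max δ Ordinal.omega0 + 3 < κ.ord := by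
  have hl : Order.IsSuccLimit κ.ord := Cardinal.isSuccLimit_ord hκ.1.le
  have hω : Ordinal.omega0 < κ.ord := by
    rw [Cardinal.lt_ord, Ordinal.card_omega0]; exact hκ.1
  have : max δ Ordinal.omega0 + 3 = max δ Ordinal.omega0 + 1 + 1 + 1 := by
    norm_num [add_assoc]
  rw [this]
  exact hl.add_one_lt (hl.add_one_lt (hl.add_one_lt (max_lt hδ hω)))

/-- A name `z` that is realizably a subset of `x` may have components outside `x`, so such names
need not be bounded. It is replaced by `z' x z`, whose elements are elements `d` of `x` indexed by
realizers of d ∈ z: this name is bounded and realizably equal to `z`. -/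
theorem valid_modalPower (𝒦 : PCA ℕ) (hκ : κ.IsInaccessible) : McCartyValid 𝒦 κ modalPower := by
  let L := equalityLaws 𝒦 hκ
  have := Dom.nonempty hκ
  obtain ⟨e, he⟩ := exists_ext 𝒦 hκ
  have hy (x : Dom κ) := Dom.exists_comprehension hκ
    (fun n z => (∀ m d, Dom.El m d z → ∃ k, Dom.El k d x) ∧
      n ∈ ⋂ u, 𝒦.hImp (memVal 𝒦 u z) (memVal 𝒦 u x)) (Dom.bound_lt hκ (Dom.rank_lt hκ x)) (by
      rintro n z ⟨h, -⟩
      refine Dom.rank_le_of_forall hκ fun m d hd => ?_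
      obtain ⟨k, hk⟩ := h m d hd
      exact hk.rank_lt.le)
  choose y hy using hy
  have hz (x z : Dom κ) := Dom.exists_comprehension hκ
    (fun n d => (∃ k, Dom.El k d x) ∧ n ∈ memVal 𝒦 d z) (Dom.rank_lt hκ x) (by
      rintro n d ⟨⟨k, hk⟩, -⟩
      exact hk.rank_lt.le)
  choose z' hz using hz
  obtain ⟨f, hf⟩ : ∃ f, ∀ x z : Dom κ, f ∈ 𝒦.hImp (⋂ u, 𝒦.hImp (memVal 𝒦 u z) (memVal 𝒦 u x))
      (⋂ u, 𝒦.hImp (memVal 𝒦 u z) (memVal 𝒦 u (z' x z))) :=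
    ⟨𝒦.value _, fun x z => value_mem <| .lam 0 fun _ ha => .iInter fun u => .lam 1 fun _ hb =>
      .bind 2 (.memVal_app (.var 0 ha) (.var 1 hb)) fun _ hc => by
        obtain ⟨k, d, hd, hr⟩ := exists_of_mem_memVal hκ hc
        exact .memVal_of_forall (X := memVal 𝒦 d z)
          (.app (.app (.const (L.left_mem _ _ _)) (.snd (.var 2 hr))) (.var 1 hb))
          (fun n hn => (hz _ _ _ _).2 ⟨⟨k, hd⟩, hn⟩) (.snd (.var 2 hr))⟩
  obtain ⟨g, hg⟩ : ∃ g, ∀ x z : Dom κ,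
      g ∈ ⋂ u, 𝒦.hImp (memVal 𝒦 u (z' x z)) (memVal 𝒦 u z) :=
    ⟨𝒦.value _, fun x z => value_mem <| .iInter fun u => .lam 0 fun _ ha => by
      obtain ⟨n, d, hd, hr⟩ := exists_of_mem_memVal hκ ha
      exact .app (.app (.const (L.left_mem _ _ _)) (.app (.const (L.symm_mem _ _))
        (.snd (.var 0 hr)))) (.mono (.fst (.var 0 hr)) (by simpa using ((hz _ _ _ _).1 hd).2))⟩
  exact valid_iff.2 ⟨𝒦.value _, fun ρ D => value_mem <| .all fun x => .ex (y x) <| .box fun Z =>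
    .all fun z => .pair
      (.lam 0 fun _ ha => .elim 1 (.var 0 ha) fun _ hb => by
        obtain ⟨n, c, hc, hr⟩ := exists_of_mem_memVal hκ hb
        exact .box fun W => .all fun u => .lam 2 fun _ hm => .kleisli 3 (.var 2 hm) fun _ hm' =>
          .unit (.memVal_app (a := c) (.mono (.fst (.var 1 hr))
            (Set.singleton_subset_iff.2 ((hy _ _ _).1 hc).2))
            (.app (.app (.const (L.right_mem _ _ _)) (.snd (.var 1 hr))) (.var 3 hm'))))
      (.lam 0 fun _ ha => .kleisli 1 (.var 0 ha) fun _ hb => .unit <|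
        .bind 2 (X := ⋂ u, 𝒦.hImp (memVal 𝒦 u z) (memVal 𝒦 u x))
          (.iInter fun u => .descend fun W =>
            .allElim (E := eqVal 𝒦) (M := memVal 𝒦) (φ := mem 0 1 ⟹ mem 0 3)
              (ρ := scons z (scons (y x) (scons x ρ))) (.var 1 (Set.mem_iInter.1 hb W)) u)
          fun _ hc => .memVal_of_forall (c := z' x z)
            (X := ⋂ u, 𝒦.hImp (memVal 𝒦 u (z' x z)) (memVal 𝒦 u x))
            (.iInter fun u => .lam 3 fun _ hd => .memVal_app (.var 2 hc)
              (.memVal_app (.const (hg x z)) (.var 3 hd)))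
            (fun n hn => (hy _ _ _).2 ⟨fun m d hd => ((hz _ _ _ _).1 hd).1, hn⟩)
            (.app (.app (.const (he _ _)) (.app (.const (hf x z)) (.var 2 hc))) (.const (hg x z))))⟩

end Power

end EpistemicSet

-- Natural numbers in McCarty's model.

namespace EpistemicSet

open Form PCA

section Omega

variable {𝒦 : PCA ℕ} {κ : Cardinal.{u}} {γ : ℕ → ℕ} {t v w : Tm ℕ} {n : ℕ} {X Y Z D : Set ℕ}
  {φ ψ : Form} {ρ ρ' : ℕ → Dom κ}

theorem mem_numBar {z : ZFSet.{u}} : z ∈ numBar 𝒦 n ↔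
    ∃ j < n, z = ZFSet.pair (natSet (𝒦.numeral j)) (numBar 𝒦 j) := by
  induction n with
  | zero => simp [numBar]
  | succ n ih =>
    rw [numBar, ZFSet.mem_insert_iff, ih]
    constructor
    · rintro (rfl | ⟨j, hj, rfl⟩)
      · exact ⟨n, by omega, rfl⟩
      · exact ⟨j, by omega, rfl⟩
    · rintro ⟨j, hj, rfl⟩
      rcases Nat.lt_succ_iff_lt_or_eq.1 hj with h | rfl
      · exact .inr ⟨j, h, rfl⟩
      · exact .inl rfl

theorem isName_numBar (𝒦 : PCA ℕ) (n : ℕ) : IsName (numBar.{u} 𝒦 n) := by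
  induction n using Nat.strong_induction_on with
  | _ n ih =>
    refine ⟨fun z hz => ?_, fun m y hz => ?_⟩
    · obtain ⟨j, -, rfl⟩ := mem_numBar.1 hz
      exact ⟨_, _, rfl⟩
    · obtain ⟨j, hj, h⟩ := mem_numBar.1 hz
      rw [(ZFSet.pair_inj.1 h).2]
      exact ih j hj

theorem rank_numBar_pair_lt {m : ℕ} (h : (numBar.{u} 𝒦 n).rank < Ordinal.omega0) :
    (ZFSet.pair (natSet m) (numBar.{u} 𝒦 n)).rank < Ordinal.omega0 := by
  obtain ⟨k, hk⟩ := Ordinal.lt_omega0.1 h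
  have := rank_pair_le (x := natSet.{u} m) (y := numBar 𝒦 n) (α := ((max m k : ℕ) : Ordinal.{u}))
    (by rw [rank_natSet]; exact_mod_cast le_max_left _ _) (by
      rw [hk]; exact_mod_cast le_max_right _ _)
  refine this.trans_lt ?_
  exact_mod_cast Ordinal.natCast_lt_omega0 (max m k + 2)

theorem rank_numBar_lt (𝒦 : PCA ℕ) (n : ℕ) : (numBar.{u} 𝒦 n).rank < Ordinal.omega0 := by
  induction n with
  | zero => simp [numBar]
  | succ n ih =>
    rw [numBar, ZFSet.rank_insert]
    exact max_lt (Ordinal.isSuccLimit_omega0.succ_lt (rank_numBar_pair_lt ih)) ih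

theorem Dom.omega0_lt (hκ : κ.IsInaccessible) : Ordinal.omega0 < κ.ord := by
  rw [Cardinal.lt_ord, Ordinal.card_omega0]; exact hκ.1

/-- The natural number `n` in McCarty's model. -/
noncomputable def num (𝒦 : PCA ℕ) (hκ : κ.IsInaccessible) (n : ℕ) : Dom κ :=
  ⟨numBar 𝒦 n, (mem_V_ord hκ).2 ⟨isName_numBar 𝒦 n,
    (rank_numBar_lt 𝒦 n).trans (Dom.omega0_lt hκ)⟩⟩

theorem omegaBar_mem (𝒦 : PCA ℕ) (hκ : κ.IsInaccessible) : omegaBar 𝒦 ∈ V κ.ord := by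
  refine (mem_V_ord hκ).2 ⟨⟨fun z hz => ?_, fun m y hz => ?_⟩,
    lt_of_le_of_lt (ZFSet.rank_le_iff.2 fun z hz => ?_) (Dom.omega0_lt hκ)⟩
  · obtain ⟨j, rfl⟩ := ZFSet.mem_range.1 hz
    exact ⟨_, _, rfl⟩
  · obtain ⟨j, h⟩ := ZFSet.mem_range.1 hz
    rw [← (ZFSet.pair_inj.1 h).2]
    exact isName_numBar 𝒦 j
  · obtain ⟨j, rfl⟩ := ZFSet.mem_range.1 hz
    exact rank_numBar_pair_lt (rank_numBar_lt 𝒦 j)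

/-- The set of natural numbers in McCarty's model. -/
noncomputable def omega (𝒦 : PCA ℕ) (hκ : κ.IsInaccessible) : Dom κ :=
  ⟨omegaBar 𝒦, omegaBar_mem 𝒦 hκ⟩

theorem el_num (hκ : κ.IsInaccessible) {m : ℕ} {c : Dom κ} : Dom.El m c (num 𝒦 hκ n) ↔
    ∃ j < n, m = 𝒦.numeral j ∧ c = num 𝒦 hκ j := by
  refine mem_numBar.trans ⟨?_, ?_⟩
  · rintro ⟨j, hj, h⟩
    obtain ⟨h1, h2⟩ := ZFSet.pair_inj.1 h
    exact ⟨j, hj, natSet_injective h1, Subtype.ext h2⟩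
  · rintro ⟨j, hj, rfl, rfl⟩
    exact ⟨j, hj, rfl⟩

theorem el_omega (hκ : κ.IsInaccessible) {m : ℕ} {c : Dom κ} : Dom.El m c (omega 𝒦 hκ) ↔
    ∃ j, m = 𝒦.numeral j ∧ c = num 𝒦 hκ j := by
  refine ZFSet.mem_range.trans ⟨?_, ?_⟩
  · rintro ⟨j, h⟩
    obtain ⟨h1, h2⟩ := ZFSet.pair_inj.1 h
    exact ⟨j, natSet_injective h1.symm, Subtype.ext h2.symm⟩
  · rintro ⟨j, rfl, rfl⟩
    exact ⟨j, rfl⟩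

theorem exists_of_mem_omega (hκ : κ.IsInaccessible) {a : Dom κ} {r : ℕ}
    (h : r ∈ memVal 𝒦 a (omega 𝒦 hκ)) :
    ∃ n, r ∈ 𝒦.hAnd {𝒦.numeral n} (eqVal 𝒦 a (num 𝒦 hκ n)) := by
  obtain ⟨m, c, hc, hr⟩ := exists_of_mem_memVal hκ h
  obtain ⟨j, rfl, rfl⟩ := (el_omega hκ).1 hc
  exact ⟨j, hr⟩

theorem memVal_num_zero (hκ : κ.IsInaccessible) (a : Dom κ) : memVal 𝒦 a (num 𝒦 hκ 0) = ∅ := by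
  refine Set.eq_empty_of_forall_notMem fun r h => ?_
  obtain ⟨m, c, hc, -⟩ := exists_of_mem_memVal hκ h
  obtain ⟨j, hj, -⟩ := (el_num hκ).1 hc
  omega

/-- A computed Boolean is made into a tagged pair with a dummy content. Each branch may assume its
case, since it is only required to behave well when selected. -/
theorem PCA.Den.decide {P : Prop} [Decidable P] (ht : 𝒦.Den γ t {if P then 𝒦.k else 𝒦.kbar})
    (hv : 𝒦.Den γ v {e | P → e ∈ 𝒦.hImp Set.univ X})
    (hw : 𝒦.Den γ w {e | ¬ P → e ∈ 𝒦.hImp Set.univ X}) :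
    𝒦.Den γ (𝒦.tCases (𝒦.tPair t (.const 0)) v w) X := by
  by_cases hP : P
  · rw [if_pos hP] at ht
    exact .cases_left (.pair ht (.const (Set.mem_univ _))) (hv.mono fun _ h => h hP) hw
  · rw [if_neg hP] at ht
    exact .cases_right (.pair ht (.const (Set.mem_univ _))) hv (hw.mono fun _ h => h hP)

theorem PCA.Den.numeral_succ (ht : 𝒦.Den γ t {𝒦.numeral n}) :
    𝒦.Den γ (𝒦.tPair (.const 𝒦.kbar) t) {𝒦.numeral (n + 1)} :=
  .singleton_pair (.pair (.const rfl) ht)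

/-- An element of the successor of `n` is an element of `n` or equal to `n`. -/
theorem exists_mem_num_succ (hK : IsKleeneFirst 𝒦) (hκ : κ.IsInaccessible) :
    ∃ e, ∀ n c, e ∈ 𝒦.hImp {𝒦.numeral n} (𝒦.hImp (memVal 𝒦 c (num 𝒦 hκ (n + 1)))
      (𝒦.hOr (memVal 𝒦 c (num 𝒦 hκ n)) (eqVal 𝒦 c (num 𝒦 hκ n)))) := by
  obtain ⟨f, hf⟩ := exists_realizer hK (f := fun p : ℕ × ℕ => if p.1 < p.2 then 𝒦.k else 𝒦.kbar)
    (Primrec.ite (Primrec.nat_lt.comp Primrec.fst Primrec.snd) (.const _) (.const _)).to_comp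
  obtain ⟨g, hg⟩ := exists_code_of_numeral hK
  obtain ⟨p, hp⟩ := exists_pairCode hK (α := ℕ) (β := ℕ)
  exact ⟨𝒦.value _, fun n c => value_mem <| .lam 0 fun _ ha => .lam 1 fun _ hb => by
    obtain ⟨m, d, hd, hr⟩ := exists_of_mem_memVal hκ hb
    obtain ⟨j, hj, rfl, rfl⟩ := (el_num hκ).1 hd
    -- The index of a membership in n + 1 is the numeral of some j ≤ n, and comparing it with n
    -- decides the disjunction.
    exact .decide (P := j < n) (.app (.const (hf (j, n))) (.app (.const (hp _ _))
      (.pair (.app (.const (hg _)) (.fst (.var 1 hr))) (.app (.const (hg _)) (.var 0 ha)))))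
      (.lamAll 2 fun h _ _ => .inl (.memVal ((el_num hκ).2 ⟨j, h, rfl, rfl⟩) (.fst (.var 1 hr))
        (.snd (.var 1 hr))))
      (.lamAll 2 fun h _ _ => .inr (.cast (by rw [show j = n by omega]) (.snd (.var 1 hr))))⟩

theorem exists_mem_num_succ_of_mem (hκ : κ.IsInaccessible) :
    ∃ e, ∀ n c, e ∈ 𝒦.hImp (memVal 𝒦 c (num 𝒦 hκ n)) (memVal 𝒦 c (num 𝒦 hκ (n + 1))) := by
  exact ⟨𝒦.value _, fun n c => value_mem <| .lam 0 fun _ ha => by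
    obtain ⟨m, d, hd, hr⟩ := exists_of_mem_memVal hκ ha
    obtain ⟨j, hj, rfl, rfl⟩ := (el_num hκ).1 hd
    exact .memVal ((el_num hκ).2 ⟨j, by omega, rfl, rfl⟩) (.fst (.var 0 hr)) (.snd (.var 0 hr))⟩

/-! ### Formulas and their Gödel translations -/

/-- A box if `g` is true. -/
def Form.bx (g : Bool) (φ : Form) : Form := bif g then box φ else φ

/-- The Gödel translation if `g` is true, and the formula itself otherwise. -/
def Form.tr (g : Bool) : Form → Form
  | and φ ψ => and (tr g φ) (tr g ψ)
  | or φ ψ => or (tr g φ) (tr g ψ)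
  | imp φ ψ => bx g (imp (tr g φ) (tr g ψ))
  | all φ => bx g (all (tr g φ))
  | ex φ => ex (tr g φ)
  | box φ => box (tr g φ)
  | bot => bot
  | eq x y => eq x y
  | mem x y => mem x y

theorem Form.tr_false (φ : Form) : tr false φ = φ := by
  induction φ <;> simp_all [tr, bx]

theorem Form.tr_true (φ : Form) : tr true φ = godel φ := by
  induction φ <;> simp_all [tr, bx, godel]

/-- A term for the introduction of an optional box. -/
def tBx (𝒦 : PCA ℕ) (g : Bool) (t : Tm ℕ) : Tm ℕ := bif g then 𝒦.tUnit t else t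

theorem PCA.Den.bx {g : Bool} (h : ∀ Z, 𝒦.Den γ t (mval 𝒦 φ ρ Z)) :
    𝒦.Den γ (tBx 𝒦 g t) (mval 𝒦 (Form.bx g φ) ρ D) := by
  cases g with
  | false => exact h D
  | true => exact .box h

theorem exists_isEmpty (𝒦 : PCA ℕ) (hκ : κ.IsInaccessible) (g : Bool) :
    ∃ e, ∀ (ρ : ℕ → Dom κ) i, ρ i = num 𝒦 hκ 0 → ∀ D, e ∈ mval 𝒦 (tr g (isEmpty i)) ρ D :=
  ⟨𝒦.value _, fun ρ i hi D => value_mem <| .bx fun Z => .all fun c => .bx fun W => .lam 0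
    fun _ ha => .kleisli 1 (.var 0 ha) fun _ (hb : _ ∈ memVal 𝒦 c (ρ i)) => by
      rw [hi, memVal_num_zero] at hb
      exact .var 0 hb.elim⟩

theorem exists_isSucc (hK : IsKleeneFirst 𝒦) (hκ : κ.IsInaccessible) (g : Bool) :
    ∃ e, ∀ (ρ : ℕ → Dom κ) i j n, ρ i = num 𝒦 hκ (n + 1) → ρ j = num 𝒦 hκ n → ∀ D,
      e ∈ 𝒦.hImp {𝒦.numeral n} (mval 𝒦 (tr g (isSucc i j)) ρ D) := by
  obtain ⟨e, he⟩ := exists_mem_num_succ hK hκ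
  obtain ⟨f, hf⟩ := exists_mem_num_succ_of_mem (𝒦 := 𝒦) hκ
  exact ⟨𝒦.value _, fun ρ i j n hi hj D => value_mem <| .lam 0 fun _ hn => .bx fun Z =>
    .all fun c => .pair
      (.bx fun W => .lam 1 fun _ ha => .kleisli 2 (.var 1 ha)
        fun _ (hb : _ ∈ memVal 𝒦 c (ρ i)) => .unit <| .cases
          (.app (.app (.const (he n c)) (.var 0 hn)) (.var 2 (hi ▸ hb)))
          (.lam 3 fun _ hc => .inl (.cast (by rw [← hj]; rfl) (.unit (.var 3 hc))))
          (.lam 3 fun _ hc => .inr (.cast (by rw [← hj]; rfl) (.unit (.var 3 hc)))))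
      (.bx fun W => .lam 1 fun _ ha => .kleisli 2 (.var 1 ha) fun _ hb => .cases (.var 2 hb)
          (.lam 3 fun _ hc => .kleisli 4 (.var 3 hc) fun _ (hd : _ ∈ memVal 𝒦 c (ρ j)) => .unit
            (.cast (by rw [← hi]; rfl) (.app (.const (hf n c)) (.var 4 (hj ▸ hd)))))
          (.lam 3 fun _ hc => .kleisli 4 (.var 3 hc) fun _ (hd : _ ∈ eqVal 𝒦 c (ρ j)) => .unit
            (.cast (by rw [← hi]; rfl) (.memVal ((el_num hκ).2 ⟨n, by omega, rfl, rfl⟩)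
              (.var 0 hn) (.var 4 (hj ▸ hd))))))⟩

end Omega

end EpistemicSet

-- Inductive sets and the uniqueness of ω.

namespace EpistemicSet

open Form PCA

section Induction

variable {𝒦 : PCA ℕ} {κ : Cardinal.{u}} {γ : ℕ → ℕ} {t v w : Tm ℕ} {n : ℕ} {X Y Z D : Set ℕ}
  {φ ψ : Form} {ρ ρ' : ℕ → Dom κ}

theorem exists_isEmpty_untr (𝒦 : PCA ℕ) (hκ : κ.IsInaccessible) :
    ∃ e, ∀ (ρ : ℕ → Dom κ) i, ρ i = num 𝒦 hκ 0 → ∀ D, e ∈ mval 𝒦 (isEmpty i) ρ D := by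
  simpa only [tr_false] using exists_isEmpty 𝒦 hκ false

theorem exists_isSucc_untr (hK : IsKleeneFirst 𝒦) (hκ : κ.IsInaccessible) :
    ∃ e, ∀ (ρ : ℕ → Dom κ) i j n, ρ i = num 𝒦 hκ (n + 1) → ρ j = num 𝒦 hκ n → ∀ D,
      e ∈ 𝒦.hImp {𝒦.numeral n} (mval 𝒦 (isSucc i j) ρ D) := by
  simpa only [tr_false] using exists_isSucc hK hκ false

theorem exists_isInductive (hK : IsKleeneFirst 𝒦) (hκ : κ.IsInaccessible) (i : ℕ) :
    ∃ e, ∀ ρ : ℕ → Dom κ, ρ i = omega 𝒦 hκ → ∀ D, e ∈ mval 𝒦 (isInductive i) ρ D := by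
  let L := equalityLaws 𝒦 hκ
  obtain ⟨e, he⟩ := exists_isEmpty_untr 𝒦 hκ
  obtain ⟨f, hf⟩ := exists_isSucc_untr hK hκ
  obtain ⟨s, hs⟩ := exists_subst 𝒦 hκ (isSucc 0 1) 1
  have hs' (z y c : Dom κ) (ρ : ℕ → Dom κ) (Z : Set ℕ) := hs (scons z (scons c ρ))
    (scons z (scons y ρ)) (fun j hj => match j, hj with
      | 0, _ => rfl | 1, h => absurd rfl h | j + 2, _ => rfl) Z
  exact ⟨𝒦.value _, fun ρ hi D => value_mem <| .pair
    (.ex (num 𝒦 hκ 0) (.pair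
      (.unit (.memVal (n := 𝒦.numeral 0) (c := num 𝒦 hκ 0)
        (show Dom.El _ _ (ρ i) from hi ▸ (el_omega hκ).2 ⟨0, rfl, rfl⟩)
        (.const rfl) (.const (L.refl_mem _))))
      (.box fun Z => .const (he _ _ rfl _))))
    (.all fun y => .lam 0 fun _ ha => .elim 1 (.var 0 ha)
      fun _ (hb : _ ∈ memVal 𝒦 y (ρ i)) => by
        rw [hi] at hb
        obtain ⟨n, hr⟩ := exists_of_mem_omega hκ hb
        exact .ex (num 𝒦 hκ (n + 1)) (.pair
          (.unit (.memVal (n := 𝒦.numeral (n + 1)) (c := num 𝒦 hκ (n + 1))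
            (show Dom.El _ _ (ρ i) from hi ▸ (el_omega hκ).2 ⟨n + 1, rfl, rfl⟩)
            (.numeral_succ (.fst (.var 1 hr))) (.const (L.refl_mem _))))
          (.box fun Z => .app (.app (.const (hs' _ y (num 𝒦 hκ n) _ Z))
            (.app (.const (L.symm_mem _ _)) (.snd (.var 1 hr))))
              (.app (.const (hf _ 0 1 n rfl rfl Z)) (.fst (.var 1 hr))))))⟩

theorem valid_infinity (hK : IsKleeneFirst 𝒦) (hκ : κ.IsInaccessible) :
    McCartyValid 𝒦 κ infinity := by
  obtain ⟨e, he⟩ := exists_isInductive hK hκ 0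
  exact valid_iff.2 ⟨𝒦.value _, fun ρ D => value_mem <| .ex (omega 𝒦 hκ) <| .box fun Z =>
    .const (he _ rfl _)⟩

/-- An element without elements is the number zero. -/
theorem exists_eq_zero (𝒦 : PCA ℕ) (hκ : κ.IsInaccessible) : ∃ e, ∀ (ρ : ℕ → Dom κ),
    e ∈ 𝒦.hImp (⋂ Z, mval 𝒦 (isEmpty 0) ρ Z) (eqVal 𝒦 (ρ 0) (num 𝒦 hκ 0)) := by
  have := Dom.nonempty hκ
  obtain ⟨e, he⟩ := exists_ext 𝒦 hκ
  exact ⟨𝒦.value _, fun ρ => value_mem <| .lam 0 fun _ ha => .app (.app (.const (he _ _))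
    (.iInter fun c => .cast (X := 𝒦.hImp (memVal 𝒦 c (ρ 0)) ∅) (by rw [memVal_num_zero])
      (.descend fun Z => .allElim (E := eqVal 𝒦) (M := memVal 𝒦) (φ := neg (mem 0 1))
        (ρ := ρ) (.var 0 (Set.mem_iInter.1 ha Z)) c)))
    (.iInter fun c => .lam 1 fun _ hb => by
      rw [memVal_num_zero] at hb
      exact .var 1 hb.elim)⟩

/-- The successor of `n` is the number `n + 1`. -/
theorem exists_eq_succ (hK : IsKleeneFirst 𝒦) (hκ : κ.IsInaccessible) :
    ∃ e, ∀ (ρ : ℕ → Dom κ) n, ρ 1 = num 𝒦 hκ n → e ∈ 𝒦.hImp {𝒦.numeral n}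
      (𝒦.hImp (⋂ Z, mval 𝒦 (isSucc 0 1) ρ Z) (eqVal 𝒦 (ρ 0) (num 𝒦 hκ (n + 1)))) := by
  have := Dom.nonempty hκ
  obtain ⟨e, he⟩ := exists_ext 𝒦 hκ
  obtain ⟨f, hf⟩ := exists_mem_num_succ hK hκ
  obtain ⟨g, hg⟩ := exists_mem_num_succ_of_mem (𝒦 := 𝒦) hκ
  exact ⟨𝒦.value _, fun ρ n hρ => value_mem <| .lam 0 fun _ hn => .lam 1 fun _ ha =>
    .app (.app (.const (he _ _))
    (.iInter fun c => .descend fun Z => .lam 2 fun _ hb => .kleisli 3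
      (.mp (E := eqVal 𝒦) (M := memVal 𝒦) (φ := mem 0 1) (ψ := mem 0 2 ⩖ eq 0 2)
        (ρ := scons c ρ) (.iffMp (.allElim (.var 1 (Set.mem_iInter.1 ha Z)) c)) (.var 2 hb))
      fun _ hc => .cases (.var 3 hc)
        (.lam 4 fun _ (hd : _ ∈ 𝒦.ominus Z (memVal 𝒦 c (ρ 1))) => .kleisli 5 (.var 4 hd)
          fun _ h => .unit (.app (.const (hg n c)) (.var 5 (hρ ▸ h))))
        (.lam 4 fun _ (hd : _ ∈ 𝒦.ominus Z (eqVal 𝒦 c (ρ 1))) => .kleisli 5 (.var 4 hd)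
          fun _ h => .unit (.memVal ((el_num hκ).2 ⟨n, by omega, rfl, rfl⟩)
              (.var 0 hn) (.var 5 (hρ ▸ h))))))
    (.iInter fun c => .descend fun Z => .lam 2 fun _ hb =>
      .mp (E := eqVal 𝒦) (M := memVal 𝒦) (ψ := mem 0 1) (φ := mem 0 2 ⩖ eq 0 2)
        (ρ := scons c ρ) (.iffMpr (.allElim (.var 1 (Set.mem_iInter.1 ha Z)) c))
          (.kleisli 3 (.var 2 hb) fun _ hc => .unit <| .cases
            (.app (.app (.const (hf n c)) (.var 0 hn)) (.var 3 hc))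
            (.lam 4 fun _ hd => .inl (.cast (X := 𝒦.ominus Z (memVal 𝒦 c (num 𝒦 hκ n)))
              (by rw [← hρ]; rfl) (.unit (.var 4 hd))))
            (.lam 4 fun _ hd => .inr (.cast (X := 𝒦.ominus Z (eqVal 𝒦 c (num 𝒦 hκ n)))
              (by rw [← hρ]; rfl) (.unit (.var 4 hd))))))⟩

/-- Every number belongs to every inductive set. -/
theorem exists_num_mem (hK : IsKleeneFirst 𝒦) (hκ : κ.IsInaccessible) :
    ∃ e, ∀ (ρ : ℕ → Dom κ) i D n, e ∈ 𝒦.hImp (mval 𝒦 (isInductive i) ρ D)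
      (𝒦.hImp {𝒦.numeral n} (𝒦.ominus D (memVal 𝒦 (num 𝒦 hκ n) (ρ i)))) := by
  let L := equalityLaws 𝒦 hκ
  obtain ⟨e, he⟩ := exists_eq_zero 𝒦 hκ
  obtain ⟨f, hf⟩ := exists_eq_succ hK hκ
  obtain ⟨r, hr⟩ := exists_natRec 𝒦
  exact ⟨𝒦.value _, fun ρ i D n => value_mem <| .lam 0 fun _ ha =>
    -- The recursion runs inside ⊖_D, since inductiveness at `D` supplies zero and successors only
    -- under ⊖_D.
    .app (.app (.const (hr (fun n => 𝒦.ominus D (memVal 𝒦 (num 𝒦 hκ n) (ρ i))) n))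
      (.kleisli 1 (.fst (.var 0 ha)) fun _ hb => by
        obtain ⟨y, hy⟩ := Set.mem_iUnion.1 hb
        exact .kleisli 2 (.fst (.var 1 hy)) fun _ hc => .kleisli 3 (.snd (.var 1 hy))
          fun _ hd => .unit (.app (.app (.const (L.left_mem y (num 𝒦 hκ 0) (ρ i)))
            (.app (.const (he (scons y ρ))) (.var 3 hd))) (.var 2 hc))))
      (.lamAll 1 fun n _ hn => .lam 2 fun _ hm => .kleisli 3
        (.mp (E := eqVal 𝒦) (M := memVal 𝒦) (φ := mem 0 (i + 1))
          (ψ := ex (mem 0 (i + 2) ⩕ box (isSucc 0 1))) (.allElim (.snd (.var 0 ha)) (num 𝒦 hκ n))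
          (.var 2 hm)) fun _ hb => by
          obtain ⟨y, hy⟩ := Set.mem_iUnion.1 hb
          exact .kleisli 4 (.fst (.var 3 hy)) fun _ hc => .kleisli 5 (.snd (.var 3 hy))
            fun _ hd => .unit (.app (.app (.const (L.left_mem y (num 𝒦 hκ (n + 1)) (ρ i)))
              (.app (.app (.const (hf (scons y (scons (num 𝒦 hκ n) ρ)) n rfl)) (.var 1 hn))
                (.var 5 hd))) (.var 4 hc)))⟩

theorem exists_isOmega (hK : IsKleeneFirst 𝒦) (hκ : κ.IsInaccessible) (i : ℕ) :
    ∃ e, ∀ ρ : ℕ → Dom κ, ρ i = omega 𝒦 hκ → ∀ D, e ∈ mval 𝒦 (isOmega i) ρ D := by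
  let L := equalityLaws 𝒦 hκ
  obtain ⟨e, he⟩ := exists_isInductive hK hκ i
  obtain ⟨f, hf⟩ := exists_num_mem hK hκ
  exact ⟨𝒦.value _, fun ρ hi D => value_mem <| .box fun Z => .pair (.const (he _ hi _)) <|
    .all fun v => .lam 0 fun _ ha => .all fun z => .lam 1 fun _ hb => .elim 2 (.var 1 hb)
      fun _ (hc : _ ∈ memVal 𝒦 z (ρ i)) => by
        rw [hi] at hc
        obtain ⟨n, hr⟩ := exists_of_mem_omega hκ hc
        exact .kleisli 3 (.app (.app (.const (hf (scons v ρ) 0 Z n)) (.var 0 ha))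
          (.fst (.var 2 hr))) fun _ hd => .unit (.app (.app (.const (L.left_mem _ z v))
            (.app (.const (L.symm_mem _ _)) (.snd (.var 2 hr)))) (.var 3 hd))⟩

/-- The set of natural numbers is unique. -/
theorem exists_eq_omega (hK : IsKleeneFirst 𝒦) (hκ : κ.IsInaccessible) :
    ∃ e, ∀ (ρ : ℕ → Dom κ), e ∈ 𝒦.hImp (⋂ Z, mval 𝒦
      (isInductive 0 ⩕ all (isInductive 0 ⟹ all (mem 0 2 ⟹ mem 0 1))) ρ Z)
      (eqVal 𝒦 (ρ 0) (omega 𝒦 hκ)) := by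
  let L := equalityLaws 𝒦 hκ
  have := Dom.nonempty hκ
  obtain ⟨e, he⟩ := exists_ext 𝒦 hκ
  obtain ⟨f, hf⟩ := exists_isInductive hK hκ 0
  obtain ⟨g, hg⟩ := exists_num_mem hK hκ
  exact ⟨𝒦.value _, fun ρ => value_mem <| .lam 0 fun _ ha => .app (.app (.const (he _ _))
    (.iInter fun c => .descend fun Z => .allElim (E := eqVal 𝒦) (M := memVal 𝒦)
      (φ := mem 0 2 ⟹ mem 0 1) (ρ := scons (omega 𝒦 hκ) ρ) (.mp (φ := isInductive 0) (.allElim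
        (φ := isInductive 0 ⟹ all (mem 0 2 ⟹ mem 0 1)) (ρ := ρ)
        (.snd (.var 0 (Set.mem_iInter.1 ha Z))) (omega 𝒦 hκ)) (.const (hf _ rfl Z))) c))
    (.iInter fun c => .lam 1 fun _ hb => by
      obtain ⟨n, hr⟩ := exists_of_mem_omega hκ hb
      -- The hypothesis is uniform in `Z`; at the value of the desired membership itself the
      -- identity removes the double negation.
      exact .app (.app (.const (L.left_mem (num 𝒦 hκ n) _ _)) (.app (.const (L.symm_mem _ _))
        (.snd (.var 1 hr)))) (.extract (.app (.app (.const (hg ρ 0 _ n))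
          (.fst (.var 0 (Set.mem_iInter.1 ha (memVal 𝒦 (num 𝒦 hκ n) (ρ 0))))))
            (.fst (.var 1 hr))) 2 fun _ hd => .var 2 hd))⟩

end Induction

end EpistemicSet

namespace EpistemicSet

open Form PCA

/-! ### Primitive recursive functions -/

theorem get_cons_eq {n : ℕ} (a : ℕ) (v : List.Vector ℕ n) :
    (a ::ᵥ v).get = Fin.cons a v.get := by
  funext i
  refine Fin.cases ?_ (fun i => ?_) i
  · simp
  · simp

theorem get_tail_eq {n : ℕ} (v : List.Vector ℕ (n + 1)) :
    v.tail.get = fun i : Fin n => v.get i.succ :=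
  funext fun i => List.Vector.get_tail_succ v i

theorem get_ofFn_eq {n : ℕ} (f : Fin n → ℕ) : (List.Vector.ofFn f).get = f :=
  funext fun i => List.Vector.get_ofFn f i

theorem PR.primrec {n : ℕ} (c : PR n) : Primrec fun v : List.Vector ℕ n => c.eval v.get := by
  refine Nat.Primrec'.to_prim ?_
  induction c with
  | zero => exact .zero
  | succ => exact Nat.Primrec'.succ.of_eq fun v => by simp [PR.eval]
  | proj i => exact .get i
  | comp f g ihf ihg =>
    exact (Nat.Primrec'.comp _ ihf ihg).of_eq fun v => by simp [PR.eval, get_ofFn_eq]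
  | prec f g ihf ihg =>
    exact (Nat.Primrec'.prec ihf ihg).of_eq fun v => by
      simp only [PR.eval, get_cons_eq, get_tail_eq, List.Vector.get_zero]

theorem PR.eval_prec_zero {n : ℕ} (f : PR n) (g : PR (n + 2)) (v : List.Vector ℕ n) :
    (PR.prec f g).eval (0 ::ᵥ v).get = f.eval v.get := by
  simp [PR.eval]

theorem PR.eval_prec_succ {n : ℕ} (f : PR n) (g : PR (n + 2)) (m : ℕ) (v : List.Vector ℕ n) :
    (PR.prec f g).eval ((m + 1) ::ᵥ v).get =
      g.eval (m ::ᵥ (PR.prec f g).eval (m ::ᵥ v).get ::ᵥ v).get := by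
  simp [PR.eval, get_cons_eq]

section Graph

variable {𝒦 : PCA ℕ} {κ : Cardinal.{u}} {γ : ℕ → ℕ} {t v w : Tm ℕ} {n : ℕ} {X Y Z D : Set ℕ}
  {φ ψ : Form} {ρ ρ' : ℕ → Dom κ}

/-! ### Ordered pairs -/

/-- The internal unordered pair. -/
noncomputable def up (𝒦 : PCA ℕ) (hκ : κ.IsInaccessible) (x y : Dom κ) : Dom κ :=
  (exists_upair 𝒦 hκ x y).choose

theorem memVal_up (𝒦 : PCA ℕ) (hκ : κ.IsInaccessible) (x y u : Dom κ) :
    memVal 𝒦 u (up 𝒦 hκ x y) = 𝒦.hOr (eqVal 𝒦 u x) (eqVal 𝒦 u y) :=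
  (exists_upair 𝒦 hκ x y).choose_spec u

/-- The internal ordered pair. -/
noncomputable def op (𝒦 : PCA ℕ) (hκ : κ.IsInaccessible) (x y : Dom κ) : Dom κ :=
  up 𝒦 hκ (up 𝒦 hκ x x) (up 𝒦 hκ x y)

theorem exists_isUPair (𝒦 : PCA ℕ) (hκ : κ.IsInaccessible) (g : Bool) :
    ∃ e, ∀ (ρ : ℕ → Dom κ) i x y, ρ i = up 𝒦 hκ (ρ x) (ρ y) → ∀ D,
      e ∈ mval 𝒦 (tr g (isUPair i x y)) ρ D :=
  ⟨𝒦.value _, fun ρ i x y hi D => value_mem <| .bx fun Z => .all fun u =>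
    have hu : memVal 𝒦 u (ρ i) = 𝒦.hOr (eqVal 𝒦 u (ρ x)) (eqVal 𝒦 u (ρ y)) := by
      rw [hi, memVal_up]
    .pair
      (.bx fun W => .lam 0 fun _ ha => .kleisli 1 (.var 0 ha) fun _ (hb : _ ∈ memVal 𝒦 u (ρ i)) =>
        .unit (.cases (.var 1 (hu ▸ hb))
          (.lam 2 fun _ hc => .inl (.unit (.var 2 hc)))
          (.lam 2 fun _ hc => .inr (.unit (.var 2 hc)))))
      (.bx fun W => .lam 0 fun _ ha => .kleisli 1 (.var 0 ha) fun _ hb => .cases (.var 1 hb)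
        (.lam 2 fun _ hc => .kleisli 3 (.var 2 hc) fun _ hd => .unit (.cast hu.symm
          (.inl (.var 3 hd))))
        (.lam 2 fun _ hc => .kleisli 3 (.var 2 hc) fun _ hd => .unit (.cast hu.symm
          (.inr (.var 3 hd)))))⟩

theorem exists_isPair (𝒦 : PCA ℕ) (hκ : κ.IsInaccessible) (g : Bool) :
    ∃ e, ∀ (ρ : ℕ → Dom κ) p x y, ρ p = op 𝒦 hκ (ρ x) (ρ y) → ∀ D,
      e ∈ mval 𝒦 (tr g (isPair p x y)) ρ D := by
  obtain ⟨e, he⟩ := exists_isUPair 𝒦 hκ g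
  exact ⟨𝒦.value _, fun ρ p x y hp D => value_mem <| .ex (up 𝒦 hκ (ρ x) (ρ x)) <|
    .ex (up 𝒦 hκ (ρ x) (ρ y)) <| .pair (.const (he _ _ _ _ rfl _)) <|
      .pair (.const (he _ _ _ _ rfl _)) (.const (he _ _ _ _ hp _))⟩

/-! ### Iterated quantifiers and conjunctions -/

/-- The sequence `ρ` with `cs` put in front. -/
def consN {N : Type*} (m : ℕ) (cs : Fin m → N) (ρ : ℕ → N) (j : ℕ) : N :=
  if h : j < m then cs ⟨j, h⟩ else ρ (j - m)

theorem scons_consN {N : Type*} (m : ℕ) (cs : Fin (m + 1) → N) (ρ : ℕ → N) :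
    scons (cs 0) (consN m (fun i => cs i.succ) ρ) = consN (m + 1) cs ρ := by
  funext j
  cases j with
  | zero => simp [scons, consN]
  | succ j => simp [scons, consN]

theorem consN_add {N : Type*} (m : ℕ) (cs : Fin m → N) (ρ : ℕ → N) (j : ℕ) :
    consN m cs ρ (j + m) = ρ j := by simp [consN]

theorem consN_fin {N : Type*} (m : ℕ) (cs : Fin m → N) (ρ : ℕ → N) (j : Fin m) :
    consN m cs ρ j = cs j := by simp [consN]

theorem tr_exN (g : Bool) (m : ℕ) (φ : Form) : tr g (exN m φ) = exN m (tr g φ) := by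
  induction m generalizing φ with
  | zero => rfl
  | succ m ih => rw [exN, ih, tr, exN]

theorem exists_exN (𝒦 : PCA ℕ) (m : ℕ) : ∃ e, ∀ (φ : Form) (ρ : ℕ → Dom κ) (cs : Fin m → Dom κ) D,
    e ∈ 𝒦.hImp (mval 𝒦 φ (consN m cs ρ) D) (mval 𝒦 (exN m φ) ρ D) := by
  induction m with
  | zero =>
    refine ⟨𝒦.value _, fun φ ρ cs D => value_mem <| .lam 0 fun _ ha => .var 0 (?_ : _ ∈ _)⟩
    have : consN 0 cs ρ = ρ := by funext j; simp [consN]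
    rwa [this] at ha
  | succ m ih =>
    obtain ⟨e, he⟩ := ih
    exact ⟨𝒦.value _, fun φ ρ cs D => value_mem <| .lam 0 fun _ ha =>
      .app (.const (he (ex φ) ρ (fun i => cs i.succ) D)) (.ex (cs 0)
        (.cast (by rw [scons_consN]) (.var 0 ha)))⟩

/-- The family over `ι` collects all assignments and arguments, so one realizer per conjunct, hence
one for the conjunction, serves them all. -/
theorem exists_conj (𝒦 : PCA ℕ) (g : Bool) {ι : Type*} (X : ι → Set ℕ) (ρ : ι → ℕ → Dom κ)
    (m : ℕ) (F : Fin m → Form)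
    (h : ∀ k, ∃ e, ∀ i D, e ∈ 𝒦.hImp (X i) (mval 𝒦 (tr g (F k)) (ρ i) D)) :
    ∃ e, ∀ i D, e ∈ 𝒦.hImp (X i) (mval 𝒦 (tr g (conj m F)) (ρ i) D) := by
  induction m with
  | zero => exact ⟨𝒦.value _, fun i D => value_mem <| .lam 0 fun _ _ => .bx fun Z => .lam 1
      fun _ ha => .var 1 ha⟩
  | succ m ih =>
    obtain ⟨e, he⟩ := h 0
    obtain ⟨f, hf⟩ := ih _ fun k => h k.succ
    exact ⟨𝒦.value _, fun i D => value_mem <| .lam 0 fun _ ha =>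
      .pair (.app (.const (he i D)) (.var 0 ha)) (.app (.const (hf i D)) (.var 0 ha))⟩

/-! ### The graphs of primitive recursive functions -/

/-- The course is taken over all of ω, not only up to the given argument. This suffices for
`PR.graph`, which asks only that each element be initial or justified by a predecessor in the set,
and it makes the witness independent of the argument of recursion. -/
theorem exists_course (𝒦 : PCA ℕ) (hκ : κ.IsInaccessible) (F : ℕ → ℕ) : ∃ s : Dom κ,
    ∀ m c, Dom.El m c s ↔
      ∃ i, m = 𝒦.numeral i ∧ c = op 𝒦 hκ (num 𝒦 hκ i) (num 𝒦 hκ (F i)) := by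
  obtain ⟨δ, hδ, h⟩ := Dom.exists_bound hκ (omega 𝒦 hκ) fun _ _ i =>
    op 𝒦 hκ (num 𝒦 hκ i) (num 𝒦 hκ (F i))
  refine Dom.exists_comprehension hκ _ hδ ?_
  rintro m c ⟨i, -, rfl⟩
  -- The bounded family depends only on its last argument, so any element of ω will do.
  exact h _ _ i ((el_omega hκ).2 ⟨0, rfl, rfl⟩)

/-- The course of a primitive recursion, as an element of the domain. -/
noncomputable def course (𝒦 : PCA ℕ) (hκ : κ.IsInaccessible) (F : ℕ → ℕ) : Dom κ :=
  (exists_course 𝒦 hκ F).choose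

theorem el_course (hκ : κ.IsInaccessible) {F : ℕ → ℕ} {m : ℕ} {c : Dom κ} :
    Dom.El m c (course 𝒦 hκ F) ↔
      ∃ i, m = 𝒦.numeral i ∧ c = op 𝒦 hκ (num 𝒦 hκ i) (num 𝒦 hκ (F i)) :=
  (exists_course 𝒦 hκ F).choose_spec m c

theorem exists_numeral_get (hK : IsKleeneFirst 𝒦) {n : ℕ} (i : Fin n) :
    ∃ e, ∀ v : List.Vector ℕ n, e ∈ 𝒦.hImp (cd v) {𝒦.numeral (v.get i)} :=
  exists_realizer hK (f := fun v : List.Vector ℕ n => 𝒦.numeral (v.get i))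
    ((computable_numeral hK).comp (Primrec.vector_get.comp .id (.const i)).to_comp)

/-- The graph of the function with the definition `c` is realized uniformly. -/
def GraphRealized (𝒦 : PCA ℕ) (hκ : κ.IsInaccessible) (g : Bool) {n : ℕ} (c : PR n)
    (xs : Fin n → ℕ) (y : ℕ) : Prop :=
  ∃ e, ∀ (ρ : ℕ → Dom κ) (v : List.Vector ℕ n), (∀ i, ρ (xs i) = num 𝒦 hκ (v.get i)) →
    ρ y = num 𝒦 hκ (c.eval v.get) → ∀ D, e ∈ 𝒦.hImp (cd v) (mval 𝒦 (tr g (c.graph xs y)) ρ D)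

theorem graphRealized_comp (hK : IsKleeneFirst 𝒦) (hκ : κ.IsInaccessible) (g : Bool) {m n : ℕ}
    (f : PR m) (h : Fin m → PR n) (hf : ∀ xs y, GraphRealized 𝒦 hκ g f xs y)
    (hh : ∀ i xs y, GraphRealized 𝒦 hκ g (h i) xs y) (xs : Fin n → ℕ) (y : ℕ) :
    GraphRealized 𝒦 hκ g (.comp f h) xs y := by
  let ι := {p : (ℕ → Dom κ) × List.Vector ℕ n // (∀ i, p.1 (xs i) = num 𝒦 hκ (p.2.get i)) ∧
    p.1 y = num 𝒦 hκ ((PR.comp f h).eval p.2.get)}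
  let δ (p : ι) : ℕ → Dom κ := consN m (fun k => num 𝒦 hκ ((h k).eval p.1.2.get)) p.1.1
  obtain ⟨e, he⟩ := exists_conj 𝒦 g (fun p : ι => cd p.1.2) δ m
    (fun i => (h i).graph (fun j => xs j + m) i) fun k => by
      obtain ⟨e, he⟩ := hh k (fun j => xs j + m) k
      exact ⟨e, fun p D => he (δ p) p.1.2 (fun i => (consN_add _ _ _ _).trans (p.2.1 i))
        (consN_fin _ _ _ _) D⟩
  obtain ⟨f', hf'⟩ := hf (fun i => i) (y + m)
  obtain ⟨q, hq⟩ := exists_exN (κ := κ) 𝒦 m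
  obtain ⟨r, hr⟩ := exists_realizer hK
    (Primrec.vector_ofFn fun i => (h i).primrec).to_comp
  refine ⟨𝒦.value _, fun ρ v hv hy D => value_mem <| .lam 0 fun _ ha =>
    .cast (X := mval 𝒦 (exN m (tr g (conj m (fun i => (h i).graph (fun j => xs j + m) i) ⩕
      f.graph (fun i => i) (y + m)))) ρ D) (by rw [← tr_exN]; rfl)
    (.app (.const (hq _ ρ _ D)) (.pair (.app (.const (he ⟨(ρ, v), hv, hy⟩ D)) (.var 0 ha))
      (.app (.const (hf' (δ ⟨(ρ, v), hv, hy⟩) _ (fun i => ?_) ?_ D))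
        (.app (.const (hr v)) (.var 0 ha)))))⟩
  · simp [δ, consN_fin]
  · rw [get_ofFn_eq]
    exact (consN_add _ _ _ _).trans hy

end Graph

end EpistemicSet

-- Realizing the graph of a primitive recursion.

namespace EpistemicSet

open Form PCA

section Recursion

variable {𝒦 : PCA ℕ} {κ : Cardinal.{u}}

/-- The witness is the full course. An element of it carries its argument as a numeral index, so a
case distinction on that numeral tells which disjunct of the recursion clause to realize, and the
predecessor supplies the index of the earlier pair. -/
theorem graphRealized_prec (hK : IsKleeneFirst 𝒦) (hκ : κ.IsInaccessible) (g : Bool) {n : ℕ}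
    (f : PR n) (h : PR (n + 2)) (hf : ∀ xs y, GraphRealized 𝒦 hκ g f xs y)
    (hh : ∀ xs y, GraphRealized 𝒦 hκ g h xs y) (xs : Fin (n + 1) → ℕ) (y : ℕ) :
    GraphRealized 𝒦 hκ g (.prec f h) xs y := by
  let L := equalityLaws 𝒦 hκ
  let F (v : List.Vector ℕ (n + 1)) (i : ℕ) : ℕ := (PR.prec f h).eval (i ::ᵥ v.tail).get
  have hFv (v : List.Vector ℕ (n + 1)) : F v (v.get 0) = (PR.prec f h).eval v.get := by
    simp only [F, List.Vector.get_zero, List.Vector.cons_head_tail]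
  obtain ⟨ef, hef⟩ := hf (fun k => xs k.succ + 4) 0
  obtain ⟨eh, heh⟩ := hh (Fin.cons 2 (Fin.cons 1 fun k => xs k.succ + 7)) 3
  obtain ⟨q, hq⟩ := exists_isPair 𝒦 hκ g
  obtain ⟨z, hz⟩ := exists_isEmpty 𝒦 hκ g
  obtain ⟨c, hc⟩ := exists_isSucc hK hκ g
  obtain ⟨e, he⟩ := exists_code_of_numeral hK
  obtain ⟨p, hp⟩ := exists_pairCode hK (α := ℕ) (β := List.Vector ℕ (n + 1))
  obtain ⟨l, hl⟩ := exists_realizer hK (f := fun v : List.Vector ℕ (n + 1) => v.tail)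
    Primrec.vector_tail.to_comp
  obtain ⟨r, hr⟩ := exists_realizer hK
    (f := fun p : ℕ × List.Vector ℕ (n + 1) => p.1 ::ᵥ F p.2 p.1 ::ᵥ p.2.tail)
    (Primrec.vector_cons.comp .fst (Primrec.vector_cons.comp
      ((PR.prec f h).primrec.comp (Primrec.vector_cons.comp .fst
        (Primrec.vector_tail.comp .snd))) (Primrec.vector_tail.comp .snd))).to_comp
  obtain ⟨o, ho⟩ := exists_numeral_get hK (0 : Fin (n + 1))
  let B : Form := ex (ex (ex (isSucc 4 2 ⩕ isPair 0 2 1 ⩕ mem 0 6 ⩕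
    h.graph (Fin.cons 2 (Fin.cons 1 fun k => xs k.succ + 7)) 3)))
  let A : Form := isEmpty 1 ⩕ f.graph (fun k => xs k.succ + 4) 0
  obtain ⟨s, hs⟩ := exists_subst_zero 𝒦 hκ (tr g (ex (ex (isPair 2 1 0 ⩕ (A ⩖ B)))))
  -- Indices 0 to 3 are the value, the argument, their ordered pair and the course.
  let δ (ρ : ℕ → Dom κ) (v : List.Vector ℕ (n + 1)) (i : ℕ) : ℕ → Dom κ :=
    scons (num 𝒦 hκ (F v i)) (scons (num 𝒦 hκ i) (scons
      (op 𝒦 hκ (num 𝒦 hκ i) (num 𝒦 hκ (F v i))) (scons (course 𝒦 hκ (F v)) ρ)))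
  have step : ∃ e, ∀ (ρ : ℕ → Dom κ) (v : List.Vector ℕ (n + 1)) (i : ℕ),
      (∀ k : Fin n, ρ (xs k.succ) = num 𝒦 hκ (v.get k.succ)) → ∀ D,
      e ∈ 𝒦.hImp (cd v) (𝒦.hImp {𝒦.numeral i} (mval 𝒦 (tr g (A ⩖ B)) (δ ρ v i) D)) := by
    refine ⟨𝒦.value _, fun ρ v i hρ D => value_mem <| .lam 0 fun _ ha => .lam 1 fun _ hb =>
      .natCases (.var 1 hb)
        (.lamAll 2 fun hi _ _ => .unit (.inl (.pair
          (.const (hz (δ ρ v i) 1 (congrArg (num 𝒦 hκ) hi) D))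
          (.app (.const (hef (δ ρ v i) v.tail (fun k => (hρ k).trans ?_) ?_ D))
            (.app (.const (hl v)) (.var 0 ha))))))
        (.lamAll 2 fun m _ hm => .unit (.inr (.ex (num 𝒦 hκ m) (.ex (num 𝒦 hκ (F v m))
          (.ex (op 𝒦 hκ (num 𝒦 hκ m) (num 𝒦 hκ (F v m))) (.pair
            (.app (.const (hc _ 4 2 m.1 (show num 𝒦 hκ i = _ from congrArg _ m.2) rfl D)) (.var 2 hm))
            (.pair (.const (hq _ 0 2 1 rfl D)) (.pair
              (.unit (.memVal ((el_course hκ).2 ⟨m, rfl, rfl⟩) (.var 2 hm)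
                (.const (L.refl_mem _))))
              (.app (.const (heh _ (m.1 ::ᵥ F v m ::ᵥ v.tail) ?_ ?_ D))
                (.app (.const (hr (m.1, v))) (.app (.const (hp _ _)) (.pair
                  (.app (.const (he _)) (.var 2 hm)) (.var 0 ha))))))))))))) ⟩
    · rw [get_tail_eq]
    · subst hi
      exact congrArg (num 𝒦 hκ) (PR.eval_prec_zero f h v.tail)
    · refine Fin.cases rfl (Fin.cases rfl fun k => ?_)
      simp only [get_cons_eq, Fin.cons_succ, get_tail_eq]
      exact hρ k
    · obtain ⟨m, rfl⟩ := m
      exact congrArg (num 𝒦 hκ) (PR.eval_prec_succ f h m v.tail)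
  obtain ⟨d, hd⟩ := step
  refine ⟨𝒦.value _, fun ρ v hv hy D => value_mem <| .lam 0 fun _ ha =>
    .ex (course 𝒦 hκ (F v)) (.pair
      (.bx fun Z => .all fun x => .bx fun W => .lam 1 fun _ hb => .elim 2 (.var 1 hb)
        fun _ (hb : _ ∈ memVal 𝒦 x (course 𝒦 hκ (F v))) => by
          obtain ⟨_, _, hx, hb'⟩ := exists_of_mem_memVal hκ hb
          obtain ⟨i, rfl, rfl⟩ := (el_course hκ).1 hx
          exact .app (.app (.const (hs (scons (course 𝒦 hκ (F v)) ρ) _ x W))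
            (.app (.const (L.symm_mem _ _)) (.snd (.var 2 hb'))))
            (.ex (num 𝒦 hκ i) (.ex (num 𝒦 hκ (F v i)) (.pair (.const (hq _ 2 1 0 rfl W))
              (.app (.app (.const (hd ρ v i (fun k => hv k.succ) W)) (.var 0 ha))
                (.fst (.var 2 hb')))))))
      (.ex (op 𝒦 hκ (num 𝒦 hκ (v.get 0)) (num 𝒦 hκ (F v (v.get 0)))) (.pair
        (.unit (.memVal ((el_course hκ).2 ⟨_, rfl, rfl⟩) (.app (.const (ho v)) (.var 0 ha))
          (.const (L.refl_mem _))))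
        (.const (hq _ 0 (xs 0 + 2) (y + 2) ?_ D)))))⟩
  change _ = op 𝒦 hκ (ρ (xs 0)) (ρ y)
  rw [hv, hy, ← hFv]
  rfl

/-- The values of primitive recursive functions satisfy their graphs. -/
theorem exists_graph (hK : IsKleeneFirst 𝒦) (hκ : κ.IsInaccessible) (g : Bool) {n : ℕ} (c : PR n)
    (xs : Fin n → ℕ) (y : ℕ) : GraphRealized 𝒦 hκ g c xs y := by
  induction c generalizing y with
  | zero =>
    obtain ⟨e, he⟩ := exists_isEmpty 𝒦 hκ g
    exact ⟨𝒦.value _, fun ρ v hv hy D => value_mem <| .lam 0 fun _ _ => .const (he ρ y hy D)⟩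
  | succ =>
    obtain ⟨e, he⟩ := exists_isSucc hK hκ g
    obtain ⟨o, ho⟩ := exists_numeral_get hK (0 : Fin 1)
    exact ⟨𝒦.value _, fun ρ v hv hy D => value_mem <| .lam 0 fun _ ha =>
      .app (.const (he ρ y _ _ hy (hv 0) D)) (.app (.const (ho v)) (.var 0 ha))⟩
  | proj i =>
    exact ⟨𝒦.value _, fun ρ v hv hy D => value_mem <| .lam 0 fun _ ha => .unit (.const
      (by rw [hy, hv]; exact (equalityLaws 𝒦 hκ).refl_mem _))⟩
  | comp f h ihf ihh => exact graphRealized_comp hK hκ g f h ihf ihh xs y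
  | prec f h ihf ihh => exact graphRealized_prec hK hκ g f h ihf ihh xs y

end Recursion

end EpistemicSet

-- Epistemic Church's Thesis.

namespace EpistemicSet

open Form PCA

section Church

variable {𝒦 : PCA ℕ} {κ : Cardinal.{u}}

theorem get_triple_eq (a b c : ℕ) : (a ::ᵥ b ::ᵥ c ::ᵥ List.Vector.nil).get = ![a, b, c] := by
  funext i
  match i with
  | 0 => rfl
  | 1 => rfl
  | 2 => rfl

theorem get_single_eq (a : ℕ) : (a ::ᵥ List.Vector.nil).get = ![a] := by
  funext i
  match i with
  | 0 => rfl

theorem exists_formT (K : KleenePredicates) (hK : IsKleeneFirst 𝒦) (hκ : κ.IsInaccessible)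
    (g : Bool) : ∃ e, ∀ (ρ : ℕ → Dom κ) (x n q : ℕ), ρ 3 = num 𝒦 hκ x → ρ 2 = num 𝒦 hκ n →
      ρ 0 = num 𝒦 hκ q → K.t.eval ![x, n, q] = 0 → ∀ D,
      e ∈ 𝒦.hImp (cd ((x, n), q)) (mval 𝒦 (tr g (K.formT 3 2 0)) ρ D) := by
  obtain ⟨z, hz⟩ := exists_isEmpty 𝒦 hκ g
  obtain ⟨e, he⟩ := exists_graph hK hκ g K.t ![3 + 1, 2 + 1, 0 + 1] 0
  obtain ⟨c, hc⟩ := exists_realizer hK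
    (f := fun p : (ℕ × ℕ) × ℕ => p.1.1 ::ᵥ p.1.2 ::ᵥ p.2 ::ᵥ List.Vector.nil)
    (Primrec.vector_cons.comp (Primrec.fst.comp .fst) (Primrec.vector_cons.comp
      (Primrec.snd.comp .fst) (Primrec.vector_cons.comp .snd (.const _)))).to_comp
  refine ⟨𝒦.value _, fun ρ x n q hx hn hq ht D => value_mem <| .lam 0 fun _ ha =>
    .ex (num 𝒦 hκ 0) (.pair (.const (hz (scons (num 𝒦 hκ 0) ρ) 0 rfl D))
      (.app (.const (he _ (x ::ᵥ n ::ᵥ q ::ᵥ List.Vector.nil) (fun i => ?_) ?_ D))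
        (.app (.const (hc ((x, n), q))) (.var 0 ha))))⟩
  · rw [get_triple_eq]
    match i with
    | 0 => exact hx
    | 1 => exact hn
    | 2 => exact hq
  · rw [get_triple_eq, ht]
    rfl

theorem exists_formU (K : KleenePredicates) (hK : IsKleeneFirst 𝒦) (hκ : κ.IsInaccessible)
    (g : Bool) : ∃ e, ∀ (ρ : ℕ → Dom κ) (q : ℕ), ρ 0 = num 𝒦 hκ q →
      ρ 1 = num 𝒦 hκ (K.u.eval ![q]) → ∀ D,
      e ∈ 𝒦.hImp (cd q) (mval 𝒦 (tr g (K.formU 0 1)) ρ D) := by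
  obtain ⟨e, he⟩ := exists_graph hK hκ g K.u ![0] 1
  obtain ⟨c, hc⟩ := exists_realizer hK (f := fun q : ℕ => q ::ᵥ List.Vector.nil)
    (Primrec.vector_cons.comp .id (.const _)).to_comp
  refine ⟨𝒦.value _, fun ρ q hq hm D => value_mem <| .lam 0 fun _ ha =>
    .app (.const (he ρ (q ::ᵥ List.Vector.nil) (fun i => ?_) ?_ D))
      (.app (.const (hc q)) (.var 0 ha))⟩
  · rw [get_single_eq]
    match i with
    | 0 => exact hq
  · rw [get_single_eq, hm]

/-- The search for a computation. -/
theorem exists_search (K : KleenePredicates) (hK : IsKleeneFirst 𝒦) :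
    ∃ e, ∀ x n m, m ∈ kleene x n → ∃ q, K.t.eval ![x, n, q] = 0 ∧ K.u.eval ![q] = m ∧
      e ∈ 𝒦.hImp (cd (x, n)) (cd q) := by
  have h0 : Primrec fun p : (ℕ × ℕ) × ℕ =>
      p.1.1 ::ᵥ p.1.2 ::ᵥ p.2 ::ᵥ (List.Vector.nil : List.Vector ℕ 0) :=
    Primrec.vector_cons.comp (Primrec.fst.comp .fst) (Primrec.vector_cons.comp
      (Primrec.snd.comp .fst) (Primrec.vector_cons.comp .snd (.const _)))
  have h1 : Computable₂ fun (p : ℕ × ℕ) (q : ℕ) => decide (K.t.eval ![p.1, p.2, q] = 0) :=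
    (((Primrec.eq.comp (K.t.primrec.comp h0) (.const 0)).decide).of_eq
      fun p => by simp only [get_triple_eq]).to_comp
  obtain ⟨e, he⟩ := exists_realizer_partrec hK (Partrec.rfind h1.partrec₂)
  refine ⟨e, fun x n m hm => ?_⟩
  obtain ⟨q', hq', -⟩ := (K.normalForm x n m).1 hm
  have hd : (Nat.rfind fun q => (Part.some (decide (K.t.eval ![x, n, q] = 0)) : Part Bool)).Dom :=
    Nat.rfind_dom'.2 ⟨q', by simpa using hq', by simp⟩
  obtain ⟨q, hq⟩ := Part.dom_iff_mem.1 hd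
  have ht : K.t.eval ![x, n, q] = 0 := by simpa using (Nat.mem_rfind.1 hq).1
  -- The computation found by the search may differ from `q'`, but its output is again a value of
  -- `kleene x n`, hence equal to `m`.
  exact ⟨q, ht, Part.mem_unique ((K.normalForm x n _).2 ⟨q, ht, rfl⟩) hm, he (x, n) q hq⟩

/-- The boxed hypothesis yields one number working for every answer set. Evaluated at a set that
records the witness and its realizer, it loses all double negations and becomes an honest program,
whose index is the required `e`. -/
theorem exists_ectAt (K : KleenePredicates) (hK : IsKleeneFirst 𝒦) (hκ : κ.IsInaccessible)
    (g : Bool) (φ : Form) : ∃ e, ∀ (ρ : ℕ → Dom κ) D,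
      e ∈ mval 𝒦 (ectAt (fun e n q => tr g (K.formT e n q)) (fun q m => tr g (K.formU q m)) φ)
        (scons (omega 𝒦 hκ) ρ) D := by
  let L := equalityLaws 𝒦 hκ
  obtain ⟨t, ht⟩ := exists_formT K hK hκ g
  obtain ⟨o, ho⟩ := exists_formU K hK hκ g
  obtain ⟨f, hf⟩ := exists_search K hK
  obtain ⟨c, hc⟩ := exists_numeral_of_code hK
  obtain ⟨d, hd⟩ := exists_code_of_numeral hK
  obtain ⟨p, hp⟩ := exists_pairCode hK (α := ℕ) (β := ℕ)
  obtain ⟨p', hp'⟩ := exists_pairCode hK (α := ℕ × ℕ) (β := ℕ)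
  obtain ⟨s, hs⟩ := exists_subst_zero 𝒦 hκ φ
  obtain ⟨s', hs'⟩ := exists_subst_zero 𝒦 hκ (ex (mem 0 3 ⩕ ex (mem 0 4 ⩕ tr g (K.formT 3 2 0) ⩕
    tr g (K.formU 0 1) ⩕ box (φ.ren (scons 1 (scons 2 (· + 4)))))))
  have hren (q m n x : Dom κ) (ρ : ℕ → Dom κ) (Z : Set ℕ) :
      mval 𝒦 (φ.ren (scons 1 (scons 2 (· + 4)))) (scons q (scons m (scons n (scons x ρ)))) Z =
        mval 𝒦 φ (scons m (scons n ρ)) Z :=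
    val_ren_eq φ (fun j => match j with | 0 => rfl | 1 => rfl | j + 2 => rfl) Z
  exact ⟨𝒦.value _, fun ρ D => value_mem <| .lam 0 fun _ ha => .boxElim 1 (.var 0 ha) fun _ hr =>
    .bind 2 (X := {G | ∀ n, G ∈ 𝒦.hImp (cd n) (⋃ m, 𝒦.hAnd {𝒦.numeral m}
        (⋂ W, mval 𝒦 φ (scons (num 𝒦 hκ m) (scons (num 𝒦 hκ n) (scons (omega 𝒦 hκ) ρ))) W))})
      (.lamAll 3 fun n _ hn => by
        -- The answer set is the set of desired outputs for `n`; the nested double negations of ∃, ∈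
        -- and □ are then all removed by `extract`.
        let T : Set ℕ := ⋃ m, 𝒦.hAnd {𝒦.numeral m}
          (⋂ W, mval 𝒦 φ (scons (num 𝒦 hκ m) (scons (num 𝒦 hκ n) (scons (omega 𝒦 hκ) ρ))) W)
        exact .extract (.mp (E := eqVal 𝒦) (M := memVal 𝒦) (φ := mem 0 1)
          (ψ := ex (mem 0 2 ⩕ box φ)) (ρ := scons (num 𝒦 hκ n) (scons (omega 𝒦 hκ) ρ))
          (.allElim (.var 1 (hr T)) (num 𝒦 hκ n))
          (.unit (.memVal ((el_omega hκ).2 ⟨n, rfl, rfl⟩) (.app (.const (hc n)) (.var 3 hn))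
            (.const (L.refl_mem _))))) 4 fun _ hb => by
          obtain ⟨y, hy⟩ := Set.mem_iUnion.1 hb
          exact .extract (.fst (.var 4 hy)) 5 fun _ he => by
            obtain ⟨m, hm⟩ := exists_of_mem_omega hκ he
            exact .extract (.snd (.var 4 hy)) 6 fun _ hφ => .iUnion m (.pair (.fst (.var 5 hm))
              (.iInter fun W => .app (.app (.const (hs _ y _ W)) (.snd (.var 5 hm)))
                (.var 6 (Set.mem_iInter.1 hφ W)))))
      fun G hG => by
        -- The program `G` is a fixed number and has one output per input, so `m` and the realizer
        -- `s` are functions of `n`.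
        have hG' (n : ℕ) : ∃ m s, (∀ W, s ∈ mval 𝒦 φ (scons (num 𝒦 hκ m)
            (scons (num 𝒦 hκ n) (scons (omega 𝒦 hκ) ρ))) W) ∧
            G ∈ 𝒦.hImp (cd n) (𝒦.hAnd {𝒦.numeral m} {s}) := by
          obtain ⟨b, hb, hb'⟩ := hG n n rfl
          obtain ⟨m, _, hm, s, hs, rfl⟩ := Set.mem_iUnion.1 hb'
          refine ⟨m, s, Set.mem_iInter.1 hs, ?_⟩
          rintro _ rfl
          exact ⟨_, hb, _, hm, s, rfl, rfl⟩
        choose m s hs hm using hG'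
        -- Here `x` is `G` followed by the decoding of the first component, an index of the function
        -- `m`. Application in the first Kleene algebra is `kleene`, so `x` can be taken as the
        -- witness for `e`.
        exact .bind 3 (X := {x | ∀ n, x ∈ 𝒦.hImp (cd n) (cd (m n))})
          (.lamAll 4 fun n _ hn => .app (.const (hd _)) (.fst (.app (.var 2 (hm n)) (.var 4 hn))))
          fun x hx => by
            have hx' (n : ℕ) : m n ∈ kleene x n := by
              obtain ⟨b, hb, rfl⟩ := hx n n rfl
              rwa [hK] at hb
            choose q hqt hqu hq using fun n => hf x n (m n) (hx' n)
            exact .ex (num 𝒦 hκ x) (.pair (.unit (.memVal ((el_omega hκ).2 ⟨x, rfl, rfl⟩)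
              (.app (.const (hc x)) (.var 3 rfl)) (.const (L.refl_mem _)))) (.box fun Z =>
                .all fun y => .lam 4 fun _ hy => .elim 5 (.var 4 hy) fun _ hy' => by
                  obtain ⟨n, hn⟩ := exists_of_mem_omega hκ hy'
                  exact .bind 6 (.app (.const (hd n)) (.fst (.var 5 hn))) fun _ hn' =>
                    .bind 7 (.app (.const (hp x n)) (.pair (.var 3 rfl) (.var 6 hn'))) fun _ hxn =>
                    .bind 8 (.app (.const (hq n)) (.var 7 hxn)) fun _ hq' =>
                    .app (.app (.const (hs' _ (num 𝒦 hκ n) y Z))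
                      (.app (.const (L.symm_mem _ _)) (.snd (.var 5 hn))))
                    (.ex (num 𝒦 hκ (m n)) (.pair
                      (.unit (.memVal ((el_omega hκ).2 ⟨m n, rfl, rfl⟩)
                        (.fst (.app (.var 2 (hm n)) (.var 6 hn'))) (.const (L.refl_mem _))))
                      (.ex (num 𝒦 hκ (q n)) (.pair
                        (.unit (.memVal ((el_omega hκ).2 ⟨q n, rfl, rfl⟩)
                          (.app (.const (hc _)) (.var 8 hq')) (.const (L.refl_mem _))))
                        (.pair (.app (.const (ht _ x n (q n) rfl rfl rfl (hqt n) Z))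
                          (.app (.const (hp' _ _)) (.pair (.var 7 hxn) (.var 8 hq'))))
                        (.pair (.app (.const (ho _ (q n) rfl
                          (show num 𝒦 hκ (m n) = _ from congrArg _ (hqu n).symm) Z)) (.var 8 hq'))
                          (.box fun W => .cast (hren _ _ _ _ _ _).symm
                            (.mono (.snd (.app (.var 2 (hm n)) (.var 6 hn')))
                              (Set.singleton_subset_iff.2 (hs n W))))))))))))⟩

end Church

end EpistemicSet

-- Stability, failure of negated stability, and conclusion.

namespace EpistemicSet

open Form PCA

section Model

variable {𝒦 : PCA ℕ} {κ : Cardinal.{u}}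

theorem valid_eq_stable (𝒦 : PCA ℕ) (κ : Cardinal.{u}) :
    McCartyValid 𝒦 κ (box (all (all (eq 1 0 ⟹ box (eq 1 0))))) :=
  valid_iff.2 ⟨𝒦.value _, fun _ _ => value_mem <| .box fun _ => .all fun _ => .all fun _ =>
    .lam 0 fun _ ha => .elim 1 (.var 0 ha) fun _ hb => .box fun _ => .unit (.var 1 hb)⟩

theorem valid_mem_stable (𝒦 : PCA ℕ) (κ : Cardinal.{u}) :
    McCartyValid 𝒦 κ (box (all (all (mem 1 0 ⟹ box (mem 1 0))))) :=
  valid_iff.2 ⟨𝒦.value _, fun _ _ => value_mem <| .box fun _ => .all fun _ => .all fun _ =>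
    .lam 0 fun _ ha => .elim 1 (.var 0 ha) fun _ hb => .box fun _ => .unit (.var 1 hb)⟩

/-- No number realizes the stability of negated atomic formulas for all parameters `Z`. -/
theorem notMem_stability_eq_empty (𝒦 : PCA ℕ) (hκ : κ.IsInaccessible) (ρ : ℕ → Dom κ) :
    ⋂ Z, mval 𝒦 (all (all (neg (mem 0 1) ⟹ box (neg (mem 0 1))))) ρ Z = ∅ := by
  refine Set.eq_empty_of_forall_notMem fun r hr => ?_
  -- One number realizes y ∉ x in both situations below: at D = {0} since the constant function 0
  -- always ends in `D`, and for x = 0 since the membership value is empty.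
  obtain ⟨a, ha⟩ : ∃ a, ∀ X Z, 𝒦.ka 0 ∈ 𝒦.hImp X Z →
      a ∈ 𝒦.hImp (𝒦.ominus Z X) (𝒦.ominus Z ∅) :=
    ⟨𝒦.value _, fun X Z h => value_mem <| .lam 0 fun _ hb => .lam 1 fun _ _ =>
      .app (.var 0 hb) (.const h)⟩
  have hr' (x y : Dom κ) (Z : Set ℕ) : r ∈ 𝒦.hImp
      (𝒦.hImp (𝒦.ominus Z (memVal 𝒦 y x)) (𝒦.ominus Z ∅))
      (𝒦.ominus Z (⋂ W, 𝒦.hImp (𝒦.ominus W (memVal 𝒦 y x)) (𝒦.ominus W ∅))) :=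
    Set.mem_iInter.1 (Set.mem_iInter.1 (Set.mem_iInter.1 hr Z) x) y
  have hm : 𝒦.value (𝒦.tPair (.const (𝒦.numeral 0)) (.const (equalityLaws 𝒦 hκ).refl)) ∈
      memVal 𝒦 (num 𝒦 hκ 0) (num 𝒦 hκ 1) :=
    value_mem <| .memVal ((el_num hκ).2 ⟨0, by omega, rfl, rfl⟩) (.const rfl)
      (.const ((equalityLaws 𝒦 hκ).refl_mem _))
  -- The same `r` applied to the same `a` gives the same output in both cases, although the
  -- parameters and answer sets differ.
  obtain ⟨c, hc, hc'⟩ := hr' (num 𝒦 hκ 1) (num 𝒦 hκ 0) {0} a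
    (ha _ _ fun b _ => ⟨0, by rw [app_ka]; exact Part.mem_some _, rfl⟩)
  obtain ⟨d, hd, hd'⟩ := hr' (num 𝒦 hκ 0) (num 𝒦 hκ 0) {1} a
    (ha _ _ fun b hb => by rw [memVal_num_zero] at hb; exact hb.elim)
  obtain rfl := Part.mem_unique hc hd
  -- As 0 ∈ 1 is realized, nothing realizes 0 ∉ 1 at W = ∅, so the intersection is empty and `ka 1`
  -- is vacuously a continuation into {0}.
  obtain ⟨v, hv, rfl⟩ := hc' (𝒦.ka 1) fun b hb => by
    obtain ⟨f, -, hf⟩ := Set.mem_iInter.1 hb ∅ (𝒦.value (𝒦.tUnit (.const _)))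
      (value_mem (.unit (.const hm)))
    obtain ⟨_, -, h⟩ := hf 0 fun _ h => h.elim
    exact h.elim
  -- At D = {1} the number `ka 1` is a genuine continuation, so the common output sends it to 1,
  -- whereas before it sent it to 0.
  obtain ⟨w, hw, rfl⟩ := hd' (𝒦.ka 1) fun b _ => ⟨1, by rw [app_ka]; exact Part.mem_some _, rfl⟩
  exact zero_ne_one (Part.mem_unique hv hw)

theorem valid_neg_notMemStability (𝒦 : PCA ℕ) (hκ : κ.IsInaccessible) :
    McCartyValid 𝒦 κ (neg notMemStability) :=
  valid_iff.2 ⟨𝒦.value _, fun ρ _ => value_mem <| .lam 0 fun _ ha => .kleisli 1 (.var 0 ha)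
    fun _ hb =>
      .var 1 (Set.notMem_empty _ (notMem_stability_eq_empty 𝒦 hκ ρ ▸ hb)).elim⟩

theorem not_valid_notMemStability (𝒦 : PCA ℕ) (hκ : κ.IsInaccessible) :
    ¬ McCartyValid 𝒦 κ notMemStability := by
  intro h
  have := Dom.nonempty hκ
  refine not_valid_bot ((equalityLaws 𝒦 hκ).sound (Ax := {notMemStability, neg notMemStability})
    ?_ (.mp (.ax (.inr rfl)) (.ax (.inl rfl))))
  rintro _ (rfl | rfl)
  · exact h
  · exact valid_neg_notMemStability 𝒦 hκ

theorem validAt_of_realizer {w : Dom κ} {φ : Form} {e : ℕ}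
    (he : ∀ ρ D, e ∈ mval 𝒦 φ (scons w ρ) D) : McCartyValidAt 𝒦 κ w φ := by
  refine ⟨𝒦.ka e, fun ρ hρ D a _ => ⟨e, by rw [app_ka]; exact Part.mem_some _, ?_⟩⟩
  have : ρ = scons w fun i => ρ (i + 1) := by
    funext i
    cases i with
    | zero => exact hρ
    | succ i => rfl
  rw [this]
  exact he _ D

theorem exists_of_mem_ectInstances (K : KleenePredicates) (hK : IsKleeneFirst 𝒦)
    (hκ : κ.IsInaccessible) {χ : Form} (hχ : χ ∈ ectInstances K) :
    ∃ e, ∀ ρ D, e ∈ mval 𝒦 χ (scons (omega 𝒦 hκ) ρ) D := by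
  obtain ⟨φ, rfl | rfl⟩ := hχ
  · simpa only [tr_false] using exists_ectAt K hK hκ false φ
  · simpa only [tr_true] using exists_ectAt K hK hκ true φ

/-- A realizer of Ω(w) is converted into one of w = ω̄, and the instance for ω̄ is transported by
substitution. -/
theorem valid_ECT (K : KleenePredicates) (hK : IsKleeneFirst 𝒦) (hκ : κ.IsInaccessible)
    {φ : Form} (hφ : φ ∈ ECT K) : McCartyValid 𝒦 κ φ := by
  obtain ⟨χ, hχ, rfl⟩ := hφ
  let L := equalityLaws 𝒦 hκ
  obtain ⟨e, he⟩ := exists_of_mem_ectInstances K hK hκ hχ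
  obtain ⟨f, hf⟩ := exists_eq_omega hK hκ
  obtain ⟨s, hs⟩ := exists_subst_zero 𝒦 hκ χ
  exact valid_iff.2 ⟨𝒦.value _, fun ρ D => value_mem <| .all fun w => .lam 0 fun _ ha =>
    .boxElim 1 (.var 0 ha) fun _ hb => .app (.app (.const (hs ρ (omega 𝒦 hκ) w D))
      (.app (.const (L.symm_mem _ _)) (.app (.const (hf (scons w ρ)))
        (.var 1 (Set.mem_iInter.2 hb))))) (.const (he ρ D))⟩

theorem valid_axioms (K : KleenePredicates) (hK : IsKleeneFirst 𝒦) (hκ : κ.IsInaccessible)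
    {φ : Form} (hφ : φ ∈ eZF ∪ ECT K ∪ atomicStability) : McCartyValid 𝒦 κ φ := by
  rcases hφ with ((((hφ | ⟨φ, rfl⟩) | ⟨φ, rfl⟩) | ⟨φ, rfl⟩) | hφ) | rfl | rfl
  · rcases hφ with rfl | rfl | rfl | rfl | rfl
    · exact valid_modalExt 𝒦 hκ
    · exact valid_pairing 𝒦 hκ
    · exact valid_unions 𝒦 hκ
    · exact valid_modalPower 𝒦 hκ
    · exact valid_infinity hK hκ
  · exact valid_modalFoundation 𝒦 hκ φ
  · exact valid_boxComprehension 𝒦 hκ φ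
  · exact valid_boxCollection 𝒦 hκ φ
  · exact valid_ECT K hK hκ hφ
  · exact valid_eq_stable 𝒦 κ
  · exact valid_mem_stable 𝒦 κ

theorem consistent_axioms (K : KleenePredicates) (hK : IsKleeneFirst 𝒦) (hκ : κ.IsInaccessible) :
    Consistent (eZF ∪ ECT K ∪ atomicStability ∪ {neg notMemStability}) := by
  intro h
  have := Dom.nonempty hκ
  refine not_valid_bot ((equalityLaws 𝒦 hκ).sound ?_ h)
  rintro φ (hφ | rfl)
  · exact valid_axioms K hK hκ hφ
  · exact valid_neg_notMemStability 𝒦 hκ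

end Model

end EpistemicSet

theorem theorem1p4 (K : EpistemicSet.KleenePredicates) :
    EpistemicSet.Consistent
      (EpistemicSet.eZF ∪ EpistemicSet.ECT K ∪ EpistemicSet.atomicStability ∪
        {EpistemicSet.Form.neg EpistemicSet.notMemStability}) ∧
    ∀ 𝒦 : EpistemicSet.PCA ℕ, EpistemicSet.IsKleeneFirst 𝒦 →
      ∀ κ : Cardinal.{u}, κ.IsInaccessible →
        (∀ φ ∈ EpistemicSet.eZF ∪ EpistemicSet.ECT K ∪ EpistemicSet.atomicStability,
          EpistemicSet.McCartyValid 𝒦 κ φ) ∧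
        EpistemicSet.McCartyValid 𝒦 κ (EpistemicSet.Form.neg EpistemicSet.notMemStability) ∧
        ¬ EpistemicSet.McCartyValid 𝒦 κ EpistemicSet.notMemStability ∧
        ∃ w : EpistemicSet.Dom κ, w.1 = EpistemicSet.omegaBar 𝒦 ∧
          EpistemicSet.McCartyValidAt 𝒦 κ w (EpistemicSet.isOmega 0) ∧
          ∀ φ ∈ EpistemicSet.ectInstances K, EpistemicSet.McCartyValidAt 𝒦 κ w φ := by
  constructor
  · obtain ⟨𝒦, hK⟩ := EpistemicSet.exists_isKleeneFirst
    -- Consistency is to hold outright, so an inaccessible cardinal must be supplied: the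
    -- cardinality of a type universe, seen in the next one.
    exact EpistemicSet.consistent_axioms K hK Cardinal.IsInaccessible.univ.{0, 1}
  · intro 𝒦 hK κ hκ
    refine ⟨fun φ hφ => EpistemicSet.valid_axioms K hK hκ hφ,
      EpistemicSet.valid_neg_notMemStability 𝒦 hκ, EpistemicSet.not_valid_notMemStability 𝒦 hκ,
      EpistemicSet.omega 𝒦 hκ, rfl, ?_, fun φ hφ => ?_⟩
    · obtain ⟨e, he⟩ := EpistemicSet.exists_isOmega hK hκ 0
      exact EpistemicSet.validAt_of_realizer fun ρ D => he _ rfl D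
    · obtain ⟨e, he⟩ := EpistemicSet.exists_of_mem_ectInstances K hK hκ hφ
      exact EpistemicSet.validAt_of_realizer he
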